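/- Let $k$ be a field and let $G \to \operatorname{Spec} k$ be a finite group scheme. Say that $G$ is \emph{linearly reductive} if the functor $V \mapsto V^G$, from $G$-equivariant quasi-coherent sheaves on $\operatorname{Spec} k$ (that is, $k$-vector spaces with a coaction $V \to V\otimes_k \mathcal{O}(G)$) to $k$-vector spaces, is exact. Call a group scheme over a scheme $S$ \emph{well-split} if it is isomorphic to a semidirect product $H \ltimes \Delta$, where $H$ is the constant group scheme attached to a finite group whose order is prime to all residue characteristics of $S$ ("constant and tame"), and $\Delta$ is finite diagonalizable, that is, the Cartier dual of the constant group scheme attached to a finite abelian group. Call it \emph{locally well-split} if there is an fpqc cover $\{S_i \to S\}$ such that $S_i \times_S G \to S_i$ is well-split for every $i$. Then $G$ is linearly reductive if and only if it is locally well-split. Moreover, if $k$ is algebraically closed, then $G$ is locally well-split if and only if it is well-split. -/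

import Mathlib

open CategoryTheory Limits Opposite AlgebraicGeometry
open scoped TensorProduct CategoryTheory.MonObj

universe u

noncomputable section

namespace LinRed

/-! ### Representations, as comodules, and linear reductivity -/

section Representations

variable (R : Type*) [CommRing R] (A : Type*) [CommRing A] [Bialgebra R A]

/-- A (right) coaction `V → V ⊗ A` of the bialgebra `A` on the module `V`.  If `A` is the Hopf
algebra of functions of an affine group scheme `G` over `R`, this is a linear (left) action of `G`
on the quasi-coherent sheaf given by `V`. -/
structure Coaction (V : Type*) [AddCommGroup V] [Module R V] where
  /-- The coaction map. -/
  toLin : V →ₗ[R] V ⊗[R] A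
  /-- `(id ⊗ Δ) ∘ ρ = (ρ ⊗ id) ∘ ρ`. -/
  coassoc : Coalgebra.comul.lTensor V ∘ₗ toLin =
    (TensorProduct.assoc R V A A).toLinearMap ∘ₗ toLin.rTensor A ∘ₗ toLin
  /-- `(id ⊗ ε) ∘ ρ = id`. -/
  counit : (TensorProduct.rid R V).toLinearMap ∘ₗ Coalgebra.counit.lTensor V ∘ₗ toLin =
    LinearMap.id

end Representations

section Invariants

variable {R : Type*} [CommRing R] {A : Type*} [CommRing A] [Bialgebra R A]

/-- The invariants `V^G`: the kernel of `ρ - ι`, where `ι v = v ⊗ 1` is the trivial coaction. -/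
def Coaction.invariants {V : Type*} [AddCommGroup V] [Module R V] (ρ : Coaction R A V) :
    Submodule R V :=
  LinearMap.ker (ρ.toLin - (TensorProduct.mk R V A).flip 1)

/-- `f` commutes with the coactions. -/
def Coaction.IsEquivariant {V W : Type*} [AddCommGroup V] [Module R V] [AddCommGroup W]
    [Module R W] (ρ : Coaction R A V) (σ : Coaction R A W) (f : V →ₗ[R] W) : Prop :=
  σ.toLin ∘ₗ f = f.rTensor A ∘ₗ ρ.toLin

/-- The map `V^G → W^G` induced by an equivariant map `V → W`. -/
def Coaction.IsEquivariant.mapInvariants {V W : Type*} [AddCommGroup V] [Module R V]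
    [AddCommGroup W] [Module R W] {ρ : Coaction R A V} {σ : Coaction R A W} {f : V →ₗ[R] W}
    (hf : ρ.IsEquivariant σ f) : ρ.invariants →ₗ[R] σ.invariants :=
  f.restrict fun v hv => by
    have h : ρ.toLin v = v ⊗ₜ[R] (1 : A) := by
      simpa [Coaction.invariants, sub_eq_zero] using hv
    have h2 : σ.toLin (f v) = f.rTensor A (ρ.toLin v) := LinearMap.congr_fun hf v
    simp [Coaction.invariants, h2, h]

end Invariants

/-- An affine group scheme `G → Spec R` is linearly reductive if the functor `V ↦ V^G`, from
`G`-equivariant quasi-coherent sheaves on `Spec R` (that is, `R`-modules with a coaction of the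
Hopf algebra of functions of `G`) to quasi-coherent sheaves on `Spec R` (that is, `R`-modules),
is exact. -/
def IsLinearlyReductive (R : CommRingCat.{u}) (G : Scheme.{u}) [G.Over (Spec R)]
    [GrpObj (G.asOver (Spec R))] [IsAffineHom (G ↘ Spec R)] : Prop :=
  haveI : IsAffine G := isAffine_of_isAffineHom (G ↘ Spec R)
  ∀ (V₁ V₂ V₃ : Type u) [AddCommGroup V₁] [AddCommGroup V₂] [AddCommGroup V₃]
    [Module R V₁] [Module R V₂] [Module R V₃]
    (ρ₁ : Coaction R Γ(G, ⊤) V₁) (ρ₂ : Coaction R Γ(G, ⊤) V₂) (ρ₃ : Coaction R Γ(G, ⊤) V₃)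
    (f : V₁ →ₗ[R] V₂) (g : V₂ →ₗ[R] V₃)
    (hf : ρ₁.IsEquivariant ρ₂ f) (hg : ρ₂.IsEquivariant ρ₃ g),
    Function.Injective f → Function.Exact f g → Function.Surjective g →
      Function.Injective hf.mapInvariants ∧
      Function.Exact hf.mapInvariants hg.mapInvariants ∧
      Function.Surjective hg.mapInvariants

/-! ### Constant, diagonalizable and well-split group schemes -/

section WellSplit

variable (S : Scheme.{u})

/-- The functor of points of the constant group scheme `S × Γ` over `S`: its `T`-points are the
locally constant functions `T → Γ`. -/
def constantFunctor (Γ : Type u) [Group Γ] : (Over S)ᵒᵖ ⥤ GrpCat.{u} where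
  obj T := GrpCat.of (LocallyConstant T.unop.left Γ)
  map f := GrpCat.ofHom (LocallyConstant.comapMonoidHom f.unop.left.base.hom)

/-- The functor of points of the Cartier dual `Hom(M_S, 𝔾_m)` of the constant group scheme given by
the abelian group `M`: its `T`-points are the homomorphisms from `M` to the units of `Γ(T, 𝒪_T)`. -/
def cartierDualFunctor (M : Type u) [CommGroup M] : (Over S)ᵒᵖ ⥤ GrpCat.{u} where
  obj T := GrpCat.of (M →* Γ(T.unop.left, ⊤)ˣ)
  map f := GrpCat.ofHom (MonoidHom.compHom (Units.map f.unop.left.appTop.hom.toMonoidHom))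

variable {S}

/-- `H` is (isomorphic to) the constant group scheme over `S` attached to the finite group `Γ`,
and it is tame: its degree, the order of `Γ`, is prime to every (positive) residue characteristic
of `S`. -/
def IsTameConstant (H : Over S) [GrpObj H] : Prop :=
  ∃ (Γ : Type u) (_ : Group Γ) (_ : Finite Γ), Nonempty (yonedaGrpObj H ≅ constantFunctor S Γ) ∧
    ∀ s : S, (Nat.card Γ : S.residueField s) ≠ 0

/-- `Δ` is a finite diagonalizable group scheme over `S`: the Cartier dual of a constant finite
abelian group scheme. -/
def IsDiagonalizable (Δ : Over S) [GrpObj Δ] : Prop :=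
  ∃ (M : Type u) (_ : CommGroup M) (_ : Finite M),
    Nonempty (yonedaGrpObj Δ ≅ cartierDualFunctor S M)

/-- An action of the group scheme `H` on the group scheme `Δ` by group automorphisms. -/
structure GroupAction (H Δ : Over S) [GrpObj H] [GrpObj Δ] where
  /-- The action of `H(T)` on the group `Δ(T)`. -/
  act (T : Over S) : (T ⟶ H) →* MulAut (T ⟶ Δ)
  /-- The action is functorial in `T`. -/
  naturality {T T' : Over S} (t : T' ⟶ T) (h : T ⟶ H) (d : T ⟶ Δ) :
    t ≫ act T h d = act T' (t ≫ h) (t ≫ d)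

/-- The functor of points `T ↦ Δ(T) ⋊ H(T)` of the semidirect product `H ⋉ Δ`. -/
def semidirectFunctor {H Δ : Over S} [GrpObj H] [GrpObj Δ] (φ : GroupAction H Δ) :
    (Over S)ᵒᵖ ⥤ GrpCat.{u} where
  obj T := GrpCat.of ((T.unop ⟶ Δ) ⋊[φ.act T.unop] (T.unop ⟶ H))
  map t := GrpCat.ofHom (SemidirectProduct.map
    ((yonedaGrpObj Δ).map t).hom ((yonedaGrpObj H).map t).hom fun h => by
      refine MonoidHom.ext fun d => ?_
      exact φ.naturality t.unop h d)

/-- `G` is well-split: isomorphic to a semidirect product `H ⋉ Δ` with `H` constant and tame and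
`Δ` diagonalizable. -/
def IsWellSplit (G : Over S) [GrpObj G] : Prop :=
  ∃ (H Δ : Over S) (_ : GrpObj H) (_ : GrpObj Δ) (φ : GroupAction H Δ),
    IsTameConstant H ∧ IsDiagonalizable Δ ∧ Nonempty (yonedaGrpObj G ≅ semidirectFunctor φ)

/-- `G` is locally well-split: it becomes well-split on each member of some fpqc cover of `S`. -/
def IsLocallyWellSplit (S : Scheme.{u}) (G : Scheme.{u}) [G.Over S] [GrpObj (G.asOver S)] : Prop :=
  ∃ 𝒰 : Scheme.Cover.{u} Scheme.fpqcPrecoverage S,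
    ∀ i : 𝒰.I₀, IsWellSplit ((pullback (G ↘ S) (𝒰.f i)).asOver (𝒰.X i))

end WellSplit

end LinRed

end

/-! Write `G = Spec A` with `A` a finite-dimensional Hopf algebra. The pivot between the two
conditions is a normalized invariant integral: a linear form `I` on `A` with `I 1 = 1` and `a₁ I(a₂)
= I(a) 1`. Such an `I` gives a natural projection `v ↦ v₀ I(v₁)` onto invariants, so invariants are
exact (`IsNormalizedIntegral.invariantsExact`). Conversely, exactness applied to evaluation at `1`,
from the dual of `A` onto `k`, lifts `1` to an invariant form, which is an integral
(`InvariantsExact.exists_isNormalizedIntegral`). Integrals survive extension of the base field.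

Let `k` be algebraically closed and let `I` be an integral. An idempotent `f` cuts out the identity
component `G⁰ = Spec A/(f)`. The translates of `1 - f` by `G(k)` sum to `1`, so `|G(k)| I(1 - f) =
1`: the component group is tame, and `I` restricts to an integral on `G⁰`.

The core is that `G⁰` is diagonalizable. In characteristic zero its Lie algebra vanishes. In
characteristic `p`, an element `x ≠ 0` with `x ^ p = 0` would put `1` in the image of an invariant
derivation, on which `I` is zero. A restricted Lie algebra without such elements is abelian
(`commute_of_no_nilpotent`), and the adjoint action of `G⁰` on it is trivial (`IsInf.commute_univ`).
Conjugation on the functions of `G⁰` is then trivial modulo higher powers of the augmentation ideal,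
hence trivial by averaging, so `G⁰` is commutative (`IsNormalizedIntegral.isCocomm`). Now `I(a
S(b))` is a separability idempotent for the dual algebra. That algebra is therefore reduced, and its
characters, the group-like elements, span the functions on `G⁰`
(`IsNormalizedIntegral.span_groupLike`). Finally, sending a `T`-point to its locally constant
function of values in `G(k)` splits, with kernel `G⁰(T)` (`IsNormalizedIntegral.isWellSplit`).

For the converse, take a residue field `K` of a member of the cover. On the dual of `M` the integral
is the coefficient of the unit in the group algebra. Summing its translates over the finite group
`Γ`, dividing by the order of `Γ` and retracting `K` linearly onto `k` yields an integral on `A`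
(`PointSplitting.exists_isNormalizedIntegral`). Over an algebraically closed field, locally
well-split thus gives an integral over `k` itself, hence a splitting over `k`. -/

noncomputable section

namespace LinRed

/-! ### Normalized integrals and linear reductivity -/

section Integral

variable {R : Type*} [CommRing R] {A : Type*} [CommRing A] [Bialgebra R A]

/-- A normalized (left) invariant integral on a bialgebra: a linear form `I` with `I 1 = 1` and
`a₁ I(a₂) = I(a) 1`. -/
structure IsNormalizedIntegral (I : A →ₗ[R] R) : Prop where
  map_one : I 1 = 1
  rid_lTensor_comul (a : A) :
    TensorProduct.rid R A (I.lTensor A (Coalgebra.comul a)) = algebraMap R A (I a)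

variable {V : Type*} [AddCommGroup V] [Module R V]

lemma Coaction.mem_invariants {ρ : Coaction R A V} {v : V} :
    v ∈ ρ.invariants ↔ ρ.toLin v = v ⊗ₜ[R] (1 : A) := by
  simp [Coaction.invariants, sub_eq_zero]

/-- The Reynolds operator attached to a linear form on the algebra of functions. -/
def Coaction.reynolds (ρ : Coaction R A V) (I : A →ₗ[R] R) : V →ₗ[R] V :=
  (TensorProduct.rid R V).toLinearMap ∘ₗ I.lTensor V ∘ₗ ρ.toLin

lemma Coaction.toLin_rid_lTensor (ρ : Coaction R A V) (I : A →ₗ[R] R) (z : V ⊗[R] A) :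
    ρ.toLin (TensorProduct.rid R V (I.lTensor V z)) =
      TensorProduct.rid R _ (I.lTensor _ (ρ.toLin.rTensor A z)) := by
  induction z with
  | zero => simp
  | tmul v a => simp
  | add x y hx hy => simp only [map_add, hx, hy]

/-- The identity `a₁ I(a₂) = I(a) 1` with coefficients in `V` carried along. -/
lemma IsNormalizedIntegral.contract {I : A →ₗ[R] R} (hI : IsNormalizedIntegral I)
    (z : V ⊗[R] A) :
    TensorProduct.rid R _ (I.lTensor _ ((TensorProduct.assoc R V A A).symm
      (Coalgebra.comul.lTensor V z))) =
      TensorProduct.rid R V (I.lTensor V z) ⊗ₜ[R] (1 : A) := by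
  induction z with
  | zero => simp
  | add x y hx hy => simp only [map_add, hx, hy, TensorProduct.add_tmul]
  | tmul v a =>
    have key (w : A ⊗[R] A) : TensorProduct.rid R _ (I.lTensor _
        ((TensorProduct.assoc R V A A).symm (v ⊗ₜ w))) =
        v ⊗ₜ[R] TensorProduct.rid R A (I.lTensor A w) := by
      induction w with
      | zero => simp
      | add x y hx hy => simp only [map_add, hx, hy, TensorProduct.tmul_add]
      | tmul b c => simp
    rw [LinearMap.lTensor_tmul, key, hI.rid_lTensor_comul, Algebra.algebraMap_eq_smul_one]
    simp [TensorProduct.smul_tmul]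

/-- In Sweedler notation `ρ(v₀ I(v₁)) = v₀ ⊗ v₁ I(v₂) = v₀ I(v₁) ⊗ 1`, by coassociativity and then
by invariance of `I`. -/
lemma Coaction.reynolds_mem_invariants (ρ : Coaction R A V) {I : A →ₗ[R] R}
    (hI : IsNormalizedIntegral I) (v : V) : ρ.reynolds I v ∈ ρ.invariants := by
  have h : ρ.toLin.rTensor A (ρ.toLin v) =
      (TensorProduct.assoc R V A A).symm (Coalgebra.comul.lTensor V (ρ.toLin v)) := by
    rw [LinearEquiv.eq_symm_apply]
    exact (LinearMap.congr_fun ρ.coassoc v).symm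
  rw [mem_invariants]
  simp only [reynolds, LinearMap.comp_apply, LinearEquiv.coe_coe]
  rw [toLin_rid_lTensor, h, hI.contract]

lemma Coaction.reynolds_of_mem_invariants (ρ : Coaction R A V) {I : A →ₗ[R] R}
    (hI : IsNormalizedIntegral I) {v : V} (hv : v ∈ ρ.invariants) : ρ.reynolds I v = v := by
  simp [reynolds, mem_invariants.1 hv, hI.map_one]

lemma Coaction.IsEquivariant.reynolds {W : Type*} [AddCommGroup W] [Module R W]
    {ρ : Coaction R A V} {σ : Coaction R A W} {f : V →ₗ[R] W} (hf : ρ.IsEquivariant σ f)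
    (I : A →ₗ[R] R) (v : V) : σ.reynolds I (f v) = f (ρ.reynolds I v) := by
  have h : σ.toLin (f v) = f.rTensor A (ρ.toLin v) := LinearMap.congr_fun hf v
  simp only [Coaction.reynolds, LinearMap.comp_apply, h, LinearEquiv.coe_coe]
  generalize ρ.toLin v = z
  induction z with
  | zero => simp
  | add x y hx hy => simp only [map_add, hx, hy]
  | tmul v a => simp

variable (R A) in
/-- Exactness of the functor of invariants on the category of `A`-comodules. -/
def InvariantsExact : Prop :=
  ∀ (V₁ V₂ V₃ : Type u) [AddCommGroup V₁] [AddCommGroup V₂] [AddCommGroup V₃]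
    [Module R V₁] [Module R V₂] [Module R V₃]
    (ρ₁ : Coaction R A V₁) (ρ₂ : Coaction R A V₂) (ρ₃ : Coaction R A V₃)
    (f : V₁ →ₗ[R] V₂) (g : V₂ →ₗ[R] V₃)
    (hf : ρ₁.IsEquivariant ρ₂ f) (hg : ρ₂.IsEquivariant ρ₃ g),
    Function.Injective f → Function.Exact f g → Function.Surjective g →
      Function.Injective hf.mapInvariants ∧
      Function.Exact hf.mapInvariants hg.mapInvariants ∧
      Function.Surjective hg.mapInvariants

/-- A preimage of an invariant vector need not be invariant, but its Reynolds average is, and it has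
the same image, because averaging commutes with equivariant maps and fixes invariants. -/
theorem IsNormalizedIntegral.invariantsExact {I : A →ₗ[R] R} (hI : IsNormalizedIntegral I) :
    InvariantsExact.{u} R A := by
  intro V₁ V₂ V₃ _ _ _ _ _ _ ρ₁ ρ₂ ρ₃ f g hf hg hinj hex hsurj
  refine ⟨fun x y h => Subtype.ext (hinj (congrArg Subtype.val h)), fun x => ⟨fun h => ?_, ?_⟩,
    fun w => ?_⟩
  · obtain ⟨y, hy⟩ := (hex x.1).1 (congrArg Subtype.val h)
    refine ⟨⟨_, ρ₁.reynolds_mem_invariants hI y⟩, Subtype.ext ?_⟩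
    change f (ρ₁.reynolds I y) = x.1
    rw [← hf.reynolds, hy, ρ₂.reynolds_of_mem_invariants hI x.2]
  · rintro ⟨y, rfl⟩
    exact Subtype.ext (hex.apply_apply_eq_zero y.1)
  · obtain ⟨v, hv⟩ := hsurj w.1
    refine ⟨⟨_, ρ₂.reynolds_mem_invariants hI v⟩, Subtype.ext ?_⟩
    change g (ρ₂.reynolds I v) = w.1
    rw [← hg.reynolds, hv, ρ₃.reynolds_of_mem_invariants hI w.2]

end Integral

/-! ### Comodules over a field: kernels and the dual of the coordinate algebra -/

section Field

variable {k : Type*} [Field k] {A : Type*} [CommRing A] [Bialgebra k A]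

/-- The kernel of an equivariant map carries a coaction. -/
lemma Coaction.exists_coaction_ker {V W : Type*} [AddCommGroup V] [Module k V] [AddCommGroup W]
    [Module k W] {ρ : Coaction k A V} {σ : Coaction k A W} {g : V →ₗ[k] W}
    (hg : ρ.IsEquivariant σ g) :
    ∃ τ : Coaction k A (LinearMap.ker g), τ.IsEquivariant ρ (LinearMap.ker g).subtype := by
  set N := LinearMap.ker g
  have hinj : Function.Injective (N.subtype.rTensor A) :=
    Module.Flat.rTensor_preserves_injective_linearMap _ N.injective_subtype
  -- Over a field `N ⊗ A` is the kernel of `g ⊗ A`, so equivariance of `g` forces `ρ` to map `N`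
  -- into `N ⊗ A`. The comodule axioms are then checked after embedding into the corresponding
  -- spaces for `V`.
  have hmem (v : N) : ρ.toLin v ∈ LinearMap.range (N.subtype.rTensor A) := by
    have hex : Function.Exact (N.subtype.rTensor A) (g.rangeRestrict.rTensor A) :=
      rTensor_exact A (by
        rw [LinearMap.exact_iff, LinearMap.ker_rangeRestrict, Submodule.range_subtype])
        g.surjective_rangeRestrict
    refine (hex _).1 ?_
    have h2 : Function.Injective ((LinearMap.range g).subtype.rTensor A) :=
      Module.Flat.rTensor_preserves_injective_linearMap _ (Submodule.injective_subtype _)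
    apply h2
    rw [← LinearMap.comp_apply, ← LinearMap.rTensor_comp, LinearMap.subtype_comp_codRestrict,
      map_zero]
    have := LinearMap.congr_fun hg v
    simp only [LinearMap.comp_apply] at this
    rw [← this, show g v = 0 from v.2, map_zero]
  choose τ hτ using hmem
  let t : N →ₗ[k] N ⊗[k] A :=
    { toFun := τ
      map_add' := fun x y => hinj (by simp [hτ])
      map_smul' := fun c x => hinj (by simp [hτ]) }
  have ht : N.subtype.rTensor A ∘ₗ t = ρ.toLin ∘ₗ N.subtype := LinearMap.ext hτ
  refine ⟨⟨t, ?_, ?_⟩, ht.symm⟩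
  · have hinj2 : Function.Injective (N.subtype.rTensor (A ⊗[k] A)) :=
      Module.Flat.rTensor_preserves_injective_linearMap _ N.injective_subtype
    refine (LinearMap.cancel_left hinj2).1 ?_
    have h1 : N.subtype.rTensor (A ⊗[k] A) ∘ₗ Coalgebra.comul.lTensor N ∘ₗ t =
        Coalgebra.comul.lTensor V ∘ₗ ρ.toLin ∘ₗ N.subtype := by
      rw [← ht, ← LinearMap.comp_assoc, ← LinearMap.comp_assoc, LinearMap.rTensor_comp_lTensor,
        LinearMap.lTensor_comp_rTensor]
    have h2 : N.subtype.rTensor (A ⊗[k] A) ∘ₗ (TensorProduct.assoc k N A A).toLinearMap =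
        (TensorProduct.assoc k V A A).toLinearMap ∘ₗ (N.subtype.rTensor A).rTensor A := by
      ext; simp
    rw [h1, ← LinearMap.comp_assoc, ρ.coassoc, ← LinearMap.comp_assoc, ← LinearMap.comp_assoc,
      h2]
    simp only [LinearMap.comp_assoc]
    rw [← ht, ← LinearMap.comp_assoc (t.rTensor A ∘ₗ t), ← LinearMap.comp_assoc t,
      ← LinearMap.comp_assoc t, ← LinearMap.rTensor_comp, ← ht, LinearMap.rTensor_comp]
    rfl
  · refine (LinearMap.cancel_left N.injective_subtype).1 ?_
    have h1 : N.subtype ∘ₗ (TensorProduct.rid k N).toLinearMap ∘ₗ Coalgebra.counit.lTensor N =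
        (TensorProduct.rid k V).toLinearMap ∘ₗ Coalgebra.counit.lTensor V ∘ₗ
          N.subtype.rTensor A := by
      ext; simp
    ext v
    have h2 := LinearMap.congr_fun h1 (t v)
    have h3 := LinearMap.congr_fun ht v
    have h4 := LinearMap.congr_fun ρ.counit v
    simp only [LinearMap.comp_apply, LinearEquiv.coe_coe, Submodule.subtype_apply,
      LinearMap.id_apply] at h2 h3 h4 ⊢
    rw [h2, h3, h4]

/-- The trivial coaction. -/
def Coaction.trivial (V : Type*) [AddCommGroup V] [Module k V] : Coaction k A V where
  toLin := (TensorProduct.mk k V A).flip 1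
  coassoc := by ext; simp [Algebra.TensorProduct.one_def]
  counit := by ext; simp

variable (k A) in
/-- The map `ξ ↦ (a ↦ a₁ ξ(a₂))`. -/
def translate : Module.Dual k A →ₗ[k] A →ₗ[k] A :=
  LinearMap.lcomp k A Coalgebra.comul ∘ₗ
    LinearMap.compRight k (TensorProduct.rid k A).toLinearMap ∘ₗ LinearMap.lTensorHom A

lemma translate_apply (ξ : Module.Dual k A) (a : A) :
    translate k A ξ a = TensorProduct.rid k A (ξ.lTensor A (Coalgebra.comul a)) := rfl

variable [FiniteDimensional k A]

variable (k A) in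
/-- The coaction on the dual of `A`, given by translation. -/
def Coaction.dual : Coaction k A (Module.Dual k A) where
  toLin := (dualTensorHomEquiv k A A).symm.toLinearMap ∘ₗ translate k A
  coassoc := by
    have hinj : Function.Injective (dualTensorHom k A (A ⊗[k] A)) :=
      (dualTensorHomEquiv k A (A ⊗[k] A)).injective
    -- As maps `A → A ⊗ A`, both sides become `a ↦ a₁ ⊗ a₂ ξ(a₃)`.
    refine (LinearMap.cancel_left hinj).1 ?_
    have h1 : dualTensorHom k A (A ⊗[k] A) ∘ₗ Coalgebra.comul.lTensor (Module.Dual k A) =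
        LinearMap.compRight k Coalgebra.comul ∘ₗ (dualTensorHomEquiv k A A).toLinearMap := by
      ext; simp
    have h2 : dualTensorHom k A (A ⊗[k] A) ∘ₗ
        (TensorProduct.assoc k (Module.Dual k A) A A).toLinearMap ∘ₗ
        ((dualTensorHomEquiv k A A).symm.toLinearMap ∘ₗ translate k A).rTensor A =
        LinearMap.lcomp k _ Coalgebra.comul ∘ₗ LinearMap.lTensorHom A ∘ₗ
          (dualTensorHomEquiv k A A).toLinearMap := by
      have key (z : Module.Dual k A ⊗[k] A) (b a : A) :
          dualTensorHom k A (A ⊗[k] A) (TensorProduct.assoc k (Module.Dual k A) A A (z ⊗ₜ b)) a =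
            dualTensorHom k A A z a ⊗ₜ b := by
        induction z with
        | zero => simp
        | add x y hx hy => simp only [map_add, TensorProduct.add_tmul, LinearMap.add_apply, hx, hy]
        | tmul ζ c => simp [TensorProduct.smul_tmul']
      ext ζ b a
      have h3 : dualTensorHom k A A ((dualTensorHomEquiv k A A).symm (translate k A ζ)) =
          translate k A ζ := (dualTensorHomEquiv k A A).apply_symm_apply _
      simp only [TensorProduct.AlgebraTensorModule.curry_apply, LinearMap.restrictScalars_self,
        TensorProduct.curry_apply, LinearMap.comp_apply, LinearMap.rTensor_tmul, 
        LinearEquiv.coe_coe, key, h3, translate_apply, LinearMap.lcomp_apply]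
      generalize (Coalgebra.comul a : A ⊗[k] A) = w
      induction w with
      | zero => simp
      | add x y hx hy => simp only [map_add, TensorProduct.add_tmul, hx, hy]
      | tmul c d => simp [TensorProduct.smul_tmul']
    ext ξ a
    have h1' := LinearMap.congr_fun h1 ((dualTensorHomEquiv k A A).symm (translate k A ξ))
    have h2' := LinearMap.congr_fun h2 ((dualTensorHomEquiv k A A).symm (translate k A ξ))
    simp only [LinearMap.comp_apply, LinearEquiv.coe_coe, LinearEquiv.apply_symm_apply]
      at h1' h2' ⊢
    rw [h1', h2']
    simp only [LinearMap.comp_apply, LinearMap.compRight_apply, translate_apply,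
      LinearMap.lcomp_apply, LinearMap.lTensorHom]
    have h3 := LinearMap.congr_fun (Coalgebra.coassoc (R := k) (A := A)) a
    simp only [LinearMap.comp_apply, LinearEquiv.coe_coe] at h3
    have h4 (w : A ⊗[k] A) : Coalgebra.comul (R := k) (TensorProduct.rid k A (ξ.lTensor A w)) =
        LinearMap.lTensor A ((TensorProduct.rid k A).toLinearMap ∘ₗ ξ.lTensor A)
          (TensorProduct.assoc k A A A (Coalgebra.comul.rTensor A w)) := by
      induction w with
      | zero => simp
      | add x y hx hy => simp only [map_add, hx, hy]
      | tmul c d =>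
        simp only [LinearMap.lTensor_tmul, TensorProduct.rid_tmul, map_smul,
          LinearMap.rTensor_tmul]
        generalize (Coalgebra.comul c : A ⊗[k] A) = w
        induction w with
        | zero => simp
        | add x y hx hy => simp only [map_add, TensorProduct.add_tmul, smul_add, hx, hy]
        | tmul c d => simp
    rw [h4, h3]
    change _ = LinearMap.lTensor A _ _
    rw [← LinearMap.comp_apply, ← LinearMap.lTensor_comp]
    rfl
  counit := by
    have h1 : (TensorProduct.rid k (Module.Dual k A)).toLinearMap ∘ₗ
        Coalgebra.counit.lTensor (Module.Dual k A) =
        LinearMap.compRight k Coalgebra.counit ∘ₗ (dualTensorHomEquiv k A A).toLinearMap := by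
      ext; simp [mul_comm]
    rw [← LinearMap.comp_assoc, h1]
    ext ξ a
    simp only [LinearMap.comp_apply, LinearEquiv.coe_coe, LinearEquiv.apply_symm_apply,
      LinearMap.compRight_apply, translate_apply, LinearMap.id_apply]
    have h3 := Coalgebra.rTensor_counit_comul (R := k) a
    have h4 (w : A ⊗[k] A) : Coalgebra.counit (R := k) (TensorProduct.rid k A (ξ.lTensor A w)) =
        ξ (TensorProduct.lid k A (Coalgebra.counit.rTensor A w)) := by
      induction w with
      | zero => simp
      | add x y hx hy => simp only [map_add, hx, hy]
      | tmul c d => simp [mul_comm]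
    rw [h4, h3]
    simp

end Field

/-- Evaluation at `1` is an equivariant surjection from the dual of `A`, with its translation
coaction, onto the trivial comodule `k`. An invariant lift of `1 : k` is a form `I` with `I 1 = 1`,
and its invariance reads `a₁ I(a₂) = I(a) 1`. -/
theorem InvariantsExact.exists_isNormalizedIntegral {k A : Type u} [Field k] [CommRing A]
    [Bialgebra k A] [FiniteDimensional k A] (h : InvariantsExact.{u} k A) :
    ∃ I : A →ₗ[k] k, IsNormalizedIntegral I := by
  let g : Module.Dual k A →ₗ[k] k := LinearMap.applyₗ (1 : A)
  have key (z : Module.Dual k A ⊗[k] A) : g.rTensor A z = 1 ⊗ₜ[k] dualTensorHom k A A z 1 := by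
    induction z with
    | zero => simp
    | add x y hx hy => simp only [map_add, LinearMap.add_apply, TensorProduct.tmul_add, hx, hy]
    | tmul c d => simp [g, TensorProduct.smul_tmul']
  have hdt (ξ : Module.Dual k A) : dualTensorHom k A A ((Coaction.dual k A).toLin ξ) =
      translate k A ξ := (dualTensorHomEquiv k A A).apply_symm_apply _
  have hg : (Coaction.dual k A).IsEquivariant (Coaction.trivial k) g := by
    refine LinearMap.ext fun ξ => ?_
    rw [LinearMap.comp_apply, LinearMap.comp_apply, key, hdt, translate_apply]
    simp [Coaction.trivial, g, Algebra.TensorProduct.one_def, TensorProduct.smul_tmul']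
  obtain ⟨τ, hτ⟩ := Coaction.exists_coaction_ker hg
  have hsurj : Function.Surjective g := by
    intro c
    have h1 : (Coalgebra.counit : A →ₗ[k] k) 1 = 1 := Bialgebra.counit_one
    exact ⟨c • Coalgebra.counit, by simp [g]⟩
  obtain ⟨-, -, h3⟩ := h _ _ _ τ (Coaction.dual k A) (Coaction.trivial k) _ g hτ hg
    (Submodule.injective_subtype _) (LinearMap.exact_subtype_ker_map g) hsurj
  obtain ⟨I, hI⟩ := h3 ⟨1, by rw [Coaction.mem_invariants]; rfl⟩
  have hI1 : I.1 1 = 1 := congrArg Subtype.val hI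
  refine ⟨I.1, hI1, fun a => ?_⟩
  have h4 := congrArg (dualTensorHom k A A) (Coaction.mem_invariants.1 I.2)
  rw [hdt] at h4
  have h5 := LinearMap.congr_fun h4 a
  rw [translate_apply] at h5
  rw [h5, dualTensorHom_apply, Algebra.algebraMap_eq_smul_one]

/-! ### Base change of normalized integrals -/

section BaseChange

variable {k : Type*} [Field k] {A : Type*} [CommRing A] [Bialgebra k A]
  {K : Type*} [Field K] [Algebra k K]

lemma comul_one_tmul (a : A) :
    Coalgebra.comul (R := K) (1 ⊗ₜ[k] a : K ⊗[k] A) =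
      Algebra.TensorProduct.mapRingHom (algebraMap k K)
        (RingHomClass.toRingHom (Algebra.TensorProduct.includeRight (R := k) (A := K) (B := A)))
        (RingHomClass.toRingHom (Algebra.TensorProduct.includeRight (R := k) (A := K) (B := A)))
        (by simp [← IsScalarTower.algebraMap_eq]) (by simp [← IsScalarTower.algebraMap_eq])
        (Coalgebra.comul (R := k) a) :=
  RingHom.congr_fun Bialgebra.comul_includeRight a

/-- The base change of a linear form. -/
def baseChangeForm (K : Type*) [Field K] [Algebra k K] (I : A →ₗ[k] k) : K ⊗[k] A →ₗ[K] K :=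
  (TensorProduct.AlgebraTensorModule.rid k K K).toLinearMap ∘ₗ I.baseChange K

lemma baseChangeForm_tmul (I : A →ₗ[k] k) (x : K) (a : A) :
    baseChangeForm K I (x ⊗ₜ a) = I a • x := by
  simp [baseChangeForm]

lemma IsNormalizedIntegral.baseChange {I : A →ₗ[k] k} (hI : IsNormalizedIntegral I) :
    IsNormalizedIntegral (baseChangeForm K I) := by
  refine ⟨by simp [Algebra.TensorProduct.one_def, baseChangeForm_tmul, hI.map_one], fun z => ?_⟩
  induction z with
  | zero => simp
  | add x y hx hy => simp only [map_add, hx, hy]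
  | tmul x a =>
    have hx : x ⊗ₜ[k] a = x • (1 ⊗ₜ[k] a : K ⊗[k] A) := by simp [TensorProduct.smul_tmul']
    have key (w : A ⊗[k] A) : TensorProduct.rid K (K ⊗[k] A) ((baseChangeForm K I).lTensor _
        (Algebra.TensorProduct.mapRingHom (algebraMap k K)
        (RingHomClass.toRingHom (Algebra.TensorProduct.includeRight (R := k) (A := K) (B := A)))
        (RingHomClass.toRingHom (Algebra.TensorProduct.includeRight (R := k) (A := K) (B := A)))
        (by simp [← IsScalarTower.algebraMap_eq]) (by simp [← IsScalarTower.algebraMap_eq]) w)) =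
        1 ⊗ₜ[k] TensorProduct.rid k A (I.lTensor A w) := by
      induction w with
      | zero => simp
      | add x y hx hy => simp only [map_add, TensorProduct.tmul_add, hx, hy]
      | tmul b c =>
        simp only [Algebra.TensorProduct.mapRingHom_tmul, RingHom.coe_coe,
          Algebra.TensorProduct.includeRight_apply, LinearMap.lTensor_tmul,
          baseChangeForm_tmul, TensorProduct.rid_tmul]
        simp [TensorProduct.smul_tmul']
    rw [hx, map_smul, map_smul, map_smul, map_smul, comul_one_tmul, key, hI.rid_lTensor_comul,
      baseChangeForm_tmul, Algebra.algebraMap_eq_smul_one, Algebra.algebraMap_eq_smul_one]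
    simp [Algebra.TensorProduct.one_def, TensorProduct.smul_tmul']

end BaseChange

/-! ### Infinitesimal characters -/

section Inf

open WithConv

variable {k : Type*} [Field k] {A : Type*} [CommRing A] [HopfAlgebra k A]
  {B : Type*} [CommRing B] [Algebra k B]

/-- The linear form `a ⊗ b ↦ f(a) g(b)`. -/
def convTensor (f g : WithConv (A →ₗ[k] B)) : WithConv (A ⊗[k] A →ₗ[k] B) :=
  toConv ((Algebra.TensorProduct.lmul' k (S := B)).toLinearMap ∘ₗ
    TensorProduct.map f.ofConv g.ofConv)

/-- The linear form `a ⊗ b ↦ f(ab)`. -/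
def convMulPullback (f : WithConv (A →ₗ[k] B)) : WithConv (A ⊗[k] A →ₗ[k] B) :=
  toConv (f.ofConv ∘ₗ LinearMap.mul' k A)

@[simp]
lemma convTensor_apply (f g : WithConv (A →ₗ[k] B)) (a b : A) :
    (convTensor f g).ofConv (a ⊗ₜ b) = f.ofConv a * g.ofConv b := by
  simp [convTensor]

@[simp]
lemma convMulPullback_apply (f : WithConv (A →ₗ[k] B)) (a b : A) :
    (convMulPullback f).ofConv (a ⊗ₜ b) = f.ofConv (a * b) := by
  simp [convMulPullback]

lemma convTensor_mul (f g f' g' : WithConv (A →ₗ[k] B)) :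
    convTensor f g * convTensor f' g' = convTensor (f * f') (g * g') := by
  have h := TensorProduct.map_convMul_map (R := k) (f := f) (h := f') (g := g) (k := g')
  have h2 := LinearMap.algHom_comp_convMul_distrib (Algebra.TensorProduct.lmul' k (S := B))
    (toConv (TensorProduct.map f.ofConv g.ofConv)) (toConv (TensorProduct.map f'.ofConv g'.ofConv))
  rw [h] at h2
  exact (congrArg toConv h2).symm

lemma convMulPullback_mul (f g : WithConv (A →ₗ[k] B)) :
    convMulPullback (f * g) = convMulPullback f * convMulPullback g :=
  congrArg toConv (LinearMap.convMul_comp_coalgHom_distrib f g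
    (Bialgebra.mulBialgHom k A : A ⊗[k] A →ₗc[k] A))

lemma conv_ext_tmul {f g : WithConv (A ⊗[k] A →ₗ[k] B)}
    (h : ∀ a b : A, f.ofConv (a ⊗ₜ b) = g.ofConv (a ⊗ₜ b)) : f = g :=
  WithConv.ext (TensorProduct.ext' h)

lemma convTensor_one_one : convTensor (1 : WithConv (A →ₗ[k] B)) 1 = 1 :=
  conv_ext_tmul fun a b => by simp [mul_comm]

/-- The ring homomorphism `f ↦ (a ⊗ b ↦ f(ab))`. -/
def mulPullbackHom : WithConv (A →ₗ[k] B) →+* WithConv (A ⊗[k] A →ₗ[k] B) where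
  toFun := convMulPullback
  map_one' := conv_ext_tmul fun a b => by simp [mul_comm]
  map_mul' := convMulPullback_mul
  map_zero' := rfl
  map_add' _ _ := rfl

lemma mulPullbackHom_apply (f : WithConv (A →ₗ[k] B)) :
    mulPullbackHom f = convMulPullback f := rfl

/-- The ring homomorphism `f ↦ (a ⊗ b ↦ f(a) ε(b))`. -/
def leftHom : WithConv (A →ₗ[k] B) →+* WithConv (A ⊗[k] A →ₗ[k] B) where
  toFun f := convTensor f 1
  map_one' := convTensor_one_one
  map_mul' f g := by rw [convTensor_mul, one_mul]
  map_zero' := conv_ext_tmul fun a b => by simp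
  map_add' f g := conv_ext_tmul fun a b => by simp [add_mul]

lemma leftHom_apply (f : WithConv (A →ₗ[k] B)) : leftHom f = convTensor f 1 := rfl

/-- The ring homomorphism `f ↦ (a ⊗ b ↦ ε(a) f(b))`. -/
def rightHom : WithConv (A →ₗ[k] B) →+* WithConv (A ⊗[k] A →ₗ[k] B) where
  toFun f := convTensor 1 f
  map_one' := convTensor_one_one
  map_mul' f g := by rw [convTensor_mul, one_mul]
  map_zero' := conv_ext_tmul fun a b => by simp
  map_add' f g := conv_ext_tmul fun a b => by simp [mul_add]

lemma rightHom_apply (f : WithConv (A →ₗ[k] B)) : rightHom f = convTensor 1 f := rfl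

/-- Infinitesimal characters: `B`-valued derivations of `A` at the counit. -/
def IsInf (z : WithConv (A →ₗ[k] B)) : Prop :=
  ∀ a b : A, z.ofConv (a * b) = z.ofConv a * algebraMap k B (Coalgebra.counit b) +
    algebraMap k B (Coalgebra.counit a) * z.ofConv b

/-- Infinitesimal characters are the primitive elements for the map dual to multiplication. This
form turns questions about them into computations in the convolution ring of `A ⊗ A`. -/
lemma isInf_iff {z : WithConv (A →ₗ[k] B)} :
    IsInf z ↔ convMulPullback z = convTensor z 1 + convTensor 1 z := by
  refine ⟨fun h => conv_ext_tmul fun a b => by simp [h a b], fun h a b => ?_⟩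
  simpa using congrArg (fun f => f.ofConv (a ⊗ₜ b)) h

lemma IsInf.map_one {z : WithConv (A →ₗ[k] B)} (h : IsInf z) : z.ofConv 1 = 0 := by
  simpa using h 1 1

lemma IsInf.bracket {x y : WithConv (A →ₗ[k] B)} (hx : IsInf x) (hy : IsInf y) :
    IsInf (x * y - y * x) := by
  rw [isInf_iff] at *
  rw [← mulPullbackHom_apply, map_sub, map_mul, map_mul, mulPullbackHom_apply,
    mulPullbackHom_apply, hx, hy, ← leftHom_apply (x * y - y * x),
    ← rightHom_apply (x * y - y * x), map_sub, map_sub]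
  simp only [mul_add, add_mul, convTensor_mul, one_mul, mul_one, leftHom_apply, rightHom_apply]
  abel

instance [Nontrivial B] : Nontrivial (WithConv (A →ₗ[k] B)) :=
  ⟨0, 1, fun h => zero_ne_one (α := B) (by simpa using congrArg (fun f => f.ofConv 1) h)⟩

instance [Nontrivial B] : Nontrivial (WithConv (A ⊗[k] A →ₗ[k] B)) :=
  ⟨0, 1, fun h => zero_ne_one (α := B) (by simpa using congrArg (fun f => f.ofConv 1) h)⟩

/-- The two summands `x ⊗ 1` and `1 ⊗ x` commute, so raising their sum to the power `p` is additive.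
-/
lemma IsInf.pow_char [Nontrivial B] {x : WithConv (A →ₗ[k] B)} (hx : IsInf x) (p : ℕ)
    [Fact p.Prime] [CharP k p] : IsInf (x ^ p) := by
  have : CharP (WithConv (A ⊗[k] A →ₗ[k] B)) p :=
    charP_of_injective_algebraMap (algebraMap k _).injective p
  rw [isInf_iff] at *
  have hc : Commute (leftHom x) (rightHom x) := by
    simp [Commute, SemiconjBy, leftHom_apply, rightHom_apply, convTensor_mul]
  rw [← mulPullbackHom_apply, map_pow, mulPullbackHom_apply, hx, ← leftHom_apply,
    ← rightHom_apply, add_pow_char_of_commute _ hc, ← map_pow, ← map_pow, leftHom_apply,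
    rightHom_apply]

lemma IsInf.pow_char_pow [Nontrivial B] {x : WithConv (A →ₗ[k] B)} (hx : IsInf x) (p : ℕ)
    [Fact p.Prime] [CharP k p] (n : ℕ) : IsInf (x ^ p ^ n) := by
  induction n with
  | zero => simpa
  | succ n ih => rw [pow_succ, pow_mul]; exact ih.pow_char p

/-- The identity of `A`, as an element of the convolution ring. -/
def univ (k A : Type*) [Field k] [CommRing A] [HopfAlgebra k A] : WithConv (A →ₗ[k] A) :=
  toConv LinearMap.id

/-- The antipode of `A`, as an element of the convolution ring. -/
def univInv (k A : Type*) [Field k] [CommRing A] [HopfAlgebra k A] : WithConv (A →ₗ[k] A) :=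
  toConv (HopfAlgebra.antipode k)

lemma univ_mul_univInv : univ k A * univInv k A = 1 := LinearMap.id_mul_antipode
lemma univInv_mul_univ : univInv k A * univ k A = 1 := LinearMap.antipode_mul_id

/-- This is the adjoint action by the generic point: `univ` and `univInv` are algebra homomorphisms,
that is, group-like for the map dual to multiplication, and conjugation by a group-like element
preserves primitive ones. -/
lemma IsInf.conj {z : WithConv (A →ₗ[k] A)} (hz : IsInf z) :
    IsInf (univInv k A * z * univ k A) := by
  have hu : convMulPullback (univ k A) = convTensor (univ k A) (univ k A) :=
    conv_ext_tmul fun a b => by simp [univ]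
  have hs : convMulPullback (univInv k A) = convTensor (univInv k A) (univInv k A) :=
    conv_ext_tmul fun a b => by simp [univInv, HopfAlgebra.antipode_mul_distrib]
  rw [isInf_iff] at *
  rw [convMulPullback_mul, convMulPullback_mul, hu, hs, hz]
  simp only [mul_add, add_mul, convTensor_mul, mul_one, univInv_mul_univ]

end Inf

/-! ### Invariant derivations -/

section Derivation

open WithConv

/-- Each application of `D` lowers the exponent of `a` by at most one. The case `j = n` gives
`D^n(a^n) = n! (D a)^n` modulo `a`. -/
lemma Derivation.exists_iterate_pow {k A : Type*} [CommRing k] [CommRing A] [Algebra k A]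
    (D : Derivation k A A) (a : A) (n : ℕ) {j : ℕ} (hj : j ≤ n) :
    ∃ r, D^[j] (a ^ n) = n.descFactorial j * (D a) ^ j * a ^ (n - j) + r * a ^ (n - j + 1) := by
  induction j with
  | zero => exact ⟨0, by simp⟩
  | succ j ih =>
    obtain ⟨r, hr⟩ := ih (by omega)
    obtain ⟨m, hm⟩ : ∃ m, n - j = m + 1 := ⟨n - j - 1, by omega⟩
    have hm' : n - (j + 1) = m := by omega
    rw [Function.iterate_succ_apply', hr, hm, hm']
    refine ⟨n.descFactorial j * D (D a ^ j) + r * (m + 2) * D a + a * D r, ?_⟩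
    simp only [map_add, Derivation.leibniz, Derivation.leibniz_pow, Derivation.map_natCast,
      Nat.descFactorial_succ, hm, smul_eq_mul, nsmul_eq_mul, Nat.add_sub_cancel]
    push_cast
    ring

lemma Derivation.iterate_mul_of_eq_zero {k A : Type*} [CommRing k] [CommRing A] [Algebra k A]
    (D : Derivation k A A) {w : A} (hw : D w = 0) (b : A) (j : ℕ) :
    D^[j] (b * w) = D^[j] b * w := by
  induction j with
  | zero => rfl
  | succ j ih =>
    rw [Function.iterate_succ_apply', ih, Derivation.leibniz, hw, smul_zero, zero_add,
      Function.iterate_succ_apply', smul_eq_mul, mul_comm]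

variable {k : Type*} [Field k] {A : Type*} [CommRing A] [HopfAlgebra k A]

/-- Extension of scalars of linear forms, as a ring homomorphism of convolution rings. -/
def scalarExt (B : Type*) [CommRing B] [Algebra k B] :
    WithConv (A →ₗ[k] k) →+* WithConv (A →ₗ[k] B) where
  toFun x := toConv (Algebra.linearMap k B ∘ₗ x.ofConv)
  map_one' := by ext; simp
  map_mul' x y := congrArg toConv (LinearMap.algHom_comp_convMul_distrib (Algebra.ofId k B) x y)
  map_zero' := by ext; simp
  map_add' x y := by ext; simp

@[simp]
lemma scalarExt_apply (B : Type*) [CommRing B] [Algebra k B] (x : WithConv (A →ₗ[k] k)) (a : A) :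
    (scalarExt B x).ofConv a = algebraMap k B (x.ofConv a) := rfl

/-- The value of the convolution product is the sum of the `x(a₁) w(a₂)` with `x(a₁)` a scalar,
which any `k`-linear `f` respects. The lemma is used with `f` a derivation, the counit, an integral
and an arbitrary form. -/
lemma comp_scalarExt_mul {B C : Type*} [CommRing B] [Algebra k B] [CommRing C] [Algebra k C]
    (f : B →ₗ[k] C) (x : WithConv (A →ₗ[k] k)) (w : WithConv (A →ₗ[k] B)) :
    f ∘ₗ (scalarExt B x * w).ofConv = (scalarExt C x * toConv (f ∘ₗ w.ofConv)).ofConv := by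
  ext a
  rw [LinearMap.comp_apply, (Coalgebra.Repr.arbitrary k a).convMul_apply,
    (Coalgebra.Repr.arbitrary k a).convMul_apply]
  simp [← Algebra.smul_def]

lemma isInf_scalarExt {B : Type*} [CommRing B] [Algebra k B] {x : WithConv (A →ₗ[k] k)}
    (hx : IsInf x) : IsInf (scalarExt B x) := fun a b => by simp [hx a b]

/-- The invariant derivation `a ↦ x(a₁) a₂` attached to an infinitesimal character `x`. -/
def IsInf.derivation {x : WithConv (A →ₗ[k] k)} (hx : IsInf x) : Derivation k A A :=
  Derivation.mk' (scalarExt A x * univ k A).ofConv fun a b => by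
    have hu : convMulPullback (univ k A) = convTensor (univ k A) (univ k A) :=
      conv_ext_tmul fun a b => by simp [univ]
    have h : convMulPullback (scalarExt A x * univ k A) =
        convTensor (scalarExt A x * univ k A) (univ k A) +
          convTensor (univ k A) (scalarExt A x * univ k A) := by
      rw [convMulPullback_mul, hu, isInf_iff.1 (isInf_scalarExt hx)]
      simp only [add_mul, convTensor_mul, one_mul]
    have h2 := congrArg (fun f => f.ofConv (a ⊗ₜ b)) h
    simp only [convMulPullback_apply, ofConv_add, LinearMap.add_apply, convTensor_apply] at h2
    rw [h2]
    simp [univ]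
    ring

/-- Iterating the invariant derivation corresponds to convolution powers of `x`; in particular `x ^
p = 0` makes the `p`-th iterate zero. -/
lemma IsInf.iterate_derivation {x : WithConv (A →ₗ[k] k)} (hx : IsInf x) (n : ℕ) (a : A) :
    hx.derivation^[n] a = (scalarExt A (x ^ n) * univ k A).ofConv a := by
  induction n with
  | zero => simp [univ]
  | succ n ih =>
    rw [Function.iterate_succ_apply', ih]
    have h := LinearMap.congr_fun
      (comp_scalarExt_mul (scalarExt A x * univ k A).ofConv (x ^ n) (univ k A)) a
    have h2 : toConv ((scalarExt A x * univ k A).ofConv ∘ₗ (univ k A).ofConv) =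
      scalarExt A x * univ k A := rfl
    rw [h2, ← mul_assoc, ← map_mul, ← pow_succ] at h
    exact h

lemma counit_scalarExt_mul_univ (x : WithConv (A →ₗ[k] k)) (a : A) :
    Coalgebra.counit (R := k) ((scalarExt A x * univ k A).ofConv a) = x.ofConv a := by
  have h := LinearMap.congr_fun (comp_scalarExt_mul Coalgebra.counit x (univ k A)) a
  have h2 : toConv (Coalgebra.counit ∘ₗ (univ k A).ofConv) = (1 : WithConv (A →ₗ[k] k)) := rfl
  rw [h2, mul_one] at h
  exact h

lemma IsInf.counit_derivation {x : WithConv (A →ₗ[k] k)} (hx : IsInf x) (a : A) :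
    Coalgebra.counit (R := k) (hx.derivation a) = x.ofConv a :=
  counit_scalarExt_mul_univ x a

/-- `I(x(a₁) a₂) = x(a₁ I(a₂)) = I(a) x(1) = 0`. -/
lemma IsNormalizedIntegral.apply_derivation {I : A →ₗ[k] k} (hI : IsNormalizedIntegral I)
    {x : WithConv (A →ₗ[k] k)} (hx : IsInf x) (a : A) : I (hx.derivation a) = 0 := by
  have h := LinearMap.congr_fun (comp_scalarExt_mul I x (univ k A)) a
  have h2 (w : A ⊗[k] A) : LinearMap.mul' k k (TensorProduct.map x.ofConv I w) =
      x.ofConv (TensorProduct.rid k A (I.lTensor A w)) := by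
    induction w with
    | zero => simp
    | add x y hx hy => simp only [map_add, hx, hy]
    | tmul b c => simp [mul_comm]
  refine h.trans ((h2 _).trans ?_)
  rw [hI.rid_lTensor_comul, Algebra.algebraMap_eq_smul_one, map_smul, hx.map_one, smul_zero]

lemma isUnit_of_counit_ne_zero (hloc : ∀ a : A, Coalgebra.counit (R := k) a = 0 → IsNilpotent a)
    {a : A} (ha : Coalgebra.counit (R := k) a ≠ 0) : IsUnit a := by
  have h1 : IsNilpotent (a - algebraMap k A (Coalgebra.counit a)) := hloc _ (by simp)
  have h2 : IsUnit (algebraMap k A (Coalgebra.counit (R := k) a)) := (Ne.isUnit ha).map _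
  simpa using h1.isUnit_add_right_of_commute h2 (Commute.all _ _)

lemma IsInf.exists_ne_zero {x : WithConv (A →ₗ[k] k)} (hx : IsInf x) (h0 : x ≠ 0) :
    ∃ a : A, Coalgebra.counit (R := k) a = 0 ∧ x.ofConv a ≠ 0 := by
  obtain ⟨a, ha⟩ : ∃ a, x.ofConv a ≠ 0 := by
    by_contra! h
    exact h0 (WithConv.ext (LinearMap.ext h))
  refine ⟨a - algebraMap k A (Coalgebra.counit a), by simp, ?_⟩
  rw [map_sub, Algebra.algebraMap_eq_smul_one, map_smul, hx.map_one]
  simpa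

lemma IsInf.counit_iterate_derivation_pow {x : WithConv (A →ₗ[k] k)} (hx : IsInf x) {a : A}
    (ha : Coalgebra.counit (R := k) a = 0) (n : ℕ) :
    Coalgebra.counit (R := k) (hx.derivation^[n] (a ^ n)) = n.factorial * x.ofConv a ^ n := by
  obtain ⟨r, hr⟩ := Derivation.exists_iterate_pow hx.derivation a n le_rfl
  rw [hr]
  simp [ha, hx.counit_derivation, Nat.descFactorial_self]

/-- In characteristic zero, a local Hopf algebra has no infinitesimal characters. -/
lemma IsInf.eq_zero_of_charZero [CharZero k]
    (hloc : ∀ a : A, Coalgebra.counit (R := k) a = 0 → IsNilpotent a)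
    {x : WithConv (A →ₗ[k] k)} (hx : IsInf x) : x = 0 := by
  by_contra h0
  obtain ⟨a, ha, hxa⟩ := hx.exists_ne_zero h0
  obtain ⟨n, hn⟩ := hloc a ha
  -- Since `a ^ n = 0`, the nonzero number `n! x(a)^n` would be zero.
  have h := hx.counit_iterate_derivation_pow ha n
  rw [hn, iterate_map_zero, map_zero, eq_comm, mul_eq_zero] at h
  rcases h with h | h
  · exact n.factorial_ne_zero (by exact_mod_cast h)
  · exact pow_ne_zero n hxa h

/-- If there is a normalized integral, there are no infinitesimal characters `x` with `x ^ p = 0`,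
that is, no subgroups `α_p`. -/
lemma IsInf.eq_zero_of_pow_char_eq_zero (p : ℕ) [hp : Fact p.Prime] [CharP k p]
    (hloc : ∀ a : A, Coalgebra.counit (R := k) a = 0 → IsNilpotent a)
    {I : A →ₗ[k] k} (hI : IsNormalizedIntegral I)
    {x : WithConv (A →ₗ[k] k)} (hx : IsInf x) (hxp : x ^ p = 0) : x = 0 := by
  by_contra h0
  obtain ⟨a, ha, hxa⟩ := hx.exists_ne_zero h0
  obtain ⟨q, hq⟩ : ∃ q, p = q + 1 + 1 := ⟨p - 2, by have := hp.out.two_le; omega⟩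
  set D := hx.derivation with hD
  -- Here `q + 1 = p - 1`. The element `v = D^(p-1)(a^(p-1))` has counit `(p-1)! x(a)^(p-1) ≠ 0`,
  -- hence is a unit, and `D v = 0` because `D^p = 0`. Then `D` also kills `v⁻¹`, so `1 =
  -- D^(p-1)(a^(p-1) v⁻¹)` lies in the image of `D`, where `I` vanishes.
  have hv : IsUnit (D^[q + 1] (a ^ (q + 1))) := by
    refine isUnit_of_counit_ne_zero hloc ?_
    rw [hx.counit_iterate_derivation_pow ha]
    refine mul_ne_zero (fun h => ?_) (pow_ne_zero _ hxa)
    rw [CharP.cast_eq_zero_iff k p, hp.out.dvd_factorial] at h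
    omega
  obtain ⟨v, hv⟩ := hv
  have hDv : D (v : A) = 0 := by
    rw [hv, ← Function.iterate_succ_apply' D, ← Nat.add_one, ← hq, hD, hx.iterate_derivation, hxp,
      map_zero, zero_mul]
    rfl
  have hDw : D (v⁻¹ : Aˣ).val = 0 := by
    have h := D.leibniz (v : A) (v⁻¹ : Aˣ).val
    rw [Units.mul_inv, Derivation.map_one_eq_zero, hDv, smul_zero, add_zero, smul_eq_mul] at h
    exact (Units.mul_right_eq_zero v).1 h.symm
  have h1 := Derivation.iterate_mul_of_eq_zero D hDw (a ^ (q + 1)) (q + 1)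
  rw [← hv, Units.mul_inv, Function.iterate_succ_apply'] at h1
  have h2 := hI.apply_derivation hx (D^[q] (a ^ (q + 1) * (v⁻¹ : Aˣ).val))
  rw [← hD, h1, hI.map_one] at h2
  exact one_ne_zero h2

end Derivation

/-! ### Restricted Lie algebras without nilpotent elements -/

section Restricted

variable {k : Type*} [Field k] {H : Type*} [Ring H] [Algebra k H] (p : ℕ)

lemma eq_zero_of_pow_char_pow_eq_zero {L : Submodule k H} (hL : ∀ x ∈ L, x ^ p ∈ L)
    (hn : ∀ x ∈ L, x ^ p = 0 → x = 0) (n : ℕ) {x : H} (hx : x ∈ L) (h : x ^ p ^ n = 0) :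
    x = 0 := by
  induction n generalizing x with
  | zero => simpa using h
  | succ n ih =>
    rw [pow_succ', pow_mul] at h
    exact hn x hx (ih (hL x hx) h)

lemma pow_char_pow_mem {L : Submodule k H} (hL : ∀ x ∈ L, x ^ p ∈ L) (n : ℕ) {x : H}
    (hx : x ∈ L) : x ^ p ^ n ∈ L := by
  induction n with
  | zero => simpa
  | succ n ih => rw [pow_succ, pow_mul]; exact hL _ ih

variable [hp : Fact p.Prime] [CharP k p]

/-- The powers `x ^ p ^ i` satisfy a linear relation; let `r` be its least exponent index. As `k` is
perfect, the relation is the `p ^ r`-th power of a combination of the `x ^ p ^ (i - r)`. That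
combination lies in `L`, so it vanishes for lack of nilpotents, and its coefficient at `x` is
nonzero. -/
lemma mem_span_pow_char [PerfectRing k p] [FiniteDimensional k H] {L : Submodule k H}
    (hL : ∀ x ∈ L, x ^ p ∈ L) (hn : ∀ x ∈ L, x ^ p = 0 → x = 0) {x : H} (hx : x ∈ L) :
    x ∈ Submodule.span k (Set.range fun i : ℕ => x ^ p ^ (i + 1)) := by
  classical
  have hdep : ¬ LinearIndependent k fun i : ℕ => x ^ p ^ i := fun h =>
    not_finite_iff_infinite.2 inferInstance h.finite
  rw [not_linearIndependent_iff] at hdep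
  obtain ⟨s, c, hsum, i₀, hi₀, hci₀⟩ := hdep
  set t := s.filter fun i => c i ≠ 0
  have ht : t.Nonempty := ⟨i₀, by simp [t, hi₀, hci₀]⟩
  set r := t.min' ht
  have hr : r ∈ t := t.min'_mem ht
  have hsum' : ∑ i ∈ t, c i • x ^ p ^ i = 0 := by
    rw [← hsum, Finset.sum_filter_of_ne]
    intro i _ h hc
    exact h (by rw [hc, zero_smul])
  choose d hd using fun i : ℕ => (bijective_iterateFrobenius k p r).2 (c i)
  simp only [iterateFrobenius_def] at hd
  let q : Polynomial k := ∑ i ∈ t, Polynomial.C (d i) * Polynomial.X ^ p ^ (i - r)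
  have hq : q ^ p ^ r = ∑ i ∈ t, Polynomial.C (c i) * Polynomial.X ^ p ^ i := by
    rw [sum_pow_char_pow]
    refine Finset.sum_congr rfl fun i hi => ?_
    rw [mul_pow, ← Polynomial.C_pow, hd, ← pow_mul, ← pow_add,
      Nat.sub_add_cancel (t.min'_le i hi)]
  have hz : Polynomial.aeval x q = 0 := by
    refine eq_zero_of_pow_char_pow_eq_zero p hL hn r ?_ ?_
    · simp only [q, map_sum, map_mul, Polynomial.aeval_C, map_pow, Polynomial.aeval_X,
        ← Algebra.smul_def]
      exact L.sum_mem fun i _ => L.smul_mem _ (pow_char_pow_mem p hL _ hx)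
    · rw [← map_pow, hq]
      simpa [Algebra.smul_def] using hsum'
  simp only [q, map_sum, map_mul, Polynomial.aeval_C, map_pow, Polynomial.aeval_X,
    ← Algebra.smul_def] at hz
  rw [← Finset.add_sum_erase _ _ hr, Nat.sub_self, pow_zero, pow_one] at hz
  have hdr : d r ≠ 0 := fun h => by
    have := hd r
    rw [h, zero_pow (pow_ne_zero _ hp.out.ne_zero)] at this
    exact (Finset.mem_filter.1 hr).2 this.symm
  have hx' : x = (-(d r)⁻¹) • ∑ i ∈ t.erase r, d i • x ^ p ^ (i - r) := by
    rw [neg_smul, ← smul_neg, ← eq_neg_of_add_eq_zero_left hz, smul_smul, inv_mul_cancel₀ hdr,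
      one_smul]
  suffices h : ∑ i ∈ t.erase r, d i • x ^ p ^ (i - r) ∈
      Submodule.span k (Set.range fun i : ℕ => x ^ p ^ (i + 1)) by
    have h' := Submodule.smul_mem _ (-(d r)⁻¹) h
    rwa [← hx'] at h'
  refine Submodule.sum_mem _ fun i hi => Submodule.smul_mem _ _ ?_
  refine Submodule.subset_span ⟨i - r - 1, ?_⟩
  have h1 : r ≤ i := t.min'_le i (Finset.mem_of_mem_erase hi)
  have h2 : i ≠ r := Finset.ne_of_mem_erase hi
  have h3 : i - r - 1 + 1 = i - r := by omega
  simp only [h3]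

/-- In characteristic `p`, `ad (y ^ p ^ i) = (ad y) ^ p ^ i`. If `(ad y)²` kills `z`, so does `ad (y
^ p ^ (i + 1))` for every `i`, and `y` is a combination of these powers. -/
lemma commutator_eq_zero_of_commutator_commutator_eq_zero [PerfectRing k p]
    [FiniteDimensional k H] {L : Submodule k H}
    (hL : ∀ x ∈ L, x ^ p ∈ L) (hn : ∀ x ∈ L, x ^ p = 0 → x = 0) {y : H} (hy : y ∈ L) {z : H}
    (h : y * (y * z - z * y) - (y * z - z * y) * y = 0) : y * z - z * y = 0 := by
  cases subsingleton_or_nontrivial H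
  · exact Subsingleton.elim _ _
  let ad : H → Module.End k H := fun w => LinearMap.mulLeft k w - LinearMap.mulRight k w
  have had (w v : H) : ad w v = w * v - v * w := rfl
  have : CharP (Module.End k H) p :=
    charP_of_injective_algebraMap (algebraMap k _).injective p
  have hpow (i : ℕ) : ad (y ^ p ^ i) = ad y ^ p ^ i := by
    simp only [ad]
    rw [sub_pow_char_pow_of_commute _ _ (LinearMap.commute_mulLeft_right y y),
      LinearMap.pow_mulLeft, LinearMap.pow_mulRight]
  have h2 (i : ℕ) : ad (y ^ p ^ (i + 1)) z = 0 := by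
    obtain ⟨m, hm⟩ : ∃ m, p ^ (i + 1) = m + 2 :=
      ⟨p ^ (i + 1) - 2, by
        have h1 := hp.out.two_le
        have h2 := Nat.le_self_pow (n := i + 1) (by omega) p
        omega⟩
    rw [hpow, hm, pow_add, Module.End.mul_apply, pow_two, Module.End.mul_apply, had y z, had y,
      h, map_zero]
  have h3 := mem_span_pow_char p hL hn hy
  have h4 : Submodule.span k (Set.range fun i : ℕ => y ^ p ^ (i + 1)) ≤
      LinearMap.ker (LinearMap.mulRight k z - LinearMap.mulLeft k z) := by
    rw [Submodule.span_le]
    rintro _ ⟨i, rfl⟩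
    exact h2 i
  exact h4 h3

/-- A finite-dimensional restricted Lie algebra of operators without nilpotent elements, over an
algebraically closed field, is commutative. -/
theorem commute_of_no_nilpotent [IsAlgClosed k] [FiniteDimensional k H] {L : Submodule k H}
    (hL : ∀ x ∈ L, x ^ p ∈ L) (hbr : ∀ x ∈ L, ∀ y ∈ L, x * y - y * x ∈ L)
    (hn : ∀ x ∈ L, x ^ p = 0 → x = 0) {x y : H} (hx : x ∈ L) (hy : y ∈ L) : Commute x y := by
  have key {a : H} := @commutator_eq_zero_of_commutator_commutator_eq_zero k _ H _ _ p _ _ _ _ L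
    hL hn a
  let f : Module.End k H := LinearMap.mulLeft k x - LinearMap.mulRight k x
  have hf (v : H) : f v = x * v - v * x := rfl
  let W : Submodule k H := L.map f
  have hWL : W ≤ L := by
    rintro _ ⟨v, hv, rfl⟩
    exact hbr x hx v hv
  have hfW : ∀ w ∈ W, f w ∈ W := fun w hw => ⟨w, hWL hw, rfl⟩
  by_contra hne
  have hne' : f y ≠ 0 := fun h => hne (sub_eq_zero.1 h)
  have : Nontrivial W := ⟨⟨f y, y, hy, rfl⟩, 0, fun h => hne' (congrArg Subtype.val h)⟩
  -- If `W = [x, L]` is nonzero, it contains an eigenvector `w` of `ad x`.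
  obtain ⟨c, hc⟩ := Module.End.exists_eigenvalue (f.restrict hfW)
  obtain ⟨⟨w, hw⟩, hw2⟩ := hc.exists_hasEigenvector
  have hw0 : w ≠ 0 := fun h => hw2.2 (Subtype.ext h)
  have hfw : f w = c • w := congrArg Subtype.val hw2.apply_eq_smul
  -- From `[x, w] = c w` follows `[w, [w, x]] = 0`, so `[w, x] = 0`. Writing `w = [x, v]`, this says
  -- `[x, [x, v]] = 0`, so `w = 0` by the same principle.
  have h1 : w * x - x * w = 0 := by
    refine key (hWL hw) ?_
    have : w * x - x * w = -(c • w) := by rw [← hfw, hf]; abel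
    rw [this]
    simp
  have h2 : f w = 0 := by rw [hf, ← neg_sub, h1, neg_zero]
  obtain ⟨v, hv, rfl⟩ := hw
  exact hw0 (key hx h2)

lemma sum_pow_char_pow_of_commute' [CharP H p] {J : Type*} (s : Finset J) (f : J → H)
    (hf : ∀ i ∈ s, ∀ j ∈ s, Commute (f i) (f j)) (n : ℕ) :
    (∑ i ∈ s, f i) ^ p ^ n = ∑ i ∈ s, f i ^ p ^ n := by
  classical
  induction s using Finset.induction_on with
  | empty => simp [hp.out.ne_zero]
  | insert a s ha ih =>
    rw [Finset.sum_insert ha, Finset.sum_insert ha, add_pow_char_pow_of_commute, ih]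
    · exact fun i hi j hj => hf i (Finset.mem_insert_of_mem hi) j (Finset.mem_insert_of_mem hj)
    · exact Commute.sum_right _ _ _ fun i hi =>
        hf a (Finset.mem_insert_self a s) i (Finset.mem_insert_of_mem hi)

end Restricted

/-! ### The adjoint action on infinitesimal characters -/

section Adjoint

open WithConv

variable {k : Type*} [Field k] {A : Type*} [CommRing A] [HopfAlgebra k A]

variable (k A) in
/-- The span of `1` and of the square of the augmentation ideal. -/
def oneSqSpan : Submodule k A :=
  Submodule.span k (insert 1 {x | ∃ a b : A, Coalgebra.counit (R := k) a = 0 ∧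
    Coalgebra.counit (R := k) b = 0 ∧ a * b = x})

lemma IsInf.apply_eq_zero {B : Type*} [CommRing B] [Algebra k B] {z : WithConv (A →ₗ[k] B)}
    (hz : IsInf z) {a : A} (ha : a ∈ oneSqSpan k A) : z.ofConv a = 0 := by
  have : oneSqSpan k A ≤ LinearMap.ker z.ofConv := by
    rw [oneSqSpan, Submodule.span_le]
    rintro _ (rfl | ⟨a, b, ha, hb, rfl⟩)
    · exact hz.map_one
    · simp [hz a b, ha, hb]
  exact this ha

/-- Together with `IsInf.apply_eq_zero` this identifies the Lie algebra with the dual of the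
quotient of the augmentation ideal by its square; the proof expands the product of `a - ε(a)` and `b
- ε(b)`. -/
lemma isInf_of_apply_eq_zero {x : WithConv (A →ₗ[k] k)}
    (hx : ∀ a ∈ oneSqSpan k A, x.ofConv a = 0) : IsInf x := by
  intro a b
  have h1 : x.ofConv 1 = 0 := hx 1 (Submodule.subset_span (Set.mem_insert _ _))
  have h2 := hx ((a - algebraMap k A (Coalgebra.counit a)) *
      (b - algebraMap k A (Coalgebra.counit b)))
    (Submodule.subset_span (Or.inr ⟨_, _, by simp, by simp, rfl⟩))
  have h3 : (a - algebraMap k A (Coalgebra.counit a)) * (b - algebraMap k A (Coalgebra.counit b)) =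
      a * b - (Coalgebra.counit (R := k) b) • a - (Coalgebra.counit (R := k) a) • b +
        (Coalgebra.counit (R := k) a * Coalgebra.counit (R := k) b) • 1 := by
    simp only [Algebra.smul_def, map_mul]
    ring
  rw [h3] at h2
  simp only [map_add, map_sub, map_smul, h1, smul_eq_mul] at h2
  simp only [Algebra.algebraMap_self, RingHom.id_apply]
  linear_combination h2

/-- `B`-valued infinitesimal characters are combinations of `k`-valued ones. -/
lemma IsInf.exists_eq_sum [FiniteDimensional k A] {z : WithConv (A →ₗ[k] A)} (hz : IsInf z) :
    ∃ (n : ℕ) (t : Fin n → A) (y : Fin n → WithConv (A →ₗ[k] k)), (∀ i, IsInf (y i)) ∧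
      z = ∑ i, z.ofConv (t i) • scalarExt A (y i) := by
  -- The `y i` are the coordinate forms of a basis of the quotient and the `t i` lift that basis.
  -- Since `z` factors through the quotient, it is determined by its values on the `t i`.
  let b := Module.finBasis k (A ⧸ oneSqSpan k A)
  choose t ht using fun i => (oneSqSpan k A).mkQ_surjective (b i)
  refine ⟨_, t, fun i => toConv (b.coord i ∘ₗ (oneSqSpan k A).mkQ), fun i => ?_, ?_⟩
  · refine isInf_of_apply_eq_zero fun a ha => ?_
    change b.coord i ((oneSqSpan k A).mkQ a) = 0
    rw [show (oneSqSpan k A).mkQ a = 0 from (Submodule.Quotient.mk_eq_zero _).2 ha, map_zero]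
  · ext a
    have h : a - ∑ i, b.coord i ((oneSqSpan k A).mkQ a) • t i ∈ oneSqSpan k A := by
      refine (Submodule.Quotient.mk_eq_zero _).1 ?_
      change (oneSqSpan k A).mkQ _ = 0
      rw [map_sub, map_sum, sub_eq_zero]
      simp only [map_smul, ht]
      exact (b.sum_repr _).symm
    have h2 := hz.apply_eq_zero h
    rw [map_sub, sub_eq_zero, map_sum] at h2
    rw [h2, ofConv_sum, LinearMap.sum_apply]
    refine Finset.sum_congr rfl fun i _ => ?_
    rw [map_smul, Algebra.smul_def, mul_comm]
    rfl

/-- Composition with the counit, as a ring homomorphism of convolution rings. -/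
def counitPush : WithConv (A →ₗ[k] A) →+* WithConv (A →ₗ[k] k) where
  toFun x := toConv (Coalgebra.counit ∘ₗ x.ofConv)
  map_one' := by ext; simp
  map_mul' x y := congrArg toConv
    (LinearMap.algHom_comp_convMul_distrib (Bialgebra.counitAlgHom k A) x y)
  map_zero' := by ext; simp
  map_add' x y := by ext; simp

@[simp]
lemma counitPush_apply (x : WithConv (A →ₗ[k] A)) (a : A) :
    (counitPush x).ofConv a = Coalgebra.counit (R := k) (x.ofConv a) := rfl

/-- Composing with the counit specializes the generic point to the identity, where conjugation does
nothing. -/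
lemma counitPush_conj (x : WithConv (A →ₗ[k] k)) :
    counitPush (univInv k A * scalarExt A x * univ k A) = x := by
  have h1 : counitPush (univ k A) = 1 := by ext; simp [univ]
  have h2 : counitPush (univInv k A) = 1 := by ext; simp [univInv]
  have h3 : counitPush (scalarExt A x) = x := by ext; simp
  rw [map_mul, map_mul, h1, h2, h3, one_mul, mul_one]

variable (k A) in
/-- The space of infinitesimal characters: the Lie algebra of `Spec A`. -/
def infSubmodule : Submodule k (WithConv (A →ₗ[k] k)) where
  carrier := {x | IsInf x}
  add_mem' {x y} hx hy a b := by simp [hx a b, hy a b]; ring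
  zero_mem' a b := by simp
  smul_mem' c x hx a b := by simp [hx a b]; ring

/-- If there is a normalized integral on a local Hopf algebra, the adjoint action on
infinitesimal characters is trivial. -/
theorem IsInf.commute_univ [IsAlgClosed k] [FiniteDimensional k A] (p : ℕ) [hp : Fact p.Prime]
    [CharP k p] (hloc : ∀ a : A, Coalgebra.counit (R := k) a = 0 → IsNilpotent a)
    {I : A →ₗ[k] k} (hI : IsNormalizedIntegral I) {x : WithConv (A →ₗ[k] k)} (hx : IsInf x) :
    scalarExt A x * univ k A = univ k A * scalarExt A x := by
  have : FiniteDimensional k (WithConv (A →ₗ[k] k)) :=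
    Module.Finite.equiv (WithConv.linearEquiv k (A →ₗ[k] k)).symm
  have : Nontrivial A := ⟨0, 1, fun h => zero_ne_one (α := k) (by
    have := congrArg (Coalgebra.counit (R := k)) h
    simp at this)⟩
  have : CharP (WithConv (A →ₗ[k] A)) p :=
    charP_of_injective_algebraMap (algebraMap k _).injective p
  have : CharP (WithConv (A →ₗ[k] k)) p :=
    charP_of_injective_algebraMap (algebraMap k _).injective p
  have : CharP A p := charP_of_injective_algebraMap (algebraMap k _).injective p
  have hL : ∀ x ∈ infSubmodule k A, x ^ p ∈ infSubmodule k A := fun x hx =>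
    IsInf.pow_char hx p
  have hbr : ∀ x ∈ infSubmodule k A, ∀ y ∈ infSubmodule k A, x * y - y * x ∈ infSubmodule k A :=
    fun x hx y hy => IsInf.bracket hx hy
  have hn : ∀ x ∈ infSubmodule k A, x ^ p = 0 → x = 0 := fun x hx =>
    IsInf.eq_zero_of_pow_char_eq_zero p hloc hI hx
  -- The augmentation ideal is nilpotent, so a high power of Frobenius turns every function into a
  -- constant.
  obtain ⟨N, hN⟩ : ∃ N : ℕ, ∀ a : A, a ^ p ^ N = algebraMap k A (Coalgebra.counit a) ^ p ^ N := by
    have : IsNoetherianRing A := isNoetherian_of_isNoetherianRing_of_finite k A |> fun h =>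
      isNoetherian_of_tower k h
    obtain ⟨N, hN⟩ := IsNoetherianRing.isNilpotent_nilradical A
    refine ⟨N, fun a => ?_⟩
    have h1 : (a - algebraMap k A (Coalgebra.counit a)) ^ N = 0 := by
      have : (a - algebraMap k A (Coalgebra.counit a)) ^ N ∈ nilradical A ^ N :=
        Ideal.pow_mem_pow (mem_nilradical.2 (hloc _ (by simp))) N
      rwa [hN] at this
    have h2 := pow_eq_zero_of_le (Nat.lt_pow_self hp.out.one_lt).le h1
    rwa [sub_pow_char_pow, sub_eq_zero] at h2
  have hconj (x : WithConv (A →ₗ[k] k)) (n : ℕ) :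
      (univInv k A * scalarExt A x * univ k A) ^ n =
        univInv k A * scalarExt A (x ^ n) * univ k A := by
    induction n with
    | zero => simp [univInv_mul_univ]
    | succ n ih =>
      rw [pow_succ, ih, pow_succ x, map_mul]
      calc _ = univInv k A * scalarExt A (x ^ n) * (univ k A * univInv k A) * scalarExt A x *
          univ k A := by simp only [mul_assoc]
        _ = _ := by rw [univ_mul_univInv]; simp only [mul_assoc, mul_one]
  -- Expand the generic conjugate `z` of `x` as a combination of commuting infinitesimal characters
  -- `y i` with coefficients in `A`. The `p ^ N`-th power replaces the coefficients by constants,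
  -- namely the values at the identity, where `z` specializes to `x`. Hence `z ^ p ^ N = x ^ p ^ N`.
  have htriv {x : WithConv (A →ₗ[k] k)} (hx : IsInf x) :
      scalarExt A (x ^ p ^ N) * univ k A = univ k A * scalarExt A (x ^ p ^ N) := by
    have hz := (isInf_scalarExt (B := A) hx).conj
    obtain ⟨n, t, y, hy, hsum⟩ := hz.exists_eq_sum
    set z := univInv k A * scalarExt A x * univ k A with hzdef
    have hcomm (i j : Fin n) : Commute (y i) (y j) :=
      commute_of_no_nilpotent p hL hbr hn (hy i) (hy j)
    have h1 : z ^ p ^ N = ∑ i, algebraMap k A (Coalgebra.counit (z.ofConv (t i))) ^ p ^ N •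
        scalarExt A (y i ^ p ^ N) := by
      conv_lhs => rw [hsum]
      rw [sum_pow_char_pow_of_commute' p]
      · refine Finset.sum_congr rfl fun i _ => ?_
        rw [_root_.smul_pow, hN, map_pow]
      · intro i _ j _
        exact (((hcomm i j).map (scalarExt A)).smul_left _).smul_right _
    have h2 : x = ∑ i, Coalgebra.counit (R := k) (z.ofConv (t i)) • y i := by
      conv_lhs => rw [← counitPush_conj x, ← hzdef, hsum, map_sum]
      refine Finset.sum_congr rfl fun i _ => ?_
      ext a
      simp
    have h3 : x ^ p ^ N = ∑ i, Coalgebra.counit (R := k) (z.ofConv (t i)) ^ p ^ N •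
        y i ^ p ^ N := by
      conv_lhs => rw [h2]
      rw [sum_pow_char_pow_of_commute' p]
      · simp only [_root_.smul_pow]
      · intro i _ j _
        exact ((hcomm i j).smul_left _).smul_right _
    have h4 : z ^ p ^ N = scalarExt A (x ^ p ^ N) := by
      rw [h1, h3, map_sum]
      refine Finset.sum_congr rfl fun i _ => ?_
      ext a
      rw [scalarExt_apply, ofConv_smul, ofConv_smul, LinearMap.smul_apply, LinearMap.smul_apply,
        scalarExt_apply, smul_eq_mul, smul_eq_mul, map_mul, map_pow]
    rw [hzdef, hconj] at h4
    conv_rhs => rw [← h4]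
    simp only [← mul_assoc, univ_mul_univInv, one_mul]
  let Z : Submodule k (WithConv (A →ₗ[k] k)) :=
    { carrier := {x | scalarExt A x * univ k A = univ k A * scalarExt A x}
      add_mem' := fun {x y} hx hy => by
        simp only [Set.mem_ofPred_eq] at *
        rw [map_add, add_mul, mul_add, hx, hy]
      zero_mem' := by simp
      smul_mem' := fun c x hx => by
        simp only [Set.mem_ofPred_eq] at *
        have : scalarExt A (c • x) = c • scalarExt A x := by
          ext a
          change algebraMap k A (c * x.ofConv a) = c • algebraMap k A (x.ofConv a)
          rw [map_mul, Algebra.smul_def]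
        rw [this, smul_mul_assoc, mul_smul_comm, hx] }
  -- Remove the power of Frobenius one factor `p` at a time: `x ^ p ^ m` is in the span of the `x ^
  -- p ^ (m + i + 1)`, which are `p ^ (m + 1)`-th powers of the infinitesimal characters `x ^ p ^
  -- i`.
  have hdesc (j : ℕ) (hj : j ≤ N) : ∀ x, IsInf x → x ^ p ^ (N - j) ∈ Z := by
    induction j with
    | zero => exact fun x hx => htriv hx
    | succ j ih =>
      intro x hx
      have h1 := mem_span_pow_char p hL hn (pow_char_pow_mem p hL (N - (j + 1)) hx)
      refine Submodule.span_le.2 ?_ h1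
      rintro _ ⟨i, rfl⟩
      have h2 := ih (by omega) (x ^ p ^ i) (hx.pow_char_pow p i)
      rw [← pow_mul, ← pow_add] at h2
      simp only [SetLike.mem_coe]
      rw [← pow_mul, ← pow_add]
      have h3 : N - (j + 1) + (i + 1) = i + (N - j) := by omega
      rwa [h3]
  have := hdesc N le_rfl x hx
  rw [Nat.sub_self, pow_zero, pow_one] at this
  exact this

end Adjoint

/-! ### Points and the conjugation coaction -/

section Points

lemma conj_mul_eq {G : Type*} [Group G] (g h h' : G) :
    (h * h')⁻¹ * g * (h * h') = h'⁻¹ * (h⁻¹ * g * h) * h' := by group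

open WithConv

variable {k : Type*} [CommRing k] {A : Type*} [CommRing A] [HopfAlgebra k A]
  {B : Type*} [CommRing B] [Algebra k B] {C : Type*} [CommRing C] [Algebra k C]

instance ptInv : Inv (WithConv (A →ₐ[k] B)) where
  inv f := toConv (f.ofConv.comp (HopfAlgebra.antipodeAlgHom k A))

/-- The group of `B`-valued points of an affine group scheme. -/
instance ptGroup : Group (WithConv (A →ₐ[k] B)) where
  inv_mul_cancel f := by
    refine WithConv.ext (AlgHom.toLinearMap_injective ?_)
    have h : f.ofConv.toLinearMap ∘ₗ (toConv (HopfAlgebra.antipode k (A := A)) *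
        toConv LinearMap.id).ofConv =
        f.ofConv.toLinearMap ∘ₗ (1 : WithConv (A →ₗ[k] A)).ofConv := by
      rw [LinearMap.antipode_mul_id]
    rw [LinearMap.algHom_comp_convMul_distrib] at h
    refine h.trans (LinearMap.ext fun a => ?_)
    exact f.ofConv.commutes _

/-- Points of the affine group scheme with functions `A`: functoriality in the ring. -/
def ptMap (F : B →ₐ[k] C) : WithConv (A →ₐ[k] B) →* WithConv (A →ₐ[k] C) where
  toFun x := toConv (F.comp x.ofConv)
  map_one' := by
    refine WithConv.ext (AlgHom.ext fun a => ?_)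
    exact F.commutes _
  map_mul' x y := congrArg toConv (AlgHom.comp_convMul_distrib F x y)

lemma ptMap_apply (F : B →ₐ[k] C) (x : WithConv (A →ₐ[k] B)) :
    ptMap F x = toConv (F.comp x.ofConv) := rfl

lemma ptMap_conj (F : B →ₐ[k] C) (x y : WithConv (A →ₐ[k] B)) :
    ptMap F (x⁻¹ * y * x) = (ptMap F x)⁻¹ * ptMap F y * ptMap F x := by
  rw [map_mul, map_mul, map_inv]

/-- Points, as elements of the convolution ring. -/
def ptLinear : WithConv (A →ₐ[k] B) →* WithConv (A →ₗ[k] B) where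
  toFun x := toConv x.ofConv.toLinearMap
  map_one' := rfl
  map_mul' _ _ := AlgHom.toLinearMap_convMul _ _

@[simp]
lemma ptLinear_apply (x : WithConv (A →ₐ[k] B)) (a : A) :
    (ptLinear x).ofConv a = x.ofConv a := rfl

variable (k A) in
/-- The first generic point. -/
def genLeft : WithConv (A →ₐ[k] A ⊗[k] A) := toConv Algebra.TensorProduct.includeLeft

variable (k A) in
/-- The second generic point. -/
def genRight : WithConv (A →ₐ[k] A ⊗[k] A) := toConv Algebra.TensorProduct.includeRight

lemma genLeft_mul_genRight :
    genLeft k A * genRight k A = toConv (Bialgebra.comulAlgHom k A) := by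
  refine WithConv.ext (AlgHom.ext fun a => ?_)
  change Algebra.TensorProduct.lmul' k (S := A ⊗[k] A) (TensorProduct.map
    (Algebra.TensorProduct.includeLeft : A →ₐ[k] A ⊗[k] A).toLinearMap
    (Algebra.TensorProduct.includeRight : A →ₐ[k] A ⊗[k] A).toLinearMap
    (Coalgebra.comul a)) = Coalgebra.comul a
  generalize (Coalgebra.comul a : A ⊗[k] A) = z
  induction z with
  | zero => simp
  | add x y hx hy => simp only [map_add, hx, hy]
  | tmul x y => simp

lemma genRight_mul_genLeft (a : A) :
    (genRight k A * genLeft k A).ofConv a =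
      TensorProduct.comm k A A (Coalgebra.comul a) := by
  change Algebra.TensorProduct.lmul' k (S := A ⊗[k] A) (TensorProduct.map
    (Algebra.TensorProduct.includeRight : A →ₐ[k] A ⊗[k] A).toLinearMap
    (Algebra.TensorProduct.includeLeft : A →ₐ[k] A ⊗[k] A).toLinearMap
    (Coalgebra.comul a)) = _
  generalize (Coalgebra.comul a : A ⊗[k] A) = z
  induction z with
  | zero => simp
  | add x y hx hy => simp only [map_add, hx, hy]
  | tmul x y => simp

variable (k A) in
/-- The conjugate `h⁻¹ g h` of the generic points. -/
def genConj : WithConv (A →ₐ[k] A ⊗[k] A) := (genRight k A)⁻¹ * genLeft k A * genRight k A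

variable (k A) in
/-- The conjugation coaction. -/
def conjCoaction : Coaction k A A where
  toLin := (genConj k A).ofConv.toLinearMap
  coassoc := by
    -- Coassociativity is an identity between points of `G` over the triple tensor product, with
    -- generic points `g`, `h`, `h'`: conjugating by `h h'` agrees with substituting `h⁻¹ g h` for
    -- `g` and conjugating by `h'`.
    let F₁ : A ⊗[k] A →ₐ[k] A ⊗[k] (A ⊗[k] A) :=
      Algebra.TensorProduct.map (AlgHom.id k A) (Bialgebra.comulAlgHom k A)
    let F₂ : A ⊗[k] A →ₐ[k] A ⊗[k] (A ⊗[k] A) :=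
      (Algebra.TensorProduct.assoc k k k A A A).toAlgHom.comp
        (Algebra.TensorProduct.map (genConj k A).ofConv (AlgHom.id k A))
    let E : A ⊗[k] A →ₐ[k] A ⊗[k] (A ⊗[k] A) :=
      Algebra.TensorProduct.map (AlgHom.id k A) Algebra.TensorProduct.includeLeft
    let g : WithConv (A →ₐ[k] A ⊗[k] (A ⊗[k] A)) := toConv Algebra.TensorProduct.includeLeft
    let h : WithConv (A →ₐ[k] A ⊗[k] (A ⊗[k] A)) :=
      ptMap Algebra.TensorProduct.includeRight (genLeft k A)
    let h' : WithConv (A →ₐ[k] A ⊗[k] (A ⊗[k] A)) :=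
      ptMap Algebra.TensorProduct.includeRight (genRight k A)
    have h1 : ptMap F₁ (genLeft k A) = g := by
      refine WithConv.ext (AlgHom.ext fun a => ?_)
      simp [ptMap_apply, F₁, g, genLeft]
    have h2 : ptMap F₁ (genRight k A) = h * h' := by
      rw [← map_mul, genLeft_mul_genRight]
      refine WithConv.ext (AlgHom.ext fun a => ?_)
      simp [ptMap_apply, F₁, genRight]
    have h3 : ptMap E (genLeft k A) = g := by
      refine WithConv.ext (AlgHom.ext fun a => ?_)
      simp [ptMap_apply, E, g, genLeft, Algebra.TensorProduct.one_def]
    have h4 : ptMap E (genRight k A) = h := by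
      refine WithConv.ext (AlgHom.ext fun a => ?_)
      simp [ptMap_apply, E, h, genRight, genLeft]
    have h5 : ptMap F₂ (genLeft k A) = h⁻¹ * g * h := by
      rw [← h3, ← h4]
      refine Eq.trans ?_ (ptMap_conj E _ _)
      refine WithConv.ext (AlgHom.ext fun a => ?_)
      change F₂ (a ⊗ₜ 1) = E ((genConj k A).ofConv a)
      simp only [F₂, E, AlgHom.comp_apply, Algebra.TensorProduct.map_tmul, map_one]
      generalize (genConj k A).ofConv a = z
      induction z with
      | zero => simp
      | add x y hx hy => simp only [map_add, TensorProduct.add_tmul, hx, hy]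
      | tmul x y => simp
    have h6 : ptMap F₂ (genRight k A) = h' := by
      refine WithConv.ext (AlgHom.ext fun a => ?_)
      simp [ptMap_apply, F₂, h', genRight, Algebra.TensorProduct.one_def]
    have key : ptMap F₁ (genConj k A) = ptMap F₂ (genConj k A) := by
      refine (ptMap_conj F₁ _ _).trans (Eq.trans ?_ (ptMap_conj F₂ _ _).symm)
      rw [h1, h2, h5, h6]
      exact conj_mul_eq g h h'
    refine LinearMap.ext fun a => ?_
    exact congrArg (fun f => f.ofConv a) key
  counit := by
    let Q : A ⊗[k] A →ₐ[k] A := (Algebra.TensorProduct.rid k k A).toAlgHom.comp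
      (Algebra.TensorProduct.map (AlgHom.id k A) (Bialgebra.counitAlgHom k A))
    have h1 : ptMap Q (genLeft k A) = toConv (AlgHom.id k A) := by
      refine WithConv.ext (AlgHom.ext fun a => ?_)
      simp [ptMap_apply, Q, genLeft]
    have h2 : ptMap Q (genRight k A) = 1 := by
      refine WithConv.ext (AlgHom.ext fun a => ?_)
      simp [ptMap_apply, Q, genRight, Algebra.algebraMap_eq_smul_one]
    have key : ptMap Q (genConj k A) = toConv (AlgHom.id k A) := by
      refine (ptMap_conj Q _ _).trans ?_
      rw [h1, h2, inv_one, one_mul, mul_one]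
    refine LinearMap.ext fun a => ?_
    exact congrArg (fun f => f.ofConv a) key

/-- If the conjugation coaction is trivial then the Hopf algebra is cocommutative. -/
lemma isCocomm_of_genConj (h : genConj k A = genLeft k A) : Coalgebra.IsCocomm k A where
  comm_comp_comul := by
    have h1 : genLeft k A * genRight k A = genRight k A * genLeft k A := by
      conv_rhs => rw [← h, genConj]
      rw [mul_assoc]
      exact (mul_inv_cancel_left _ _).symm
    refine LinearMap.ext fun a => ?_
    have h2 := congrArg (fun f => f.ofConv a) h1
    simp only [genRight_mul_genLeft, genLeft_mul_genRight] at h2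
    exact h2.symm

end Points

/-! ### Local linearly reductive Hopf algebras are cocommutative -/

section Cocomm

open WithConv

variable {k : Type*} [Field k] {A : Type*} [CommRing A] [HopfAlgebra k A]

/-- The right `A`-linear map `a ⊗ b ↦ x(a) b`. -/
def contractLeft (x : A →ₗ[k] k) : A ⊗[k] A →ₗ[k] A :=
  (TensorProduct.lid k A).toLinearMap ∘ₗ x.rTensor A

@[simp]
lemma contractLeft_tmul (x : A →ₗ[k] k) (a b : A) : contractLeft x (a ⊗ₜ b) = x a • b := by
  simp [contractLeft]

lemma contractLeft_includeRight_mul (x : A →ₗ[k] k) (w : A) (z : A ⊗[k] A) :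
    contractLeft x (Algebra.TensorProduct.includeRight w * z) = w * contractLeft x z := by
  induction z with
  | zero => simp
  | add y z hy hz => simp only [map_add, mul_add, hy, hz]
  | tmul a b => simp

/-- Contraction of the left factor is linear over the right one, so it passes through convolution
with a point supported on the right factor. -/
lemma contractLeft_conv_mul (x : A →ₗ[k] k) (u : WithConv (A →ₐ[k] A))
    (y : WithConv (A →ₗ[k] A ⊗[k] A)) :
    toConv (contractLeft x ∘ₗ
      (ptLinear (ptMap Algebra.TensorProduct.includeRight u) * y).ofConv) =
      ptLinear u * toConv (contractLeft x ∘ₗ y.ofConv) := by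
  refine WithConv.ext (LinearMap.ext fun a => ?_)
  change contractLeft x ((ptLinear (ptMap Algebra.TensorProduct.includeRight u) * y).ofConv a) =
    (ptLinear u * toConv (contractLeft x ∘ₗ y.ofConv)).ofConv a
  rw [(Coalgebra.Repr.arbitrary k a).convMul_apply, (Coalgebra.Repr.arbitrary k a).convMul_apply,
    map_sum]
  exact Finset.sum_congr rfl fun i _ => contractLeft_includeRight_mul _ _ _

lemma contractLeft_mul_conv (x : A →ₗ[k] k) (u : WithConv (A →ₐ[k] A))
    (y : WithConv (A →ₗ[k] A ⊗[k] A)) :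
    toConv (contractLeft x ∘ₗ
      (y * ptLinear (ptMap Algebra.TensorProduct.includeRight u)).ofConv) =
      toConv (contractLeft x ∘ₗ y.ofConv) * ptLinear u := by
  refine WithConv.ext (LinearMap.ext fun a => ?_)
  change contractLeft x ((y * ptLinear (ptMap Algebra.TensorProduct.includeRight u)).ofConv a) =
    (toConv (contractLeft x ∘ₗ y.ofConv) * ptLinear u).ofConv a
  rw [(Coalgebra.Repr.arbitrary k a).convMul_apply, (Coalgebra.Repr.arbitrary k a).convMul_apply,
    map_sum]
  refine Finset.sum_congr rfl fun i _ => ?_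
  rw [mul_comm, mul_comm _ ((ptLinear u).ofConv _)]
  exact contractLeft_includeRight_mul _ _ _

/-- The conjugation coaction, contracted with a linear form. -/
lemma contractLeft_genConj (x : WithConv (A →ₗ[k] k)) (a : A) :
    contractLeft x.ofConv ((genConj k A).ofConv a) =
      (univInv k A * scalarExt A x * univ k A).ofConv a := by
  have h1 : genRight k A = ptMap Algebra.TensorProduct.includeRight (toConv (AlgHom.id k A)) := rfl
  have h2 : (genRight k A)⁻¹ = ptMap Algebra.TensorProduct.includeRight
      (toConv (HopfAlgebra.antipodeAlgHom k A)) := rfl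
  have h3 : toConv (contractLeft x.ofConv ∘ₗ (ptLinear (genLeft k A)).ofConv) = scalarExt A x := by
    refine WithConv.ext (LinearMap.ext fun a => ?_)
    change contractLeft x.ofConv (a ⊗ₜ 1) = algebraMap k A (x.ofConv a)
    rw [contractLeft_tmul, Algebra.algebraMap_eq_smul_one]
  have h4 : ptLinear (genConj k A) = ptLinear (genRight k A)⁻¹ * ptLinear (genLeft k A) *
      ptLinear (genRight k A) := by
    rw [← map_mul, ← map_mul]; rfl
  have h5 : toConv (contractLeft x.ofConv ∘ₗ (ptLinear (genConj k A)).ofConv) =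
      univInv k A * scalarExt A x * univ k A := by
    rw [h4, h2, h1, contractLeft_mul_conv, contractLeft_conv_mul, h3]
    rfl
  exact congrArg (fun f => f.ofConv a) h5

variable (k A) in
/-- The augmentation ideal. -/
def augIdeal : Ideal A := RingHom.ker (Bialgebra.counitAlgHom k A)

lemma mem_augIdeal {a : A} : a ∈ augIdeal k A ↔ Coalgebra.counit (R := k) a = 0 := Iff.rfl

lemma mem_augIdeal_sq {a : A} (h : a ∈ oneSqSpan k A) (h0 : Coalgebra.counit (R := k) a = 0) :
    a ∈ augIdeal k A ^ 2 := by
  have key : oneSqSpan k A ≤ (k ∙ (1 : A)) ⊔ ((augIdeal k A ^ 2).restrictScalars k) := by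
    rw [oneSqSpan, Submodule.span_le]
    rintro _ (rfl | ⟨a, b, ha, hb, rfl⟩)
    · exact Submodule.mem_sup_left (Submodule.mem_span_singleton_self _)
    · refine Submodule.mem_sup_right ?_
      rw [Submodule.restrictScalars_mem, pow_two]
      exact Ideal.mul_mem_mul ha hb
  obtain ⟨y, hy, z, hz, rfl⟩ := Submodule.mem_sup.1 (key h)
  obtain ⟨c, rfl⟩ := Submodule.mem_span_singleton.1 hy
  rw [Submodule.restrictScalars_mem] at hz
  have hz1 : Coalgebra.counit (R := k) z = 0 := Ideal.pow_le_self two_ne_zero hz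
  rw [map_add, hz1, map_smul, Bialgebra.counit_one, smul_eq_mul, mul_one, add_zero] at h0
  rw [h0, zero_smul, zero_add]
  exact hz

lemma mem_oneSqSpan_of_forall {a : A}
    (h : ∀ x : WithConv (A →ₗ[k] k), IsInf x → x.ofConv a = 0) : a ∈ oneSqSpan k A := by
  by_contra ha
  obtain ⟨f, hf, hle⟩ := Submodule.exists_le_ker_of_notMem ha
  exact hf (h (toConv f) (isInf_of_apply_eq_zero fun b hb => hle hb))

/-- Expand `w` in a basis of the right factor. Every contraction that kills `w` kills each left
coefficient, so these have counit zero and are annihilated by all infinitesimal characters, hence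
lie in the square of the augmentation ideal. -/
lemma mem_map_includeLeft {w : A ⊗[k] A} (h0 : contractLeft Coalgebra.counit w = 0)
    (h : ∀ x : WithConv (A →ₗ[k] k), IsInf x → contractLeft x.ofConv w = 0) :
    w ∈ (augIdeal k A ^ 2).map (Algebra.TensorProduct.includeLeft : A →ₐ[k] A ⊗[k] A) := by
  let b := Module.Free.chooseBasis k A
  obtain ⟨s, c, rfl⟩ : ∃ (s : Finset _) (c : _ → A), w = ∑ j ∈ s, c j ⊗ₜ b j := by
    obtain ⟨c, rfl⟩ := TensorProduct.eq_repr_basis_right b w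
    exact ⟨_, _, rfl⟩
  have key (x : A →ₗ[k] k) (hx : contractLeft x (∑ j ∈ s, c j ⊗ₜ b j) = 0) :
      ∀ j ∈ s, x (c j) = 0 := by
    rw [map_sum] at hx
    simp only [contractLeft_tmul] at hx
    exact linearIndependent_iff'.1 b.linearIndependent s _ hx
  refine Ideal.sum_mem _ fun j hj => ?_
  have h1 : c j ∈ augIdeal k A ^ 2 :=
    mem_augIdeal_sq (mem_oneSqSpan_of_forall fun x hx => key _ (h x hx) j hj) (key _ h0 j hj)
  have h2 : c j ⊗ₜ[k] b j = (Algebra.TensorProduct.includeLeft : A →ₐ[k] A ⊗[k] A) (c j) *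
      Algebra.TensorProduct.includeRight (b j) := by simp
  rw [h2]
  exact Ideal.mul_mem_right _ _ (Ideal.mem_map_of_mem _ h1)

/-- The deviation of the conjugation coaction from the trivial one raises the augmentation
filtration. -/
lemma genConj_sub_mem
    (hcomm : ∀ x : WithConv (A →ₗ[k] k), IsInf x →
      scalarExt A x * univ k A = univ k A * scalarExt A x) (i : ℕ) :
    ∀ f ∈ augIdeal k A ^ i, (genConj k A).ofConv f - f ⊗ₜ 1 ∈
      (augIdeal k A ^ (i + 1)).map (Algebra.TensorProduct.includeLeft : A →ₐ[k] A ⊗[k] A) := by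
  have hconj (x : WithConv (A →ₗ[k] k))
      (hx : scalarExt A x * univ k A = univ k A * scalarExt A x) (f : A) :
      contractLeft x.ofConv ((genConj k A).ofConv f - f ⊗ₜ 1) = 0 := by
    rw [map_sub, contractLeft_genConj, mul_assoc, hx, ← mul_assoc, univInv_mul_univ, one_mul,
      contractLeft_tmul, scalarExt_apply, Algebra.algebraMap_eq_smul_one, sub_self]
  -- Triviality of the adjoint action on infinitesimal characters puts the deviation of any function
  -- in the square of the augmentation ideal, extended to the tensor product.
  have hsq (f : A) : (genConj k A).ofConv f - f ⊗ₜ 1 ∈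
      (augIdeal k A ^ 2).map (Algebra.TensorProduct.includeLeft : A →ₐ[k] A ⊗[k] A) := by
    refine mem_map_includeLeft ?_ fun x hx => hconj x (hcomm x hx) f
    have h1 := hconj 1 (by rw [map_one, one_mul, mul_one]) f
    exact h1
  induction i with
  | zero =>
    intro f _
    exact Ideal.map_mono (Ideal.pow_le_pow_right (by norm_num)) (hsq f)
  | succ i ih =>
    intro f hf
    rw [pow_succ] at hf
    induction hf using Submodule.mul_induction_on' with
    | add x _ y _ hx hy =>
      rw [map_add, TensorProduct.add_tmul, add_sub_add_comm]
      exact add_mem hx hy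
    | mem_mul_mem a ha b hb =>
      have hA := ih a ha
      have hB := hsq b
      have hA' : a ⊗ₜ[k] (1 : A) ∈ (augIdeal k A ^ i).map
          (Algebra.TensorProduct.includeLeft : A →ₐ[k] A ⊗[k] A) := Ideal.mem_map_of_mem _ ha
      have hB' : b ⊗ₜ[k] (1 : A) ∈ (augIdeal k A).map
          (Algebra.TensorProduct.includeLeft : A →ₐ[k] A ⊗[k] A) := Ideal.mem_map_of_mem _ hb
      -- Writing `δ` for the deviation, `δ(ab) = δ(a) δ(b) + δ(a) (b ⊗ 1) + (a ⊗ 1) δ(b)`. Here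
      -- `δ(a)` has filtration degree `i + 1` and `δ(b)` has degree `2`, so every term has degree at
      -- least `i + 2`.
      have h1 : (genConj k A).ofConv (a * b) - (a * b) ⊗ₜ[k] (1 : A) =
          ((genConj k A).ofConv a - a ⊗ₜ 1) * ((genConj k A).ofConv b - b ⊗ₜ 1) +
          ((genConj k A).ofConv a - a ⊗ₜ 1) * (b ⊗ₜ 1) +
          (a ⊗ₜ 1) * ((genConj k A).ofConv b - b ⊗ₜ 1) := by
        have : (a * b) ⊗ₜ[k] (1 : A) = (a ⊗ₜ 1) * (b ⊗ₜ 1) := by simp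
        rw [map_mul, this]
        ring
      rw [h1]
      have hle (m n l : ℕ) (h : l ≤ m + n) {x y : A ⊗[k] A}
          (hx : x ∈ (augIdeal k A ^ m).map
            (Algebra.TensorProduct.includeLeft : A →ₐ[k] A ⊗[k] A))
          (hy : y ∈ (augIdeal k A ^ n).map
            (Algebra.TensorProduct.includeLeft : A →ₐ[k] A ⊗[k] A)) :
          x * y ∈ (augIdeal k A ^ l).map
            (Algebra.TensorProduct.includeLeft : A →ₐ[k] A ⊗[k] A) := by
        refine Ideal.map_mono (Ideal.pow_le_pow_right h) ?_
        rw [pow_add, Ideal.map_mul]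
        exact Ideal.mul_mem_mul hx hy
      refine add_mem (add_mem (hle _ _ _ (by omega) hA hB) ?_) (hle _ _ _ (by omega) hA' hB)
      exact hle (i + 1) 1 _ (by omega) hA (by rwa [pow_one])

/-- Integration over the second factor is linear over the first. With `genConj_sub_mem` it shows
that averaging changes a function only by terms of higher filtration degree. -/
lemma rid_lTensor_mem {I : A →ₗ[k] k} {J : Ideal A} {w : A ⊗[k] A}
    (hw : w ∈ J.map (Algebra.TensorProduct.includeLeft : A →ₐ[k] A ⊗[k] A)) :
    TensorProduct.rid k A (I.lTensor A w) ∈ J := by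
  suffices h : ∀ z : A ⊗[k] A, TensorProduct.rid k A (I.lTensor A (z * w)) ∈ J by
    simpa using h 1
  refine Submodule.span_induction
    (p := fun w _ => ∀ z : A ⊗[k] A, TensorProduct.rid k A (I.lTensor A (z * w)) ∈ J)
    ?_ (by simp) (fun x y _ _ hx hy z => ?_) (fun c x _ hx z => ?_) hw
  · rintro _ ⟨a, ha, rfl⟩ z
    induction z with
    | zero => simp
    | add x y hx hy => rw [add_mul, map_add, map_add]; exact add_mem hx hy
    | tmul x y =>
      have h1 : x ⊗ₜ[k] y * (Algebra.TensorProduct.includeLeft : A →ₐ[k] A ⊗[k] A) a =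
          (x * a) ⊗ₜ y := by simp
      refine (congrArg (fun t => TensorProduct.rid k A (I.lTensor A t) ∈ J) h1).mpr ?_
      simp only [LinearMap.lTensor_tmul, TensorProduct.rid_tmul, Algebra.smul_def]
      exact J.mul_mem_left _ (J.mul_mem_left _ ha)
  · rw [mul_add, map_add, map_add]
    exact add_mem (hx z) (hy z)
  · rw [smul_eq_mul, ← mul_assoc]
    exact hx _

/-- A local Hopf algebra with a normalized integral whose conjugation action on infinitesimal
characters is trivial, is cocommutative. -/
theorem isCocomm_of_commute_univ [FiniteDimensional k A]
    (hloc : ∀ a : A, Coalgebra.counit (R := k) a = 0 → IsNilpotent a)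
    {I : A →ₗ[k] k} (hI : IsNormalizedIntegral I)
    (hcomm : ∀ x : WithConv (A →ₗ[k] k), IsInf x →
      scalarExt A x * univ k A = univ k A * scalarExt A x) : Coalgebra.IsCocomm k A := by
  have hA : IsNoetherianRing A := isNoetherian_of_tower k inferInstance
  obtain ⟨n, hn⟩ : ∃ n, augIdeal k A ^ n = ⊥ := by
    obtain ⟨n, hn⟩ := IsNoetherianRing.isNilpotent_nilradical A
    refine ⟨n, le_bot_iff.1 (le_trans (Ideal.pow_right_mono ?_ n) hn.le)⟩
    exact fun a ha => mem_nilradical.2 (hloc a ha)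
  -- Descending induction on the filtration: the average of `f` is invariant, and it differs from
  -- `f` by an element one step deeper, invariant by induction.
  have hinv : ∀ j ≤ n, ∀ f ∈ augIdeal k A ^ (n - j), f ∈ (conjCoaction k A).invariants := by
    intro j
    induction j with
    | zero =>
      intro _ f hf
      rw [Nat.sub_zero, hn] at hf
      rw [(Submodule.mem_bot A).1 hf]
      exact zero_mem _
    | succ j ih =>
      intro hj f hf
      have h1 := rid_lTensor_mem (I := I) (genConj_sub_mem hcomm _ f hf)
      rw [show n - (j + 1) + 1 = n - j by omega] at h1
      have h2 := ih (by omega) _ h1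
      have h3 : TensorProduct.rid k A (I.lTensor A ((genConj k A).ofConv f - f ⊗ₜ 1)) =
          (conjCoaction k A).reynolds I f - f := by
        rw [map_sub, map_sub, LinearMap.lTensor_tmul, hI.map_one, TensorProduct.rid_tmul, one_smul]
        rfl
      rw [h3] at h2
      have h4 := sub_mem ((conjCoaction k A).reynolds_mem_invariants hI f) h2
      rwa [sub_sub_cancel] at h4
  refine isCocomm_of_genConj (WithConv.ext (AlgHom.ext fun f => ?_))
  have := hinv n le_rfl f (by rw [Nat.sub_self, pow_zero, Ideal.one_eq_top]; trivial)
  exact Coaction.mem_invariants.1 this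

/-- A finite local Hopf algebra with a normalized integral over an algebraically closed field is
cocommutative. -/
theorem IsNormalizedIntegral.isCocomm [IsAlgClosed k] [FiniteDimensional k A]
    (hloc : ∀ a : A, Coalgebra.counit (R := k) a = 0 → IsNilpotent a)
    {I : A →ₗ[k] k} (hI : IsNormalizedIntegral I) : Coalgebra.IsCocomm k A := by
  refine isCocomm_of_commute_univ hloc hI fun x hx => ?_
  obtain ⟨p, hp⟩ := CharP.exists k
  rcases CharP.char_is_prime_or_zero k p with h | rfl
  · have := Fact.mk h
    exact hx.commute_univ p hloc hI
  · have := CharP.charP_to_charZero k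
    rw [hx.eq_zero_of_charZero hloc, map_zero, zero_mul, mul_zero]

end Cocomm

/-! ### Cocommutative Hopf algebras with an integral are spanned by group-like elements -/

section GroupLike

open WithConv

variable {k : Type*} [Field k] {A : Type*} [CommRing A] [HopfAlgebra k A]

lemma genLeft_commute_genRight [Coalgebra.IsCocomm k A] :
    genLeft k A * genRight k A = genRight k A * genLeft k A := by
  refine WithConv.ext (AlgHom.ext fun a => ?_)
  rw [genRight_mul_genLeft, genLeft_mul_genRight]
  exact (Coalgebra.comm_comul k a).symm

lemma inv_mul_inv_of_commute {G : Type*} [Group G] {g h : G} (hgh : g * h = h * g) :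
    g⁻¹ * h⁻¹ = (g * h)⁻¹ := by
  rw [hgh, mul_inv_rev]

/-- Cocommutativity makes the generic points `g` and `h` commute, and `g⁻¹ h⁻¹ = (g h)⁻¹` says that
the antipode respects comultiplication. -/
lemma map_antipode_comul [Coalgebra.IsCocomm k A] (a : A) :
    TensorProduct.map (HopfAlgebra.antipode k) (HopfAlgebra.antipode k)
      (Coalgebra.comul a : A ⊗[k] A) = Coalgebra.comul (HopfAlgebra.antipode k a) := by
  have h1 := congrArg (fun f => f.ofConv a)
    (inv_mul_inv_of_commute (genLeft_commute_genRight (k := k) (A := A)))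
  rw [genLeft_mul_genRight] at h1
  refine Eq.trans ?_ h1
  change _ = Algebra.TensorProduct.lmul' k (S := A ⊗[k] A) (TensorProduct.map
    ((Algebra.TensorProduct.includeLeft : A →ₐ[k] A ⊗[k] A).comp
      (HopfAlgebra.antipodeAlgHom k A)).toLinearMap
    ((Algebra.TensorProduct.includeRight : A →ₐ[k] A ⊗[k] A).comp
      (HopfAlgebra.antipodeAlgHom k A)).toLinearMap
    (Coalgebra.comul a))
  generalize (Coalgebra.comul a : A ⊗[k] A) = z
  induction z with
  | zero => simp
  | add x y hx hy => simp only [map_add, hx, hy]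
  | tmul x y => simp

variable (k A) in
/-- The antipode of a cocommutative Hopf algebra, as a morphism of coalgebras. -/
def antipodeCoalgHom [Coalgebra.IsCocomm k A] : A →ₗc[k] A where
  toLinearMap := HopfAlgebra.antipode k
  counit_comp := by ext; simp
  map_comp_comul := by ext a; exact map_antipode_comul a

variable (k A) in
/-- The morphism of coalgebras `a ⊗ b ↦ a S(b)`. -/
def mulAntipode [Coalgebra.IsCocomm k A] : A ⊗[k] A →ₗc[k] A :=
  (Bialgebra.mulBialgHom k A : A ⊗[k] A →ₗc[k] A).comp
    (Coalgebra.TensorProduct.map (CoalgHom.id k A) (antipodeCoalgHom k A))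

@[simp]
lemma mulAntipode_tmul [Coalgebra.IsCocomm k A] (a b : A) :
    mulAntipode k A (a ⊗ₜ b) = a * HopfAlgebra.antipode k b := by
  simp [mulAntipode]; rfl

/-- Invariance of the integral, read as `a₁ I(a₂) = I(a)` in the convolution ring of `A`-valued
forms. -/
lemma IsNormalizedIntegral.univ_mul {I : A →ₗ[k] k} (hI : IsNormalizedIntegral I) :
    univ k A * scalarExt A (toConv I) = scalarExt A (toConv I) := by
  refine WithConv.ext (LinearMap.ext fun a => ?_)
  rw [scalarExt_apply, ofConv_toConv, ← hI.rid_lTensor_comul]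
  change LinearMap.mul' k A (TensorProduct.map _ _ (Coalgebra.comul a)) = _
  generalize (Coalgebra.comul a : A ⊗[k] A) = z
  induction z with
  | zero => simp
  | add x y hx hy => simp only [map_add, hx, hy]
  | tmul x y => simp [univ, Algebra.smul_def, mul_comm]

/-- The form `a ⊗ b ↦ I(a S(b))` is balanced. -/
lemma IsNormalizedIntegral.balanced [Coalgebra.IsCocomm k A] {I : A →ₗ[k] k}
    (hI : IsNormalizedIntegral I) (s : WithConv (A →ₗ[k] k)) :
    convTensor 1 s * toConv (I ∘ₗ (mulAntipode k A).toLinearMap) =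
      convTensor s 1 * toConv (I ∘ₗ (mulAntipode k A).toLinearMap) := by
  set T : WithConv (A ⊗[k] A →ₗ[k] k) := toConv (I ∘ₗ (mulAntipode k A).toLinearMap)
  -- Invariance of `I` pulled back along the coalgebra morphism `a ⊗ b ↦ a S(b)`. Since the
  -- convolution ring is commutative, the inverse of the right generic point can be moved to the
  -- other side; applying `s` then gives the claim.
  have h1 : leftHom (univ k A) * rightHom (univInv k A) * scalarExt A T = scalarExt A T := by
    have h := congrArg (fun f => toConv (f.ofConv ∘ₗ (mulAntipode k A).toLinearMap)) hI.univ_mul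
    have h2 := congrArg toConv (LinearMap.convMul_comp_coalgHom_distrib (univ k A)
      (scalarExt A (toConv I)) (mulAntipode k A))
    have h3 : leftHom (univ k A) * rightHom (univInv k A) =
        toConv ((univ k A).ofConv ∘ₗ (mulAntipode k A).toLinearMap) := by
      rw [leftHom_apply, rightHom_apply, convTensor_mul, mul_one, one_mul]
      refine conv_ext_tmul fun a b => ?_
      rw [convTensor_apply]
      exact (mulAntipode_tmul a b).symm
    rw [h3]
    exact h2.symm.trans h
  have h2 : leftHom (univ k A) * scalarExt A T = rightHom (univ k A) * scalarExt A T := by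
    conv_rhs => rw [← h1]
    have h : (rightHom (univ k A) : WithConv (A ⊗[k] A →ₗ[k] A)) * rightHom (univInv k A) = 1 := by
      rw [← map_mul, univ_mul_univInv, RingHom.map_one]
    rw [mul_comm (leftHom (univ k A)) (rightHom (univInv k A)), ← mul_assoc, ← mul_assoc, h,
      one_mul]
  have h3 := congrArg (fun f => toConv (s.ofConv ∘ₗ f.ofConv)) h2
  simp only [mul_comm _ (scalarExt A T)] at h3
  rw [comp_scalarExt_mul, comp_scalarExt_mul] at h3
  have h4 : toConv (s.ofConv ∘ₗ (leftHom (univ k A)).ofConv) = convTensor s 1 :=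
    conv_ext_tmul fun a b => by
      change s.ofConv ((leftHom (univ k A)).ofConv (a ⊗ₜ b)) = _
      rw [leftHom_apply, convTensor_apply, convTensor_apply, LinearMap.convOne_apply, mul_comm,
        ← Algebra.smul_def, map_smul, LinearMap.convOne_apply, smul_eq_mul, mul_comm]
      rfl
  have h5 : toConv (s.ofConv ∘ₗ (rightHom (univ k A)).ofConv) = convTensor 1 s :=
    conv_ext_tmul fun a b => by
      change s.ofConv ((rightHom (univ k A)).ofConv (a ⊗ₜ b)) = _
      rw [rightHom_apply, convTensor_apply, convTensor_apply, LinearMap.convOne_apply,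
        ← Algebra.smul_def, map_smul, LinearMap.convOne_apply, smul_eq_mul]
      rfl
  rw [h4, h5] at h3
  have h6 : scalarExt k T = T := by ext; rfl
  rw [h6] at h3
  rw [mul_comm _ T, mul_comm _ T]
  exact h3.symm

/-- A commutative algebra dual to a coalgebra `A` is reduced if there is a linear form on `A ⊗ A`
which is a separability idempotent. -/
lemma isReduced_of_separability {H : Type*} [CommRing H] [Algebra k H] [FiniteDimensional k A]
    (e : H ≃+ WithConv (A →ₗ[k] k)) (hes : ∀ (c : k) x, e (c • x) = c • e x)
    (hem : ∀ x y, e (x * y) = e x * e y) (he1 : e 1 = 1)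
    (T : WithConv (A ⊗[k] A →ₗ[k] k))
    (hT : ∀ s : WithConv (A →ₗ[k] k), convTensor 1 s * T = convTensor s 1 * T)
    (hT1 : ∀ a, T.ofConv (Coalgebra.comul a) = Coalgebra.counit (R := k) a) : IsReduced H := by
  let e' : H ≃ₗ[k] Module.Dual k A :=
    { toFun := fun x => (e x).ofConv
      invFun := fun f => e.symm (toConv f)
      map_add' := fun x y => by rw [map_add]; rfl
      map_smul' := fun c x => by rw [hes]; rfl
      left_inv := fun x => by simp
      right_inv := fun x => by simp }
  have : FiniteDimensional k H := Module.Finite.equiv e'.symm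
  -- `H ⊗ H` is the convolution algebra dual to `A ⊗ A`, and multiplication of `H` becomes
  -- restriction along comultiplication. Thus `T` is an element of `H ⊗ H` satisfying the criterion
  -- for `H` to be unramified over `k`.
  let Ψ : H ⊗[k] H ≃ₗ[k] Module.Dual k (A ⊗[k] A) :=
    TensorProduct.congr e' e' ≪≫ₗ TensorProduct.dualDistribEquiv k A A
  have hΨ (f g : H) : toConv (Ψ (f ⊗ₜ g)) = convTensor (e f) (e g) :=
    conv_ext_tmul fun a b => by rw [convTensor_apply]; rfl
  have hΨm (x y : H ⊗[k] H) : toConv (Ψ (x * y)) = toConv (Ψ x) * toConv (Ψ y) := by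
    induction x with
    | zero => simp
    | add x x' hx hx' => rw [add_mul, map_add, toConv_add, hx, hx', map_add, toConv_add, add_mul]
    | tmul f g =>
      induction y with
      | zero => simp
      | add x x' hx hx' => rw [mul_add, map_add, toConv_add, hx, hx', map_add, toConv_add, mul_add]
      | tmul f' g' =>
        rw [Algebra.TensorProduct.tmul_mul_tmul, hΨ, hΨ, hΨ, convTensor_mul, hem, hem]
  have hmul (x : H ⊗[k] H) (a : A) :
      (e (Algebra.TensorProduct.lmul' k x)).ofConv a = Ψ x (Coalgebra.comul a) := by
    induction x with
    | zero => simp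
    | add x y hx hy =>
      rw [map_add, map_add, ofConv_add, LinearMap.add_apply, hx, hy, map_add, LinearMap.add_apply]
    | tmul f g =>
      rw [Algebra.TensorProduct.lmul'_apply_tmul, hem]
      change LinearMap.mul' k k (TensorProduct.map (e f).ofConv (e g).ofConv (Coalgebra.comul a)) =
        (toConv (Ψ (f ⊗ₜ[k] g))).ofConv _
      rw [hΨ]
      rfl
  have hun : Algebra.FormallyUnramified k H := by
    refine Algebra.FormallyUnramified.iff_exists_tensorProduct.2
      ⟨Ψ.symm T.ofConv, fun s => ?_, ?_⟩
    · refine Ψ.injective (toConv_injective ?_)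
      rw [hΨm, map_sub, toConv_sub, hΨ, hΨ, LinearEquiv.apply_symm_apply, he1, sub_mul,
        toConv_ofConv, hT, sub_self, map_zero, toConv_zero]
    · refine e.injective (WithConv.ext (LinearMap.ext fun a => ?_))
      rw [hmul, LinearEquiv.apply_symm_apply, hT1, he1]
      simp
  exact Algebra.FormallyUnramified.isReduced_of_field k _

/-- The convolution algebra of a finite cocommutative Hopf algebra with an integral is reduced. -/
theorem IsNormalizedIntegral.isReduced [Coalgebra.IsCocomm k A] [FiniteDimensional k A]
    {I : A →ₗ[k] k} (hI : IsNormalizedIntegral I) : IsReduced (WithConv (A →ₗ[k] k)) := by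
  refine isReduced_of_separability (AddEquiv.refl _) (fun _ _ => rfl) (fun _ _ => rfl) rfl
    (toConv (I ∘ₗ (mulAntipode k A).toLinearMap)) hI.balanced fun a => ?_
  have h1 : (mulAntipode k A) (Coalgebra.comul a) = algebraMap k A (Coalgebra.counit a) := by
    rw [← HopfAlgebra.mul_antipode_lTensor_comul_apply (R := k) a]
    generalize (Coalgebra.comul a : A ⊗[k] A) = z
    induction z with
    | zero => simp
    | add x y hx hy => simp only [map_add, hx, hy]
    | tmul x y => simp
  change I ((mulAntipode k A) (Coalgebra.comul a)) = _
  rw [h1, Algebra.algebraMap_eq_smul_one, map_smul, hI.map_one, smul_eq_mul, mul_one]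

/-- In a reduced ring a nonzero `f` avoids some prime; the residue field there is finite over the
algebraically closed `k`, so it is `k`. -/
lemma exists_algHom_ne_zero {k H : Type*} [Field k] [IsAlgClosed k] [CommRing H] [Algebra k H]
    [FiniteDimensional k H] [IsReduced H] {f : H} (hf : f ≠ 0) : ∃ χ : H →ₐ[k] k, χ f ≠ 0 := by
  have : IsArtinianRing H := IsArtinianRing.of_finite k H
  obtain ⟨P, hP, hfP⟩ : ∃ P : Ideal H, P.IsPrime ∧ f ∉ P := by
    by_contra! h
    refine hf ?_
    have : f ∈ nilradical H := by
      rw [nilradical_eq_sInf, Ideal.mem_sInf]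
      exact fun {P} hP => h P hP
    exact (mem_nilradical.1 this).eq_zero
  have hM : P.IsMaximal := inferInstance
  let := Ideal.Quotient.field P
  have hb : Function.Bijective (algebraMap k (H ⧸ P)) :=
    IsAlgClosed.algebraMap_bijective_of_isIntegral
  let e : k ≃ₐ[k] H ⧸ P := AlgEquiv.ofBijective (Algebra.ofId k _) hb
  refine ⟨e.symm.toAlgHom.comp (Ideal.Quotient.mkₐ k P), fun h => hfP ?_⟩
  have h2 : e.symm (Ideal.Quotient.mk P f) = 0 := h
  rw [map_eq_zero_iff _ e.symm.injective] at h2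
  exact Ideal.Quotient.eq_zero_iff_mem.1 h2

/-- A finite cocommutative Hopf algebra with a normalized integral over an algebraically closed
field is spanned by its group-like elements. -/
theorem IsNormalizedIntegral.span_groupLike [IsAlgClosed k] [Coalgebra.IsCocomm k A]
    [FiniteDimensional k A] {I : A →ₗ[k] k} (hI : IsNormalizedIntegral I) :
    Submodule.span k {a : A | IsGroupLikeElem k a} = ⊤ := by
  have := hI.isReduced
  have : FiniteDimensional k (WithConv (A →ₗ[k] k)) :=
    Module.Finite.equiv (WithConv.linearEquiv k (A →ₗ[k] k)).symm
  by_contra h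
  obtain ⟨f, hf0, hf⟩ := Submodule.exists_le_ker_of_lt_top _ (lt_top_iff_ne_top.2 h)
  have hf1 : toConv f ≠ 0 := fun h => hf0 (toConv_injective h)
  -- The form `f` kills all group-like elements, yet some character `χ` of the reduced convolution
  -- algebra has `χ(f) ≠ 0`. By biduality `χ` is evaluation at some `a : A`, and multiplicativity of
  -- `χ` makes `a` group-like, so `χ(f) = f(a) = 0`.
  obtain ⟨χ, hχ⟩ := exists_algHom_ne_zero (k := k) hf1
  obtain ⟨a, ha⟩ := (Module.evalEquiv k A).surjective
    (χ.toLinearMap ∘ₗ (WithConv.linearEquiv k (A →ₗ[k] k)).symm.toLinearMap)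
  have hev (g : A →ₗ[k] k) : g a = χ (toConv g) := LinearMap.congr_fun ha g
  have hgl : IsGroupLikeElem k a := by
    refine ⟨?_, ?_⟩
    · rw [hev, ← _root_.map_one χ]
      congr 1
    · have key : ∀ φ : Module.Dual k (A ⊗[k] A), φ (Coalgebra.comul a) = φ (a ⊗ₜ a) := by
        intro φ
        obtain ⟨z, rfl⟩ := (TensorProduct.dualDistribEquiv k A A).surjective φ
        induction z with
        | zero => simp
        | add x y hx hy => rw [map_add, LinearMap.add_apply, LinearMap.add_apply, hx, hy]
        | tmul f g =>
          have h1 := map_mul χ (toConv f) (toConv g)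
          rw [← hev f, ← hev g] at h1
          have h2 := hev (toConv f * toConv g).ofConv
          rw [toConv_ofConv, h1] at h2
          refine Eq.trans ?_ (h2.trans ?_)
          · change _ = LinearMap.mul' k k (TensorProduct.map f g (Coalgebra.comul a))
            generalize (Coalgebra.comul a : A ⊗[k] A) = z
            induction z with
            | zero => simp
            | add x y hx hy => simp only [map_add, hx, hy]
            | tmul x y => simp
          · simp
      exact (Module.forall_dual_apply_eq_zero_iff k _).1 (fun φ => by
        rw [map_sub, key, sub_self]) |> sub_eq_zero.1
  have : f a = 0 := hf (Submodule.subset_span hgl)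
  exact hχ (by rw [← hev, this])

end GroupLike

/-! ### The connected component of the identity -/

section Component

open WithConv

section Points

variable {k : Type*} [Field k] [IsAlgClosed k] {H : Type*} [CommRing H] [Algebra k H]
  [FiniteDimensional k H]

lemma isNilpotent_of_forall_algHom {x : H} (h : ∀ χ : H →ₐ[k] k, χ x = 0) : IsNilpotent x := by
  by_contra hx
  have hr : IsReduced (H ⧸ nilradical H) :=
    (Ideal.isRadical_iff_quotient_reduced _).1 (Ideal.radical_isRadical ⊥)
  have hx' : Ideal.Quotient.mk (nilradical H) x ≠ 0 := fun h0 =>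
    hx (mem_nilradical.1 (Ideal.Quotient.eq_zero_iff_mem.1 h0))
  obtain ⟨χ, hχ⟩ := exists_algHom_ne_zero (k := k) hx'
  exact hχ (h (χ.comp (Ideal.Quotient.mkₐ k (nilradical H))))

/-- Idempotents that differ by a nilpotent are equal, so identities between idempotents can be
checked on rational points. The identities for `f` below are proved this way. -/
lemma isIdempotentElem_ext (k : Type*) [Field k] [IsAlgClosed k] [Algebra k H]
    [FiniteDimensional k H] {x y : H} (hx : IsIdempotentElem x) (hy : IsIdempotentElem y)
    (h : ∀ χ : H →ₐ[k] k, χ x = χ y) : x = y :=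
  eq_of_isNilpotent_sub_of_isIdempotentElem hx hy
    (isNilpotent_of_forall_algHom (k := k) fun χ => by rw [map_sub, h, sub_self])

end Points

variable {k : Type*} [Field k] {A : Type*} [CommRing A] [HopfAlgebra k A]

/-- `f` is the idempotent defining the connected component of the identity of a finite group scheme:
it vanishes exactly on that component. -/
structure IsComponentIdempotent (k : Type*) [Field k] {A : Type*} [CommRing A] [HopfAlgebra k A]
    (f : A) : Prop where
  idem : IsIdempotentElem f
  counit_eq_zero : Coalgebra.counit (R := k) f = 0
  eq_one (g : A →ₐ[k] k) (h : g ≠ Bialgebra.counitAlgHom k A) : g f = 1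
  pow_mem {a : A} (h : Coalgebra.counit (R := k) a = 0) : ∃ n, a ^ n ∈ Ideal.span {f}

-- The powers of the augmentation ideal stabilize. The stable power is an idempotent, finitely
-- generated ideal, so it is generated by an idempotent `f`. A rational point killing `f` kills a
-- power of the augmentation ideal, hence is the identity. The exponent `n + 1`, being positive,
-- keeps `f` in the augmentation ideal.
variable (k A) in
theorem exists_isComponentIdempotent [FiniteDimensional k A] :
    ∃ f : A, IsComponentIdempotent k f := by
  have : IsArtinianRing A := IsArtinianRing.of_finite k A
  have : IsNoetherianRing A := inferInstance
  obtain ⟨n, hn⟩ := IsArtinian.monotone_stabilizes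
    (⟨fun n => OrderDual.toDual (augIdeal k A ^ n), fun m n h => Ideal.pow_le_pow_right h⟩ :
      ℕ →o (Submodule A A)ᵒᵈ)
  replace hn (m : ℕ) (h : n ≤ m) : augIdeal k A ^ n = augIdeal k A ^ m := hn m h
  have hidem : IsIdempotentElem (augIdeal k A ^ (n + 1)) := by
    rw [IsIdempotentElem, ← pow_add, ← hn (n + 1 + (n + 1)) (by omega), ← hn (n + 1) (by omega)]
  obtain ⟨f, hf, hJ⟩ := (Ideal.isIdempotentElem_iff_of_fg _ (IsNoetherian.noetherian _)).1 hidem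
  have hfm : f ∈ augIdeal k A ^ (n + 1) := by
    rw [hJ]; exact Submodule.mem_span_singleton_self f
  refine ⟨f, hf, Ideal.pow_le_self n.succ_ne_zero hfm, fun g hg => ?_, fun {a} ha => ?_⟩
  · have h1 : IsIdempotentElem (g f) := hf.map g
    rcases IsIdempotentElem.iff_eq_zero_or_one.1 h1 with h0 | h1
    · exfalso
      refine hg (AlgHom.ext fun a => ?_)
      have h2 : (a - algebraMap k A (Coalgebra.counit a)) ^ (n + 1) ∈ Submodule.span A {f} := by
        rw [← hJ]
        exact Ideal.pow_mem_pow (mem_augIdeal.2 (by simp)) _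
      obtain ⟨c, hc⟩ := Submodule.mem_span_singleton.1 h2
      have h3 := congrArg g hc
      rw [smul_eq_mul, map_mul, h0, mul_zero, map_pow, eq_comm] at h3
      have h4 := pow_eq_zero_iff (n.succ_ne_zero) |>.1 h3
      rw [map_sub, AlgHom.commutes, sub_eq_zero] at h4
      exact h4
    · exact h1
  · refine ⟨n + 1, ?_⟩
    have := Ideal.pow_mem_pow (mem_augIdeal.2 ha) (n + 1)
    rwa [hJ] at this

namespace IsComponentIdempotent

variable {f : A}

lemma eq_counit_of_eq_zero (hf : IsComponentIdempotent k f) {g : A →ₐ[k] k} (h : g f = 0) :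
    g = Bialgebra.counitAlgHom k A := by
  by_contra h0
  exact zero_ne_one (h.symm.trans (hf.eq_one g h0))

lemma mk_self (f : A) : Ideal.Quotient.mkₐ k (Ideal.span {f}) f = 0 :=
  Ideal.Quotient.eq_zero_iff_mem.2 (Ideal.mem_span_singleton_self f)

lemma comp_mk_eq_counit (hf : IsComponentIdempotent k f) (χ : (A ⧸ Ideal.span {f}) →ₐ[k] k) :
    χ.comp (Ideal.Quotient.mkₐ k _) = Bialgebra.counitAlgHom k A :=
  hf.eq_counit_of_eq_zero (by rw [AlgHom.comp_apply, mk_self, map_zero])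

lemma counit_comul (a : A) : Bialgebra.counitAlgHom k (A ⊗[k] A) (Coalgebra.comul (R := k) a) =
    Coalgebra.counit (R := k) a := by
  have h : (Bialgebra.counitAlgHom k (A ⊗[k] A)) = (Bialgebra.counitAlgHom k A).comp
      ((Algebra.TensorProduct.lid k A).toAlgHom.comp
        (Algebra.TensorProduct.map (Bialgebra.counitAlgHom k A) (AlgHom.id k A))) := by
    refine Algebra.TensorProduct.ext ?_ ?_ <;> ext a <;> simp
  rw [h]
  have h2 : TensorProduct.lid k A (Coalgebra.counit.rTensor A (Coalgebra.comul (R := k) a)) = a := by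
    simp
  exact congrArg Coalgebra.counit h2

variable [IsAlgClosed k] [FiniteDimensional k A]

/-- On points: `χ⁻¹` is the identity only if `χ` is. -/
lemma antipode_eq (hf : IsComponentIdempotent k f) : HopfAlgebra.antipode k f = f := by
  refine isIdempotentElem_ext k (hf.idem.map (HopfAlgebra.antipodeAlgHom k A)) hf.idem fun χ => ?_
  by_cases h : χ = Bialgebra.counitAlgHom k A
  · rw [h]; simp
  · rw [hf.eq_one χ h]
    refine hf.eq_one (χ.comp (HopfAlgebra.antipodeAlgHom k A)) fun h1 => h ?_
    have h2 : (toConv χ)⁻¹ = 1 := WithConv.ext h1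
    exact toConv_injective (inv_eq_one.1 h2)

lemma map_mk_comul (hf : IsComponentIdempotent k f) :
    Algebra.TensorProduct.map (Ideal.Quotient.mkₐ k (Ideal.span {f}))
      (Ideal.Quotient.mkₐ k (Ideal.span {f})) (Coalgebra.comul (R := k) f) = 0 := by
  refine isIdempotentElem_ext k ((hf.idem.map (Bialgebra.comulAlgHom k A)).map _) (.zero)
    fun χ => ?_
  have h1 : χ.comp (Algebra.TensorProduct.map (Ideal.Quotient.mkₐ k (Ideal.span {f}))
      (Ideal.Quotient.mkₐ k (Ideal.span {f}))) = Bialgebra.counitAlgHom k (A ⊗[k] A) := by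
    refine Algebra.TensorProduct.ext ?_ ?_
    · have := hf.comp_mk_eq_counit (χ.comp Algebra.TensorProduct.includeLeft)
      ext a
      simpa using DFunLike.congr_fun this a
    · have := hf.comp_mk_eq_counit (χ.comp Algebra.TensorProduct.includeRight)
      ext a
      simpa using DFunLike.congr_fun this a
  have h2 := DFunLike.congr_fun h1 (Coalgebra.comul (R := k) f)
  rw [map_zero]
  refine h2.trans ((counit_comul f).trans hf.counit_eq_zero)

/-- Invariance of `f` under translation by the identity component: the only rational point of that
component is the identity, so both idempotents agree on rational points. -/
lemma map_mk_id_comul (hf : IsComponentIdempotent k f) :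
    Algebra.TensorProduct.map (Ideal.Quotient.mkₐ k (Ideal.span {f})) (AlgHom.id k A)
      (Coalgebra.comul (R := k) f) = 1 ⊗ₜ f := by
  refine isIdempotentElem_ext k ((hf.idem.map (Bialgebra.comulAlgHom k A)).map _)
    (hf.idem.map (Algebra.TensorProduct.includeRight : A →ₐ[k] (A ⧸ Ideal.span {f}) ⊗[k] A))
    fun χ => ?_
  set χ' := χ.comp Algebra.TensorProduct.includeRight
  have h1 : χ.comp (Algebra.TensorProduct.map (Ideal.Quotient.mkₐ k (Ideal.span {f}))
      (AlgHom.id k A)) = χ'.comp ((Algebra.TensorProduct.lid k A).toAlgHom.comp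
        (Algebra.TensorProduct.map (Bialgebra.counitAlgHom k A) (AlgHom.id k A))) := by
    refine Algebra.TensorProduct.ext ?_ ?_
    · have := hf.comp_mk_eq_counit (χ.comp Algebra.TensorProduct.includeLeft)
      ext a
      simpa using DFunLike.congr_fun this a
    · ext a
      simp [χ']
  refine (DFunLike.congr_fun h1 (Coalgebra.comul (R := k) f)).trans ?_
  have h2 : TensorProduct.lid k A (Coalgebra.counit.rTensor A (Coalgebra.comul (R := k) f)) = f := by
    simp
  exact congrArg χ' h2

lemma isHopfIdeal (hf : IsComponentIdempotent k f) : (Ideal.span {f}).IsHopfIdeal k where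
  counit_eq_zero x hx := by
    obtain ⟨c, rfl⟩ := Ideal.mem_span_singleton'.1 hx
    rw [Bialgebra.counit_mul, hf.counit_eq_zero, mul_zero]
  map_mkQ_comul_eq_zero x hx := by
    obtain ⟨c, rfl⟩ := Ideal.mem_span_singleton'.1 hx
    change Algebra.TensorProduct.map (Ideal.Quotient.mkₐ k (Ideal.span {f}))
      (Ideal.Quotient.mkₐ k (Ideal.span {f})) (Coalgebra.comul (R := k) (c * f)) = 0
    rw [Bialgebra.comul_mul, map_mul, hf.map_mk_comul, mul_zero]
  antipode_mem x hx := by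
    obtain ⟨c, rfl⟩ := Ideal.mem_span_singleton'.1 hx
    rw [HopfAlgebra.antipode_mul_distrib, hf.antipode_eq]
    exact Ideal.mul_mem_left _ _ (Ideal.mem_span_singleton_self f)

end IsComponentIdempotent

end Component

/-! ### Tameness, and the diagonalizability of the component of the identity -/

section Tame

open WithConv

variable {k : Type*} [Field k] {A : Type*} [CommRing A] [HopfAlgebra k A]

/-- Translation by a `k`-point. -/
def pointTranslate (g : A →ₐ[k] k) : A →ₐ[k] A :=
  (Algebra.TensorProduct.lid k A).toAlgHom.comp
    ((Algebra.TensorProduct.map g (AlgHom.id k A)).comp (Bialgebra.comulAlgHom k A))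

lemma algHom_pointTranslate (g χ : A →ₐ[k] k) (a : A) :
    χ (pointTranslate g a) = (toConv g * toConv χ).ofConv a := by
  change χ (TensorProduct.lid k A (TensorProduct.map g.toLinearMap LinearMap.id
    (Coalgebra.comul a))) = LinearMap.mul' k k (TensorProduct.map g.toLinearMap χ.toLinearMap
      (Coalgebra.comul a))
  generalize (Coalgebra.comul a : A ⊗[k] A) = z
  induction z with
  | zero => simp
  | add x y hx hy => simp only [map_add, hx, hy]
  | tmul x y => simp

/-- Apply `g` to the identity `a₁ I(a₂) = I(a) 1`. -/
lemma IsNormalizedIntegral.apply_pointTranslate {I : A →ₗ[k] k} (hI : IsNormalizedIntegral I)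
    (g : A →ₐ[k] k) (a : A) : I (pointTranslate g a) = I a := by
  have h := congrArg g (hI.rid_lTensor_comul a)
  rw [AlgHom.commutes] at h
  refine Eq.trans ?_ h
  change I (TensorProduct.lid k A (TensorProduct.map g.toLinearMap LinearMap.id
    (Coalgebra.comul a))) = _
  generalize (Coalgebra.comul a : A ⊗[k] A) = z
  induction z with
  | zero => simp
  | add x y hx hy => simp only [map_add, hx, hy]
  | tmul x y => simp [mul_comm]

variable [FiniteDimensional k A]

instance : Finite (WithConv (A →ₐ[k] k)) := Finite.of_equiv _ (WithConv.equiv (A →ₐ[k] k)).symm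

namespace IsComponentIdempotent

variable {f : A} [IsAlgClosed k]

/-- The component group of a finite group scheme with a normalized integral is tame. -/
theorem card_mul_apply (hf : IsComponentIdempotent k f) {I : A →ₗ[k] k}
    (hI : IsNormalizedIntegral I) : (Nat.card (WithConv (A →ₐ[k] k)) : k) * I (1 - f) = 1 := by
  classical
  have := Fintype.ofFinite (WithConv (A →ₐ[k] k))
  -- The translates `E g` are the indicator functions of the components: `E g` is `1` at `χ = g⁻¹`
  -- and `0` at the other rational points. They are orthogonal idempotents with sum `1`, and all
  -- have the same integral.
  let E (g : WithConv (A →ₐ[k] k)) : A := pointTranslate g.ofConv (1 - f)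
  have hE (g : WithConv (A →ₐ[k] k)) (χ : A →ₐ[k] k) :
      χ (E g) = if g = (toConv χ)⁻¹ then 1 else 0 := by
    rw [algHom_pointTranslate, toConv_ofConv, map_sub, _root_.map_one]
    split_ifs with h
    · rw [h, inv_mul_cancel]
      change 1 - Coalgebra.counit (R := k) f = 1
      rw [hf.counit_eq_zero, sub_zero]
    · rw [hf.eq_one, sub_self]
      intro h1
      have h2 : g * toConv χ = 1 := WithConv.ext h1
      exact h (eq_inv_of_mul_eq_one_left h2)
  have hidem (g) : IsIdempotentElem (E g) := hf.idem.one_sub.map _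
  have hort : OrthogonalIdempotents E := by
    refine ⟨hidem, fun g g' hgg' => ?_⟩
    refine isIdempotentElem_ext k ((hidem g).mul (hidem g')) .zero fun χ => ?_
    rw [map_mul, hE, hE, map_zero]
    split_ifs with h1 h2 <;> simp_all
  have hsum : ∑ g, E g = 1 := by
    refine isIdempotentElem_ext k hort.isIdempotentElem_sum .one fun χ => ?_
    rw [map_sum, _root_.map_one]
    simp [hE]
  have h := congrArg I hsum
  rw [map_sum, hI.map_one] at h
  simp only [E, hI.apply_pointTranslate] at h
  rw [Finset.sum_const, Finset.card_univ, nsmul_eq_mul] at h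
  rwa [Nat.card_eq_fintype_card]

/-- The normalized integral on the connected component. -/
theorem exists_isNormalizedIntegral_quotient (hf : IsComponentIdempotent k f)
    [(Ideal.span {f}).IsHopfIdeal k] {I : A →ₗ[k] k} (hI : IsNormalizedIntegral I) :
    ∃ J : A ⧸ Ideal.span {f} →ₗ[k] k, IsNormalizedIntegral J := by
  set c : k := (Nat.card (WithConv (A →ₐ[k] k)) : k)
  have hc : c * I (1 - f) = 1 := hf.card_mul_apply hI
  -- The integral over the identity component, rescaled by the number `c` of components so that `1`
  -- has integral `1`.
  let L : A →ₗ[k] k := c • (I ∘ₗ LinearMap.mulLeft k (1 - f))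
  have hL : (Ideal.span {f}).restrictScalars k ≤ LinearMap.ker L := by
    intro x hx
    obtain ⟨b, rfl⟩ := Ideal.mem_span_singleton'.1 hx
    have : (1 - f) * (b * f) = 0 := by
      have := hf.idem.eq
      linear_combination (-b) * this
    simp [L, this]
  let J : A ⧸ Ideal.span {f} →ₗ[k] k := ((Ideal.span {f}).restrictScalars k).liftQ L hL
  have hJ (a : A) : J (Ideal.Quotient.mk _ a) = c * I ((1 - f) * a) := rfl
  refine ⟨J, ?_, fun x => ?_⟩
  · have := hJ 1
    rwa [mul_one, hc] at this
  · obtain ⟨a, rfl⟩ := Ideal.Quotient.mk_surjective x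
    rw [Bialgebra.Quotient.comul_mk, hJ]
    have h1 (z : A ⊗[k] A) : TensorProduct.rid k _ (J.lTensor _ (TensorProduct.map
        (Ideal.Quotient.mkₐ k (Ideal.span {f})).toLinearMap
        (Ideal.Quotient.mkₐ k (Ideal.span {f})).toLinearMap z)) =
        c • TensorProduct.rid k _ (I.lTensor _ ((1 ⊗ₜ (1 - f)) *
          Algebra.TensorProduct.map (Ideal.Quotient.mkₐ k (Ideal.span {f})) (AlgHom.id k A) z)) := by
      induction z with
      | zero => simp
      | add x y hx hy => simp only [map_add, hx, hy, mul_add, smul_add]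
      | tmul x y => simp [hJ, smul_smul]
    -- By translation invariance of `f`, the factor `1 ⊗ (1 - f)` is the image of `Δ(1 - f)`. It is
    -- therefore absorbed into `Δ((1 - f) a)`, to which the invariance of `I` applies.
    have h2 : (1 : A ⧸ Ideal.span {f}) ⊗ₜ[k] (1 - f) =
        Algebra.TensorProduct.map (Ideal.Quotient.mkₐ k (Ideal.span {f})) (AlgHom.id k A)
          (Coalgebra.comul (R := k) (1 - f)) := by
      rw [map_sub, map_sub, hf.map_mk_id_comul, Bialgebra.comul_one, _root_.map_one,
        TensorProduct.tmul_sub]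
      rfl
    have h3 (z : A ⊗[k] A) : TensorProduct.rid k _ (I.lTensor _
        (Algebra.TensorProduct.map (Ideal.Quotient.mkₐ k (Ideal.span {f})) (AlgHom.id k A) z)) =
        Ideal.Quotient.mkₐ k (Ideal.span {f}) (TensorProduct.rid k A (I.lTensor A z)) := by
      induction z with
      | zero => simp
      | add x y hx hy => simp only [map_add, hx, hy]
      | tmul x y =>
        simp only [Algebra.TensorProduct.map_tmul, LinearMap.lTensor_tmul, TensorProduct.rid_tmul,
          map_smul]
        rfl
    rw [h1, h2, ← map_mul, ← Bialgebra.comul_mul, h3, hI.rid_lTensor_comul, AlgHom.commutes,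
      Algebra.smul_def, ← map_mul]

end IsComponentIdempotent

instance finite_groupLike : Finite (GroupLike k A) :=
  (linearIndep_groupLikeVal (R := k) (A := A)).finite

end Tame

/-- The connected component of the identity of a finite group scheme with a normalized integral
over an algebraically closed field is diagonalizable. -/
theorem IsComponentIdempotent.exists_bialgHom {k A : Type u} [Field k] [IsAlgClosed k] [CommRing A]
    [HopfAlgebra k A] [FiniteDimensional k A] {f : A} (hf : IsComponentIdempotent k f)
    {I : A →ₗ[k] k} (hI : IsNormalizedIntegral I) :
    ∃ (M : Type u) (_ : CommGroup M) (_ : Finite M) (q : A →ₐc[k] MonoidAlgebra k M),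
      Function.Surjective q ∧ ∀ a, q a = 0 ↔ a ∈ Ideal.span {f} := by
  have := hf.isHopfIdeal
  obtain ⟨J, hJ⟩ := hf.exists_isNormalizedIntegral_quotient hI
  have hloc : ∀ a : A ⧸ Ideal.span {f}, Coalgebra.counit (R := k) a = 0 → IsNilpotent a := by
    intro a ha
    obtain ⟨a, rfl⟩ := Ideal.Quotient.mk_surjective a
    obtain ⟨n, hn⟩ := hf.pow_mem ha
    exact ⟨n, by rw [← map_pow]; exact Ideal.Quotient.eq_zero_iff_mem.2 hn⟩
  have := hJ.isCocomm hloc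
  have hspan := hJ.span_groupLike
  -- Distinct group-like elements are linearly independent, and here they also span, so the quotient
  -- is their group algebra.
  have hbij : Function.Bijective
      (MonoidAlgebra.liftGroupLikeBialgHom (R := k) (A := A ⧸ Ideal.span {f})) := by
    have happ (x : MonoidAlgebra k (GroupLike k (A ⧸ Ideal.span {f}))) :
        MonoidAlgebra.liftGroupLikeBialgHom (R := k) (A := A ⧸ Ideal.span {f}) x =
          Finsupp.linearCombination k GroupLike.val x.coeff := MonoidAlgebra.lift_apply _ _
    refine ⟨fun x y h => ?_, fun a => ?_⟩
    · rw [happ, happ] at h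
      exact MonoidAlgebra.coeff_injective (linearIndep_groupLikeVal h)
    · have ha : a ∈ Submodule.span k (Set.range (GroupLike.val (R := k)
          (A := A ⧸ Ideal.span {f}))) := by
        have h1 : Set.range (GroupLike.val (R := k) (A := A ⧸ Ideal.span {f})) =
            {a | IsGroupLikeElem k a} :=
          Set.ext fun a => ⟨by rintro ⟨b, rfl⟩; exact b.2, fun h => ⟨⟨a, h⟩, rfl⟩⟩
        rw [h1, hspan]
        trivial
      obtain ⟨x, rfl⟩ := (Finsupp.mem_span_range_iff_exists_finsupp).1 ha
      exact ⟨.ofCoeff x, happ _⟩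
  let e := BialgEquiv.ofBijective _ hbij
  refine ⟨GroupLike k (A ⧸ Ideal.span {f}), inferInstance, inferInstance,
    (e.symm : _ →ₐc[k] _).comp (Bialgebra.Quotient.mkBialgHom (Ideal.span {f})), ?_, fun a => ?_⟩
  · exact e.symm.surjective.comp Ideal.Quotient.mk_surjective
  · change e.symm (Ideal.Quotient.mk _ a) = 0 ↔ _
    exact (map_eq_zero_iff e.symm (EquivLike.injective e.symm)).trans
      Ideal.Quotient.eq_zero_iff_mem

/-! ### Recognition of semidirect products -/

section Recognition

section Groups

variable {D P : Type*} [Group D] [Group P]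

/-- Conjugation on a group embedded as a normal subgroup. -/
def conjHom (d : D →* P) (hd : Function.Injective d) (hn : d.range.Normal) : P →* MulAut D :=
  (MulAut.congr (MonoidHom.ofInjective hd).symm).toMonoidHom.comp
    (@MulAut.conjNormal P _ d.range hn)

lemma apply_conjHom (d : D →* P) (hd : Function.Injective d) (hn : d.range.Normal) (g : P)
    (x : D) : d (conjHom d hd hn g x) = g * d x * g⁻¹ := by
  have h := MonoidHom.apply_ofInjective_symm hd
    (@MulAut.conjNormal P _ d.range hn g (MonoidHom.ofInjective hd x))
  exact h

/-- A group with a normal subgroup `D` and a complement `C` is a semidirect product. -/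
def semidirectEquiv {C : Type*} [Group C] (φ : C →* MulAut D) (d : D →* P) (s : C →* P)
    (hφ : ∀ h x, d (φ h x) = s h * d x * (s h)⁻¹) (hd : Function.Injective d)
    (hsd : ∀ h, s h ∈ d.range → h = 1) (hP : ∀ g, ∃ h, g * (s h)⁻¹ ∈ d.range) :
    D ⋊[φ] C ≃* P :=
  MulEquiv.ofBijective (SemidirectProduct.lift d s fun h => MonoidHom.ext fun x => hφ h x) (by
    refine ⟨(injective_iff_map_eq_one _).2 fun a ha => ?_, fun g => ?_⟩
    · rw [← SemidirectProduct.inl_left_mul_inr_right a, map_mul, SemidirectProduct.lift_inl,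
        SemidirectProduct.lift_inr] at ha
      have h1 : a.right = 1 := hsd a.right (by
        rw [eq_inv_of_mul_eq_one_right ha]
        exact inv_mem ⟨_, rfl⟩)
      rw [h1, map_one, mul_one] at ha
      have h2 : a.left = 1 := (injective_iff_map_eq_one _).1 hd _ ha
      exact SemidirectProduct.ext h2 h1
    · obtain ⟨h, x, hx⟩ := hP g
      refine ⟨⟨x, h⟩, ?_⟩
      rw [SemidirectProduct.mk_eq_inl_mul_inr, map_mul, SemidirectProduct.lift_inl,
        SemidirectProduct.lift_inr, hx, inv_mul_cancel_right])

end Groups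

variable {S : Scheme.{u}} {X H Δ : Over S} [GrpObj X] [GrpObj H] [GrpObj Δ]

/-- On each `T`, `Δ(T)` is a normal subgroup of `P(T)` with complement `H(T)`. The action is
conjugation, natural in `T` because `d` and `s` are. -/
theorem isWellSplit_of_exact (hH : IsTameConstant H) (hΔ : IsDiagonalizable Δ)
    {P : (Over S)ᵒᵖ ⥤ GrpCat.{u}} (e : yonedaGrpObj X ≅ P)
    (d : yonedaGrpObj Δ ⟶ P) (s : yonedaGrpObj H ⟶ P)
    (hd : ∀ T, Function.Injective (d.app T).hom)
    (hn : ∀ T, ((d.app T).hom.range).Normal)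
    (hsd : ∀ T h, (s.app T).hom h ∈ (d.app T).hom.range → h = 1)
    (hP : ∀ T g, ∃ h, g * ((s.app T).hom h)⁻¹ ∈ (d.app T).hom.range) : IsWellSplit X := by
  let φ : GroupAction H Δ :=
    { act := fun T => (conjHom (d.app (op T)).hom (hd _) (hn _)).comp (s.app (op T)).hom
      naturality := fun {T T'} t h x => by
        refine hd (op T') ?_
        have h1 (y : T ⟶ Δ) : (d.app (op T')).hom (t ≫ y) =
            (P.map t.op).hom ((d.app (op T)).hom y) := congr($(d.naturality t.op) y)
        have h2 : (s.app (op T')).hom (t ≫ h) =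
            (P.map t.op).hom ((s.app (op T)).hom h) := congr($(s.naturality t.op) h)
        refine (h1 _).trans ?_
        refine (congrArg (P.map t.op).hom (apply_conjHom (d.app (op T)).hom (hd _) (hn _)
          ((s.app (op T)).hom h) x)).trans ?_
        refine Eq.trans ?_ (apply_conjHom (d.app (op T')).hom (hd _) (hn _)
          ((s.app (op T')).hom (t ≫ h)) (t ≫ x)).symm
        rw [map_mul, map_mul, map_inv, h1, h2] }
  refine ⟨H, Δ, inferInstance, inferInstance, φ, hH, hΔ, ⟨e ≪≫ (NatIso.ofComponents
    (fun T => (semidirectEquiv (φ.act T.unop) (d.app T).hom (s.app T).hom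
      (fun h x => apply_conjHom (d.app T).hom (hd _) (hn _) ((s.app T).hom h) x)
      (hd T) (hsd T) (hP T)).toGrpIso) fun {T T'} t => ?_).symm⟩⟩
  refine GrpCat.hom_ext (MonoidHom.ext fun a => ?_)
  have h1 := congr($(d.naturality t) a.left)
  have h2 := congr($(s.naturality t) a.right)
  change (d.app T').hom _ * (s.app T').hom _ =
    (P.map t).hom ((d.app T).hom a.left * (s.app T).hom a.right)
  rw [map_mul]
  exact congrArg₂ (· * ·) h1 h2

end Recognition

/-! ### Points of affine group schemes over a ring -/

section AffinePoints

open WithConv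

lemma toSpecΓ_map_appTop {T : Scheme.{u}} {R : CommRingCat.{u}} (f : T ⟶ Spec R) :
    T.toSpecΓ ≫ Spec.map ((Scheme.ΓSpecIso R).inv ≫ f.appTop) = f := by
  rw [Spec.map_comp, ← Category.assoc, ← Scheme.toSpecΓ_naturality, Category.assoc,
    ← SpecMap_ΓSpecIso_hom, ← Spec.map_comp, Iso.inv_hom_id, Spec.map_id, Category.comp_id]

lemma appTop_toSpecΓ_map {T : Scheme.{u}} {R : CommRingCat.{u}} (φ : R ⟶ Γ(T, ⊤)) :
    (Scheme.ΓSpecIso R).inv ≫ (T.toSpecΓ ≫ Spec.map φ).appTop = φ := by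
  rw [Scheme.Hom.comp_appTop, ← Scheme.ΓSpecIso_inv_naturality_assoc, Scheme.toSpecΓ_appTop,
    Iso.inv_hom_id, Category.comp_id]

lemma appTop_comp_map {T : Scheme.{u}} {R R' : CommRingCat.{u}} (f : T ⟶ Spec R') (φ : R ⟶ R') :
    (Scheme.ΓSpecIso R).inv ≫ (f ≫ Spec.map φ).appTop =
      φ ≫ (Scheme.ΓSpecIso R').inv ≫ f.appTop := by
  rw [Scheme.Hom.comp_appTop, ← Scheme.ΓSpecIso_inv_naturality_assoc]

lemma comp_toSpecΓ_map {T T' : Scheme.{u}} {R : CommRingCat.{u}} (t : T' ⟶ T)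
    (φ : R ⟶ Γ(T, ⊤)) : t ≫ T.toSpecΓ ≫ Spec.map φ = T'.toSpecΓ ≫ Spec.map (φ ≫ t.appTop) := by
  rw [Spec.map_comp, ← Category.assoc, Scheme.toSpecΓ_naturality, Category.assoc]

variable {k : Type u} [CommRing k]

/-- The global sections of a scheme over `Spec k`. -/
def Sec (T : Over (Spec (.of k))) : Type u := Γ(T.left, ⊤)

instance (T : Over (Spec (.of k))) : CommRing (Sec T) := inferInstanceAs (CommRing Γ(T.left, ⊤))

instance (T : Over (Spec (.of k))) : Algebra k (Sec T) :=
  ((Scheme.ΓSpecIso (.of k)).inv ≫ T.hom.appTop).hom.toAlgebra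

/-- Pullback of global sections. -/
def secMap {T T' : Over (Spec (.of k))} (t : T' ⟶ T) : Sec T →ₐ[k] Sec T' where
  __ := t.left.appTop.hom
  commutes' c := by
    change t.left.appTop.hom (((Scheme.ΓSpecIso (.of k)).inv ≫ T.hom.appTop).hom c) =
      ((Scheme.ΓSpecIso (.of k)).inv ≫ T'.hom.appTop).hom c
    rw [← Over.w t, Scheme.Hom.comp_appTop]
    rfl

/-- The canonical morphism to the spectrum of global sections. -/
def toSpecSec (T : Over (Spec (.of k))) :
    T ⟶ (Spec (.of (Sec T))).asOver (Spec (.of k)) :=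
  Over.homMk T.left.toSpecΓ (by
    change T.left.toSpecΓ ≫ Spec.map (((Scheme.ΓSpecIso (.of k)).inv ≫ T.hom.appTop)) = T.hom
    exact toSpecΓ_map_appTop T.hom)

/-- The morphisms from `T` to the spectrum of `C` are the algebra homomorphisms from `C` to the
global sections of `T`. -/
def specHoms (T : Over (Spec (.of k))) {C : Type u} [CommRing C] [Algebra k C] :
    (C →ₐ[k] Sec T) ≃ (T ⟶ (Spec (.of C)).asOver (Spec (.of k))) where
  toFun g := toSpecSec T ≫ (Spec.map (CommRingCat.ofHom g.toRingHom)).asOver _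
  invFun f :=
    { toRingHom := ((Scheme.ΓSpecIso (.of C)).inv ≫ f.left.appTop).hom
      commutes' := fun c => by
        have h := congrArg (fun t => (Scheme.ΓSpecIso (.of k)).inv ≫ t.appTop) (Over.w f)
        have h2 := (appTop_comp_map f.left (CommRingCat.ofHom (algebraMap k C))).symm.trans h
        exact congr($h2 c) }
  left_inv g := by
    refine AlgHom.ext fun a => ?_
    exact congr($(appTop_toSpecΓ_map (CommRingCat.ofHom g.toRingHom)) a)
  right_inv f := by
    ext1
    exact toSpecΓ_map_appTop f.left

lemma comp_specHoms {T T' : Over (Spec (.of k))} {C : Type u} [CommRing C] [Algebra k C]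
    (t : T' ⟶ T) (g : C →ₐ[k] Sec T) : t ≫ specHoms T g = specHoms T' ((secMap t).comp g) := by
  ext1
  exact comp_toSpecΓ_map t.left (CommRingCat.ofHom g.toRingHom)

variable {A : Type u} [CommRing A] [HopfAlgebra k A]

/-- The points of an affine group scheme. -/
def specPoints (T : Over (Spec (.of k))) :
    WithConv (A →ₐ[k] Sec T) ≃* (T ⟶ (Spec (.of A)).asOver (Spec (.of k))) where
  __ := (WithConv.equiv _).trans (specHoms T)
  map_mul' f g := by
    change toSpecSec T ≫ Spec.mapMulEquiv (f * g) =
      (toSpecSec T ≫ Spec.mapMulEquiv f) * (toSpecSec T ≫ Spec.mapMulEquiv g)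
    rw [map_mul, MonObj.comp_mul]

lemma comp_specPoints {T T' : Over (Spec (.of k))} (t : T' ⟶ T) (g : WithConv (A →ₐ[k] Sec T)) :
    t ≫ specPoints T g = specPoints T' (ptMap (secMap t) g) :=
  comp_specHoms t g.ofConv

end AffinePoints

/-! ### Idempotent sections and locally constant functions -/

section Idempotents

lemma evaluation_map {X : Scheme.{u}} {U W : X.Opens} (h : U ≤ W) (x : X) (hx : x ∈ U)
    (s : Γ(X, W)) :
    X.evaluation U x hx (X.presheaf.map (homOfLE h).op s) = X.evaluation W x (h hx) s := by
  rw [← X.germ_residue, ← X.germ_residue]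
  change X.residue x (X.presheaf.germ U x hx (X.presheaf.map (homOfLE h).op s)) = _
  rw [TopCat.Presheaf.germ_res_apply]
  rfl

/-- Glue the section `1` on `U` with the section `0` on `V`. -/
lemma exists_idempotent_of_sup {X : Scheme.{u}} {U V W : X.Opens} (hW : U ⊔ V = W)
    (hUV : U ⊓ V = ⊥) : ∃ e : Γ(X, W), IsIdempotentElem e ∧
      (∀ x (_ : x ∈ U) (hxW : x ∈ W), X.evaluation W x hxW e = 1) ∧
      (∀ x (_ : x ∈ V) (hxW : x ∈ W), X.evaluation W x hxW e = 0) := by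
  subst hW
  have hsub : Subsingleton (X.presheaf.obj (op (U ⊓ V))) := by
    rw [hUV]
    exact CommRingCat.subsingleton_of_isTerminal X.sheaf.isTerminalOfEmpty
  let φ := X.sheaf.objSupIsoProdEqLocus U V
  let z : RingHom.eqLocus
      (RingHom.comp (X.sheaf.obj.map (homOfLE inf_le_left : U ⊓ V ⟶ U).op).hom
        (RingHom.fst (X.sheaf.obj.obj <| op U) (X.sheaf.obj.obj <| op V)))
      (RingHom.comp (X.sheaf.obj.map (homOfLE inf_le_right : U ⊓ V ⟶ V).op).hom
        (RingHom.snd (X.sheaf.obj.obj <| op U) (X.sheaf.obj.obj <| op V))) :=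
    ⟨(1, 0), Subsingleton.elim (α := X.presheaf.obj (op (U ⊓ V))) _ _⟩
  have hz : IsIdempotentElem z := Subtype.ext (Prod.ext (one_mul _) (mul_zero _))
  refine ⟨φ.inv z, hz.map φ.inv.hom, fun x hx hxW => ?_, fun x hx hxW => ?_⟩
  · have h := TopCat.Sheaf.objSupIsoProdEqLocus_inv_fst X.sheaf U V z
    refine (evaluation_map le_sup_left x hx _).symm.trans ?_
    refine (congrArg (X.evaluation U x hx) h).trans ?_
    exact map_one (X.evaluation U x hx).hom
  · have h := TopCat.Sheaf.objSupIsoProdEqLocus_inv_snd X.sheaf U V z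
    refine (evaluation_map le_sup_right x hx _).symm.trans ?_
    refine (congrArg (X.evaluation V x hx) h).trans ?_
    exact map_zero (X.evaluation V x hx).hom

lemma exists_idempotent_of_isClopen {X : Scheme.{u}} {U : Set X} (hU : IsClopen U) :
    ∃ e : Γ(X, ⊤), IsIdempotentElem e ∧ (∀ x ∈ U, X.Γevaluation x e = 1) ∧
      (∀ x ∉ U, X.Γevaluation x e = 0) := by
  obtain ⟨e, he, h1, h0⟩ := exists_idempotent_of_sup (X := X) (U := ⟨U, hU.isOpen⟩)
    (V := ⟨Uᶜ, hU.compl.isOpen⟩) (W := ⊤) (TopologicalSpace.Opens.ext (Set.union_compl_self U))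
    (TopologicalSpace.Opens.ext (Set.inter_compl_self U))
  exact ⟨e, he, fun x hx => h1 x hx trivial, fun x hx => h0 x hx trivial⟩

/-- The idempotent `c = e (1 - e')` vanishes at every point, so `1 - c` is a unit and `c (1 - c) =
0` gives `c = 0`. By symmetry `e = e e' = e'`. -/
lemma idempotent_ext {X : Scheme.{u}} {e e' : Γ(X, ⊤)} (he : IsIdempotentElem e)
    (he' : IsIdempotentElem e') (h : ∀ x, X.Γevaluation x e = X.Γevaluation x e') : e = e' := by
  have key (a b : Γ(X, ⊤)) (ha : IsIdempotentElem a) (hb : IsIdempotentElem b)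
      (h : ∀ x, X.Γevaluation x a = X.Γevaluation x b) : a * (1 - b) = 0 := by
    set c := a * (1 - b) with hc
    have hci : IsIdempotentElem c := ha.mul hb.one_sub
    have hcx (x : X) : X.Γevaluation x c = 0 := by
      have hb2 : X.Γevaluation x b * (1 - X.Γevaluation x b) = 0 := by
        have : X.Γevaluation x (b * b) = X.Γevaluation x b := congrArg _ hb.eq
        rw [map_mul] at this
        rw [mul_sub, this, mul_one, sub_self]
      rw [hc, map_mul, map_sub, map_one, h, hb2]
    have hun : IsUnit (1 - c) := by
      refine X.toRingedSpace.isUnit_of_isUnit_germ ⊤ _ fun x hx => ?_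
      refine (X.mem_basicOpen (1 - c) x hx).1 ?_
      refine (X.evaluation_ne_zero_iff_mem_basicOpen x hx (1 - c)).1 ?_
      change X.Γevaluation x (1 - c) ≠ 0
      rw [map_sub, map_one, hcx, sub_zero]
      exact one_ne_zero
    exact hun.mul_left_eq_zero.1 (by rw [mul_sub, mul_one, hci.eq, sub_self])
  have h1 := key e e' he he' h
  have h2 := key e' e he' he fun x => (h x).symm
  linear_combination h1 - h2

end Idempotents

/-! ### Evaluation at points -/

section Evaluation

variable {k : Type u} [CommRing k]

/-- The residue field at a point of a scheme over `Spec k`. -/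
def Res (T : Over (Spec (.of k))) (t : T.left) : Type u := T.left.residueField t

instance (T : Over (Spec (.of k))) (t : T.left) : Field (Res T t) :=
  inferInstanceAs (Field (T.left.residueField t))

instance (T : Over (Spec (.of k))) (t : T.left) : Algebra k (Res T t) :=
  ((T.left.Γevaluation t).hom.comp (algebraMap k (Sec T))).toAlgebra

/-- The value of a global section at a point. -/
def evalAt (T : Over (Spec (.of k))) (t : T.left) : Sec T →ₐ[k] Res T t where
  __ := (T.left.Γevaluation t).hom
  commutes' _ := rfl

/-- Extension of residue fields along a morphism. -/
def resMap {T T' : Over (Spec (.of k))} (f : T' ⟶ T) (t : T'.left) :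
    Res T (f.left t) →+* Res T' t :=
  (f.left.residueFieldMap t).hom

lemma evalAt_secMap {T T' : Over (Spec (.of k))} (f : T' ⟶ T) (t : T'.left) (x : Sec T) :
    evalAt T' t (secMap f x) = resMap f t (evalAt T (f.left t) x) :=
  (Scheme.Γevaluation_naturality_apply f.left t x).symm

lemma resMap_algebraMap {T T' : Over (Spec (.of k))} (f : T' ⟶ T) (t : T'.left) (c : k) :
    resMap f t (algebraMap k _ c) = algebraMap k _ c := by
  have h := evalAt_secMap f t (algebraMap k _ c)
  rw [AlgHom.commutes, AlgHom.commutes, AlgHom.commutes] at h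
  exact h.symm

lemma sec_idempotent_ext {T : Over (Spec (.of k))} {e e' : Sec T} (he : IsIdempotentElem e)
    (he' : IsIdempotentElem e') (h : ∀ t, evalAt T t e = evalAt T t e') : e = e' :=
  idempotent_ext (X := T.left) he he' h

lemma exists_sec_idempotent (T : Over (Spec (.of k))) {U : Set T.left} (hU : IsClopen U) :
    ∃ e : Sec T, IsIdempotentElem e ∧ (∀ t ∈ U, evalAt T t e = 1) ∧
      (∀ t ∉ U, evalAt T t e = 0) :=
  exists_idempotent_of_isClopen hU

lemma isOpen_evalAt_ne_zero {T : Over (Spec (.of k))} (x : Sec T) :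
    IsOpen {t | evalAt T t x ≠ 0} := by
  have : {t | evalAt T t x ≠ 0} = (T.left.basicOpen (U := ⊤) x : Set T.left) := by
    ext t
    exact T.left.evaluation_ne_zero_iff_mem_basicOpen (U := ⊤) t trivial x
  rw [this]
  exact (T.left.basicOpen (U := ⊤) x).isOpen

/-! ### Points of finite sets -/

variable {J : Type*} {T : Over (Spec (.of k))}

/-- The idempotent section attached to a value of a locally constant function. -/
def lcIdem (Φ : LocallyConstant T.left J) (j : J) : Sec T :=
  (exists_sec_idempotent T (Φ.isLocallyConstant.isClopen_fiber j)).choose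

lemma lcIdem_idem (Φ : LocallyConstant T.left J) (j : J) : IsIdempotentElem (lcIdem Φ j) :=
  (exists_sec_idempotent T (Φ.isLocallyConstant.isClopen_fiber j)).choose_spec.1

lemma evalAt_lcIdem [DecidableEq J] (Φ : LocallyConstant T.left J) (j : J) (t : T.left) :
    evalAt T t (lcIdem Φ j) = if Φ t = j then 1 else 0 := by
  have h := (exists_sec_idempotent T (Φ.isLocallyConstant.isClopen_fiber j)).choose_spec.2
  split_ifs with h1
  · exact h.1 t h1
  · exact h.2 t h1

lemma lcIdem_ortho (Φ : LocallyConstant T.left J) : OrthogonalIdempotents (lcIdem Φ) := by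
  classical
  refine ⟨lcIdem_idem Φ, fun i j hij => ?_⟩
  refine sec_idempotent_ext ((lcIdem_idem Φ i).mul (lcIdem_idem Φ j)) .zero fun t => ?_
  rw [map_mul, evalAt_lcIdem, evalAt_lcIdem, map_zero]
  split_ifs with h1 h2 <;> simp_all

lemma sum_lcIdem [Fintype J] (Φ : LocallyConstant T.left J) : ∑ j, lcIdem Φ j = 1 := by
  classical
  refine sec_idempotent_ext (lcIdem_ortho Φ).isIdempotentElem_sum .one fun t => ?_
  simp [evalAt_lcIdem]

variable [Finite J]

/-- The algebra homomorphism attached to a locally constant function with values in a finite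
set. -/
def lcHom (Φ : LocallyConstant T.left J) : (J → k) →ₐ[k] Sec T :=
  letI := Fintype.ofFinite J
  AlgHom.ofLinearMap
    { toFun := fun c => ∑ j, c j • lcIdem Φ j
      map_add' := fun c d => by simp [add_smul, Finset.sum_add_distrib]
      map_smul' := fun c d => by simp [mul_smul, Finset.smul_sum] }
    (by simpa using sum_lcIdem Φ) (fun c d => by
      classical
      simp [Finset.sum_mul, Finset.mul_sum, (lcIdem_ortho Φ).mul_eq, mul_smul]
      exact Finset.sum_congr rfl fun j _ => smul_comm _ _ _)

lemma evalAt_lcHom (Φ : LocallyConstant T.left J) (c : J → k) (t : T.left) :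
    evalAt T t (lcHom Φ c) = algebraMap k _ (c (Φ t)) := by
  classical
  simp [lcHom, evalAt_lcIdem, Algebra.algebraMap_eq_smul_one]

/-- The functions on a finite set are spanned by idempotents, and an idempotent section is
determined by its values at points. -/
lemma lcHom_ext {g g' : (J → k) →ₐ[k] Sec T}
    (h : ∀ t c, evalAt T t (g c) = evalAt T t (g' c)) : g = g' := by
  classical
  refine AlgHom.toLinearMap_injective (LinearMap.pi_ext' fun j => LinearMap.ext_ring ?_)
  have hi : IsIdempotentElem (Pi.single j 1 : J → k) := by
    rw [IsIdempotentElem, ← Pi.single_mul, one_mul]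
  exact sec_idempotent_ext (hi.map g) (hi.map g') fun t => h t _

/-- Functions on finite sets are contravariantly functorial. -/
def funComap {J J' : Type*} (m : J → J') : (J' → k) →ₐ[k] (J → k) :=
  AlgHom.pi fun j => Pi.evalAlgHom k (fun _ => k) (m j)

lemma lcHom_map {J' : Type*} [Finite J'] (Φ : LocallyConstant T.left J) (m : J → J') :
    lcHom (Φ.map m) = (lcHom Φ).comp (funComap m) := by
  refine lcHom_ext fun t c => ?_
  rw [AlgHom.comp_apply, evalAt_lcHom, evalAt_lcHom]
  rfl

lemma secMap_comp_lcHom {T' : Over (Spec (.of k))} (f : T' ⟶ T) (Φ : LocallyConstant T.left J) :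
    (secMap f).comp (lcHom Φ) = lcHom (Φ.comap f.left.base.hom) := by
  refine lcHom_ext fun t c => ?_
  rw [AlgHom.comp_apply, evalAt_secMap, evalAt_lcHom, resMap_algebraMap, evalAt_lcHom]
  rfl

end Evaluation

/-! ### Points of finite algebras and constant group schemes -/

section FinitePoints

/-- The image of `χ` is a domain, finite over the algebraically closed `k`, hence equal to `k`. -/
lemma exists_algHom_factor {k C L : Type*} [Field k] [IsAlgClosed k] [CommRing C] [Algebra k C]
    [FiniteDimensional k C] [CommRing L] [IsDomain L] [Algebra k L] (χ : C →ₐ[k] L) :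
    ∃ χ₀ : C →ₐ[k] k, ∀ c, χ c = algebraMap k L (χ₀ c) := by
  have : FiniteDimensional k χ.range := Module.Finite.range χ.toLinearMap
  have hb : Function.Bijective (Algebra.ofId k χ.range) :=
    IsAlgClosed.algebraMap_bijective_of_isIntegral (k := k) (K := χ.range)
  let e := AlgEquiv.ofBijective (Algebra.ofId k χ.range) hb
  refine ⟨e.symm.toAlgHom.comp χ.rangeRestrict, fun c => ?_⟩
  have h : e (e.symm (χ.rangeRestrict c)) = χ.rangeRestrict c := e.apply_symm_apply _
  exact (congrArg Subtype.val h).symm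

/-- For each of the finitely many other characters choose a function that distinguishes it from `χ`,
subtract its value there, and multiply. -/
lemma exists_separating {k C : Type*} [Field k] [CommRing C] [Algebra k C]
    [FiniteDimensional k C] (χ : C →ₐ[k] k) :
    ∃ c : C, ∀ χ' : C →ₐ[k] k, χ' c ≠ 0 ↔ χ' = χ := by
  classical
  have := Fintype.ofFinite (C →ₐ[k] k)
  have h (χ' : C →ₐ[k] k) : ∃ c, χ' = χ ∨ χ c ≠ χ' c := by
    by_cases h : χ' = χ
    · exact ⟨0, .inl h⟩
    · obtain ⟨c, hc⟩ := DFunLike.ne_iff.1 h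
      exact ⟨c, .inr (Ne.symm hc)⟩
  choose c hc using h
  refine ⟨∏ χ' ∈ Finset.univ.erase χ, (c χ' - algebraMap k C (χ' (c χ'))), fun χ' => ?_⟩
  rw [map_prod, Finset.prod_ne_zero_iff]
  constructor
  · intro h
    by_contra hne
    exact h χ' (Finset.mem_erase.2 ⟨hne, Finset.mem_univ _⟩) (by simp)
  · rintro rfl a ha
    have := (hc a).resolve_left (Finset.mem_erase.1 ha).1
    simpa [sub_eq_zero] using this

variable {k : Type u} [Field k] [IsAlgClosed k] {T : Over (Spec (.of k))}

section

variable {C : Type*} [CommRing C] [Algebra k C] [FiniteDimensional k C]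

/-- The values of a point of a finite scheme over an algebraically closed field. -/
def valueAt (g : C →ₐ[k] Sec T) (t : T.left) : C →ₐ[k] k :=
  (exists_algHom_factor ((evalAt T t).comp g)).choose

lemma algebraMap_valueAt (g : C →ₐ[k] Sec T) (t : T.left) (c : C) :
    algebraMap k (Res T t) (valueAt g t c) = evalAt T t (g c) :=
  ((exists_algHom_factor ((evalAt T t).comp g)).choose_spec c).symm

/-- The fibre over `χ` is the nonvanishing locus of a separating section, hence open. -/
lemma isLocallyConstant_valueAt (g : C →ₐ[k] Sec T) : IsLocallyConstant (valueAt g) := by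
  refine IsLocallyConstant.iff_isOpen_fiber.2 fun χ => ?_
  obtain ⟨c, hc⟩ := exists_separating χ
  convert isOpen_evalAt_ne_zero (g c) using 1
  ext t
  rw [Set.mem_preimage, Set.mem_singleton_iff, ← hc, Set.mem_ofPred_eq, ← algebraMap_valueAt,
    Ne, Ne, FaithfulSMul.algebraMap_eq_zero_iff]

end

/-- Homomorphisms from the algebra of functions on a finite set to the global sections are locally
constant functions. -/
def lcEquiv (T : Over (Spec (.of k))) (J : Type*) [Finite J] :
    LocallyConstant T.left J ≃ ((J → k) →ₐ[k] Sec T) :=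
  Equiv.ofBijective lcHom (by
    classical
    constructor
    · intro Φ Φ' h
      refine LocallyConstant.ext fun t => ?_
      have h1 := congrArg (evalAt T t) (DFunLike.congr_fun h (Pi.single (Φ t) 1))
      rw [evalAt_lcHom, evalAt_lcHom, Pi.single_eq_same, map_one] at h1
      by_contra h2
      rw [Pi.single_eq_of_ne (Ne.symm h2), map_zero] at h1
      exact one_ne_zero h1
    · intro g
      have h (χ : (J → k) →ₐ[k] k) : ∃ j, χ = Pi.evalAlgHom _ _ j := AlgHom.eq_piEvalAlgHom χ
      choose j hj using h
      refine ⟨⟨fun t => j (valueAt g t), (isLocallyConstant_valueAt g).comp j⟩, ?_⟩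
      refine lcHom_ext fun t c => ?_
      rw [evalAt_lcHom, ← algebraMap_valueAt]
      exact congrArg (algebraMap k _) (DFunLike.congr_fun (hj (valueAt g t)) c).symm)

/-- The constant group scheme is representable. -/
def constantRepresentable (k : Type u) [Field k] [IsAlgClosed k] (Γ : Type u) [Group Γ] [Finite Γ] :
    (constantFunctor (Spec (.of k)) Γ ⋙ forget _).RepresentableBy
      ((Spec (.of (Γ → k))).asOver (Spec (.of k))) where
  homEquiv {T} := (specHoms T).symm.trans (lcEquiv T Γ).symm
  homEquiv_comp {T' T} t g := by
    obtain ⟨Φ, rfl⟩ := ((lcEquiv T Γ).trans (specHoms T)).surjective g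
    refine ((lcEquiv T' Γ).trans (specHoms T')).injective ?_
    have h : t ≫ specHoms T (lcHom Φ) = specHoms T' (lcHom (Φ.comap t.left.base.hom)) := by
      rw [comp_specHoms, secMap_comp_lcHom]
    refine Eq.trans ?_ (h.trans ?_)
    · exact (((specHoms T').symm.trans (lcEquiv T' Γ).symm).symm_apply_apply _)
    · refine congrArg (fun Ψ : LocallyConstant T.left Γ =>
        specHoms T' (lcHom (Ψ.comap t.left.base.hom))) ?_
      exact (((lcEquiv T Γ).trans (specHoms T)).symm_apply_apply Φ).symm

/-- Characters with values in a ring are the points of the dual group scheme. -/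
def dualPoints (k : Type*) [CommRing k] (M : Type*) [CommGroup M] (B : Type*) [CommRing B]
    [Algebra k B] : (M →* Bˣ) ≃* WithConv (MonoidAlgebra k M →ₐ[k] B) :=
  MonoidHom.toHomUnitsMulEquiv.symm.trans (MonoidAlgebra.liftMulEquiv k B M)

lemma dualPoints_single {k : Type*} [CommRing k] {M : Type*} [CommGroup M] {B : Type*} [CommRing B]
    [Algebra k B] (φ : M →* Bˣ) (m : M) :
    (dualPoints k M B φ).ofConv (MonoidAlgebra.single m 1) = φ m := by
  simp [dualPoints, MonoidAlgebra.liftMulEquiv]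

lemma ptMap_dualPoints {k : Type*} [CommRing k] {M : Type*} [CommGroup M] {B C : Type*}
    [CommRing B] [Algebra k B] [CommRing C] [Algebra k C] (F : B →ₐ[k] C) (φ : M →* Bˣ) :
    ptMap F (dualPoints k M B φ) = dualPoints k M C ((Units.map F.toMonoidHom).comp φ) := by
  refine WithConv.ext (MonoidAlgebra.algHom_ext (fun m => ?_) (Subsingleton.elim _ _))
  refine Eq.trans ?_ (dualPoints_single _ m).symm
  exact congrArg F (dualPoints_single φ m)

/-- The Cartier dual is representable. -/
def cartierRepresentable (k : Type u) [CommRing k] (M : Type u) [CommGroup M] :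
    (cartierDualFunctor (Spec (.of k)) M ⋙ forget _).RepresentableBy
      ((Spec (.of (MonoidAlgebra k M))).asOver (Spec (.of k))) where
  homEquiv {T} := ((dualPoints k M (Sec T)).trans (specPoints T)).symm.toEquiv
  homEquiv_comp {T' T} t g := by
    obtain ⟨φ, rfl⟩ := ((dualPoints k M (Sec T)).trans (specPoints T)).surjective g
    refine ((dualPoints k M (Sec T')).trans (specPoints T')).injective ?_
    have h : t ≫ specPoints T (dualPoints k M (Sec T) φ) =
        specPoints T' (dualPoints k M (Sec T') ((Units.map (secMap t).toMonoidHom).comp φ)) := by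
      rw [comp_specPoints, ptMap_dualPoints]
    refine Eq.trans ?_ (h.trans ?_)
    · exact ((dualPoints k M (Sec T')).trans (specPoints T')).apply_symm_apply _
    · refine congrArg (fun φ => specPoints T' (dualPoints k M (Sec T')
        ((Units.map (secMap t).toMonoidHom).comp φ))) ?_
      exact (((dualPoints k M (Sec T)).trans (specPoints T)).symm_apply_apply φ).symm

end FinitePoints

/-! ### Splitting of linearly reductive group schemes over algebraically closed fields -/

section Splitting

open WithConv

/-- Points: functoriality in the Hopf algebra. -/
def ptComap {k A A' : Type*} [CommRing k] [CommRing A] [HopfAlgebra k A] [CommRing A']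
    [HopfAlgebra k A'] (B : Type*) [CommRing B] [Algebra k B] (q : A →ₐc[k] A') :
    WithConv (A' →ₐ[k] B) →* WithConv (A →ₐ[k] B) where
  toFun g := toConv (g.ofConv.comp (q : A →ₐ[k] A'))
  map_one' := by
    refine WithConv.ext (AlgHom.ext fun a => ?_)
    exact congrArg (algebraMap k B) (CoalgHomClass.counit_comp_apply q a)
  map_mul' g h := congrArg toConv (AlgHom.convMul_comp_bialgHom_distrib g h q)

lemma ptComap_injective {k A A' : Type*} [CommRing k] [CommRing A] [HopfAlgebra k A] [CommRing A']
    [HopfAlgebra k A'] {B : Type*} [CommRing B] [Algebra k B] {q : A →ₐc[k] A'}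
    (hq : Function.Surjective q) : Function.Injective (ptComap B q) := fun g h hgh => by
  refine WithConv.ext (AlgHom.ext fun a => ?_)
  obtain ⟨b, rfl⟩ := hq a
  exact DFunLike.congr_fun (congrArg WithConv.ofConv hgh) b

lemma mem_range_ptComap {k A A' : Type*} [CommRing k] [CommRing A] [HopfAlgebra k A] [CommRing A']
    [HopfAlgebra k A'] {B : Type*} [CommRing B] [Algebra k B] {q : A →ₐc[k] A'}
    (hq : Function.Surjective q) {f : A} (hf : ∀ a, q a = 0 ↔ a ∈ Ideal.span {f})
    (g : WithConv (A →ₐ[k] B)) : g ∈ (ptComap B q).range ↔ g.ofConv f = 0 := by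
  constructor
  · rintro ⟨h, rfl⟩
    change h.ofConv (q f) = 0
    rw [(hf f).2 (Ideal.mem_span_singleton_self f), map_zero]
  · intro h
    have hker : RingHom.ker (q : A →ₐ[k] A') ≤ RingHom.ker g.ofConv := fun a ha => by
      obtain ⟨c, rfl⟩ := Ideal.mem_span_singleton'.1 ((hf a).1 ha)
      rw [RingHom.mem_ker, map_mul, h, mul_zero]
    refine ⟨toConv (AlgHom.liftOfSurjective (q : A →ₐ[k] A') hq g.ofConv hker), ?_⟩
    refine WithConv.ext (AlgHom.ext fun a => ?_)
    exact AlgHom.liftOfSurjective_apply (q : A →ₐ[k] A') hq g.ofConv hker a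

variable (k A : Type u) [CommRing k] [CommRing A] [HopfAlgebra k A]

/-- The functor of points of an affine group scheme. -/
def ptFunctor : (Over (Spec (.of k)))ᵒᵖ ⥤ GrpCat.{u} where
  obj T := GrpCat.of (WithConv (A →ₐ[k] Sec T.unop))
  map t := GrpCat.ofHom (ptMap (secMap t.unop))
  map_id T := by
    refine GrpCat.hom_ext (MonoidHom.ext fun g => WithConv.ext (AlgHom.ext fun a => ?_))
    change (𝟙 T.unop.left : T.unop.left ⟶ T.unop.left).appTop.hom (g.ofConv a) = g.ofConv a
    rw [Scheme.Hom.id_appTop]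
    rfl
  map_comp s t := by
    refine GrpCat.hom_ext (MonoidHom.ext fun g => WithConv.ext (AlgHom.ext fun a => ?_))
    change (t.unop.left ≫ s.unop.left).appTop.hom (g.ofConv a) = _
    rw [Scheme.Hom.comp_appTop]
    rfl

/-- The functor of points of an affine group scheme is represented by the spectrum. -/
def ptIso : yonedaGrpObj ((Spec (.of A)).asOver (Spec (.of k))) ≅ ptFunctor k A :=
  (NatIso.ofComponents (fun T => (specPoints (A := A) T.unop).toGrpIso) fun t =>
    GrpCat.hom_ext (MonoidHom.ext fun g => (comp_specPoints t.unop g).symm)).symm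

end Splitting

/-! ### Locally constant families of rational points, and values of points -/

section Universal

open WithConv

variable {k : Type u} [Field k] {A : Type u} [CommRing A] [HopfAlgebra k A]

variable (k A) in
/-- The universal point over the algebra of functions on the set of rational points. -/
def univPt : WithConv (A →ₐ[k] (WithConv (A →ₐ[k] k) → k)) :=
  toConv (AlgHom.pi fun g => g.ofConv)

lemma ptMap_eval_univPt {J : Type*} (m : J → WithConv (A →ₐ[k] k)) (j : J) :
    ptMap (Pi.evalAlgHom k (fun _ => k) j) (ptMap (funComap m) (univPt k A)) = m j := rfl

lemma pt_pi_ext {J : Type*} {g h : WithConv (A →ₐ[k] (J → k))}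
    (H : ∀ j, ptMap (Pi.evalAlgHom k (fun _ => k) j) g = ptMap (Pi.evalAlgHom k (fun _ => k) j) h) :
    g = h := by
  refine WithConv.ext (AlgHom.ext fun a => funext fun j => ?_)
  exact DFunLike.congr_fun (congrArg WithConv.ofConv (H j)) a

lemma ptMap_ofId_injective (L : Type*) [CommRing L] [Nontrivial L] [Algebra k L] :
    Function.Injective (ptMap (A := A) (Algebra.ofId k L)) := fun g h hgh => by
  refine WithConv.ext (AlgHom.ext fun a => ?_)
  exact FaithfulSMul.algebraMap_injective k L (DFunLike.congr_fun (congrArg WithConv.ofConv hgh) a)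

variable [FiniteDimensional k A]

/-- Locally constant families of rational points are points. -/
def lcPoints (A : Type u) [CommRing A] [HopfAlgebra k A] [FiniteDimensional k A]
    (T : Over (Spec (.of k))) :
    LocallyConstant T.left (WithConv (A →ₐ[k] k)) →* WithConv (A →ₐ[k] Sec T) :=
  MonoidHom.mk' (fun φ => ptMap (lcHom φ) (univPt k A)) fun φ ψ => by
    -- Multiplicativity is checked once, for the two projections from the set of pairs of rational
    -- points, and pulled back along the pair `(φ, ψ)`.
    let Φ : LocallyConstant T.left (WithConv (A →ₐ[k] k) × WithConv (A →ₐ[k] k)) :=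
      ⟨fun t => (φ t, ψ t), φ.isLocallyConstant.prodMk ψ.isLocallyConstant⟩
    have key (m : WithConv (A →ₐ[k] k) × WithConv (A →ₐ[k] k) → WithConv (A →ₐ[k] k)) :
        ptMap (lcHom (Φ.map m)) (univPt k A) =
          ptMap (lcHom Φ) (ptMap (funComap m) (univPt k A)) := by
      rw [lcHom_map]
      rfl
    have h : ptMap (funComap fun x : WithConv (A →ₐ[k] k) × WithConv (A →ₐ[k] k) => x.1 * x.2)
        (univPt k A) = ptMap (funComap Prod.fst) (univPt k A) *
          ptMap (funComap Prod.snd) (univPt k A) := by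
      refine pt_pi_ext fun j => ?_
      rw [map_mul, ptMap_eval_univPt, ptMap_eval_univPt, ptMap_eval_univPt]
    refine (key fun x => x.1 * x.2).trans ?_
    rw [h, map_mul, ← key, ← key]
    rfl

lemma ptMap_lcPoints {T T' : Over (Spec (.of k))} (t : T' ⟶ T)
    (φ : LocallyConstant T.left (WithConv (A →ₐ[k] k))) :
    ptMap (secMap t) (lcPoints A T φ) = lcPoints A T' (φ.comap t.left.base.hom) := by
  change toConv (((secMap t).comp (lcHom φ)).comp (univPt k A).ofConv) = _
  rw [secMap_comp_lcHom]
  rfl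

variable [IsAlgClosed k]

lemma ptMap_evalAt {T : Over (Spec (.of k))} (t : T.left) (g : WithConv (A →ₐ[k] Sec T)) :
    ptMap (evalAt T t) g = ptMap (Algebra.ofId k (Res T t)) (toConv (valueAt g.ofConv t)) := by
  refine WithConv.ext (AlgHom.ext fun a => ?_)
  exact (algebraMap_valueAt g.ofConv t a).symm

/-- The value of a point at a point of the base. -/
def valueHom (A : Type u) [CommRing A] [HopfAlgebra k A] [FiniteDimensional k A]
    {T : Over (Spec (.of k))} (t : T.left) :
    WithConv (A →ₐ[k] Sec T) →* WithConv (A →ₐ[k] k) :=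
  MonoidHom.mk' (fun g => toConv (valueAt g.ofConv t)) fun g h => by
    refine ptMap_ofId_injective (Res T t) ?_
    rw [map_mul, ← ptMap_evalAt, ← ptMap_evalAt, ← ptMap_evalAt, map_mul]

lemma valueHom_lcPoints {T : Over (Spec (.of k))} (t : T.left)
    (φ : LocallyConstant T.left (WithConv (A →ₐ[k] k))) :
    valueHom A t (lcPoints A T φ) = φ t := by
  refine ptMap_ofId_injective (Res T t) ?_
  refine (ptMap_evalAt t _).symm.trans ?_
  refine WithConv.ext (AlgHom.ext fun a => ?_)
  exact evalAt_lcHom φ ((univPt k A).ofConv a) t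

/-- The section `g(f)` is idempotent, so it vanishes if and only if it vanishes at each point; there
it is the value of `f` at a rational point, zero only for the identity. Thus the `T`-points of the
identity component are those with trivial values. -/
lemma IsComponentIdempotent.apply_eq_zero_iff {f : A} (hf : IsComponentIdempotent k f)
    {T : Over (Spec (.of k))} (g : WithConv (A →ₐ[k] Sec T)) :
    g.ofConv f = 0 ↔ ∀ t, valueHom A t g = 1 := by
  constructor
  · intro h t
    refine WithConv.ext (hf.eq_counit_of_eq_zero (g := (valueHom A t g).ofConv) ?_)
    refine FaithfulSMul.algebraMap_injective k (Res T t) ?_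
    rw [map_zero]
    refine (algebraMap_valueAt g.ofConv t f).trans ?_
    rw [h, _root_.map_zero]
  · intro h
    refine sec_idempotent_ext (hf.idem.map g.ofConv) .zero fun t => ?_
    rw [_root_.map_zero, ← algebraMap_valueAt]
    have h1 : valueAt g.ofConv t f = (1 : WithConv (A →ₐ[k] k)).ofConv f :=
      DFunLike.congr_fun (congrArg WithConv.ofConv (h t)) f
    rw [h1]
    change algebraMap k (Res T t) (Coalgebra.counit (R := k) f) = 0
    rw [hf.counit_eq_zero, _root_.map_zero]

end Universal

/-! ### The splitting over an algebraically closed field -/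

section WellSplit

open WithConv

variable {k : Type u} [Field k] [IsAlgClosed k] {A : Type u} [CommRing A] [HopfAlgebra k A]
  [FiniteDimensional k A]

/-- Taking values gives a homomorphism from `G(T)` to the locally constant functions `T → G(k)`. It
is split by `lcPoints`, and its kernel is the group of `T`-points of the identity component, which
is the dual of `M`. -/
theorem IsNormalizedIntegral.isWellSplit {I : A →ₗ[k] k} (hI : IsNormalizedIntegral I)
    {X : Over (Spec (.of k))} [GrpObj X] (e : yonedaGrpObj X ≅ ptFunctor k A) : IsWellSplit X := by
  obtain ⟨f, hf⟩ := exists_isComponentIdempotent k A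
  obtain ⟨M, _, _, q, hq, hqf⟩ := hf.exists_bialgHom hI
  let rH := constantRepresentable k (WithConv (A →ₐ[k] k))
  let rD := cartierRepresentable k M
  let H := (Spec (.of (WithConv (A →ₐ[k] k) → k))).asOver (Spec (.of k))
  let D := (Spec (.of (MonoidAlgebra k M))).asOver (Spec (.of k))
  let : GrpObj H := GrpObj.ofRepresentableBy H _ rH
  let : GrpObj D := GrpObj.ofRepresentableBy D _ rD
  let eH : yonedaGrpObj H ≅ constantFunctor (Spec (.of k)) (WithConv (A →ₐ[k] k)) :=
    yonedaGrpObjIsoOfRepresentableBy H _ rH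
  let eD : yonedaGrpObj D ≅ cartierDualFunctor (Spec (.of k)) M :=
    yonedaGrpObjIsoOfRepresentableBy D _ rD
  let d₀ (T : Over (Spec (.of k))) : (M →* (Sec T)ˣ) →* WithConv (A →ₐ[k] Sec T) :=
    (ptComap (Sec T) q).comp (dualPoints k M (Sec T)).toMonoidHom
  have hd₀ (T) : Function.Injective (d₀ T) :=
    (ptComap_injective hq).comp (dualPoints k M (Sec T)).injective
  have hr (T) (g : WithConv (A →ₐ[k] Sec T)) :
      (∃ φ, d₀ T φ = g) ↔ ∀ t, valueHom A t g = 1 := by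
    rw [← hf.apply_eq_zero_iff, ← mem_range_ptComap hq hqf]
    exact ⟨fun ⟨φ, h⟩ => ⟨_, h⟩, fun ⟨x, h⟩ => ⟨(dualPoints k M (Sec T)).symm x, by
      rw [← h]; exact congrArg (ptComap (Sec T) q) ((dualPoints k M (Sec T)).apply_symm_apply x)⟩⟩
  let d : cartierDualFunctor (Spec (.of k)) M ⟶ ptFunctor k A :=
    { app := fun T => GrpCat.ofHom (d₀ T.unop)
      naturality := fun _ T' t => GrpCat.hom_ext (MonoidHom.ext fun φ =>
        (congrArg (ptComap (Sec T'.unop) q) (ptMap_dualPoints (secMap t.unop) φ)).symm) }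
  let s : constantFunctor (Spec (.of k)) (WithConv (A →ₐ[k] k)) ⟶ ptFunctor k A :=
    { app := fun T => GrpCat.ofHom (lcPoints A T.unop)
      naturality := fun T T' t => GrpCat.hom_ext (MonoidHom.ext fun φ =>
        (ptMap_lcPoints t.unop φ).symm) }
  have hrange (T) (g : WithConv (A →ₐ[k] Sec T.unop)) :
      g ∈ ((eD.hom ≫ d).app T).hom.range ↔ ∀ t, valueHom A t g = 1 := by
    rw [← hr]
    constructor
    · rintro ⟨x, hx⟩
      exact ⟨(eD.hom.app T).hom x, hx⟩
    · rintro ⟨φ, hφ⟩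
      refine ⟨(eD.inv.app T).hom φ, Eq.trans ?_ hφ⟩
      exact congrArg (d₀ T.unop) congr($(eD.inv_hom_id_app T) φ)
  refine isWellSplit_of_exact (H := H) (Δ := D) ?_ ⟨M, inferInstance, inferInstance, ⟨eD⟩⟩ e
    (eD.hom ≫ d) (eH.hom ≫ s) ?_ ?_ ?_ ?_
  · refine ⟨_, _, inferInstance, ⟨eH⟩, fun p h0 => ?_⟩
    have h1 : (Nat.card (WithConv (A →ₐ[k] k)) : k) ≠ 0 := fun h => by
      have h2 := hf.card_mul_apply hI
      rw [h, zero_mul] at h2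
      exact zero_ne_one h2
    let F : k →+* (Spec (.of k)).residueField p :=
      (((Spec (.of k)).Γevaluation p).hom).comp (Scheme.ΓSpecIso (.of k)).inv.hom
    refine h1 (F.injective ?_)
    rw [map_natCast, map_zero]
    exact h0
  · intro T
    exact (hd₀ T.unop).comp ((eD.app T).groupIsoToMulEquiv.injective)
  · intro T
    refine ⟨fun n hn g => (hrange T _).2 fun t => ?_⟩
    have h1 (x y : WithConv (A →ₐ[k] Sec T.unop)) (hx : valueHom A t x = 1) :
        valueHom A t (y * x * y⁻¹) = 1 := by
      rw [map_mul, map_mul, hx, mul_one, map_inv, mul_inv_cancel]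
    exact h1 n g ((hrange T n).1 hn t)
  · intro T h hh
    refine (MulEquiv.map_eq_one_iff (eH.app T).groupIsoToMulEquiv).1 ?_
    refine LocallyConstant.ext fun t => ?_
    exact (valueHom_lcPoints t _).symm.trans ((hrange T _).1 hh t)
  · intro T g
    -- The complement component of `g` is its own function of values.
    let φ : LocallyConstant T.unop.left (WithConv (A →ₐ[k] k)) :=
      ⟨fun t => valueHom A t g, (isLocallyConstant_valueAt (T := T.unop) g.ofConv).comp toConv⟩
    have h1 : ((eH.hom ≫ s).app T).hom ((eH.inv.app T).hom φ) = lcPoints A T.unop φ :=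
      congrArg (lcPoints A T.unop) congr($(eH.inv_hom_id_app T) φ)
    have h2 (x y : WithConv (A →ₐ[k] Sec T.unop)) (hx : y = lcPoints A T.unop φ) (t)
        (ht : φ t = valueHom A t x) : valueHom A t (x * y⁻¹) = 1 := by
      rw [hx, map_mul, map_inv, valueHom_lcPoints, ht, mul_inv_cancel]
    exact ⟨(eH.inv.app T).hom φ, (hrange T _).2 fun t => h2 g _ h1 t rfl⟩

end WellSplit

/-! ### Well-split group schemes have normalized integrals -/

section Average

open WithConv

variable {k : Type*} [CommRing k] {A : Type*} [CommRing A] [HopfAlgebra k A]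

/-- `F(x(a₁) z(a₂)) = x(a₁) F(z(a₂))`, by `B`-linearity of `F`. -/
lemma toConv_comp_mul {B C : Type*} [CommRing B] [Algebra k B] [CommRing C] [Algebra k C]
    [Algebra B C] [IsScalarTower k B C] (F : C →ₗ[B] B) (x : WithConv (A →ₐ[k] B))
    (z : WithConv (A →ₗ[k] C)) :
    toConv (F.restrictScalars k ∘ₗ (ptLinear (ptMap (IsScalarTower.toAlgHom k B C) x) * z).ofConv) =
      ptLinear x * toConv (F.restrictScalars k ∘ₗ z.ofConv) := by
  refine WithConv.ext (LinearMap.ext fun a => ?_)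
  change F (LinearMap.mul' k C (TensorProduct.map
    ((IsScalarTower.toAlgHom k B C).comp x.ofConv).toLinearMap z.ofConv (Coalgebra.comul a))) =
    LinearMap.mul' k B (TensorProduct.map x.ofConv.toLinearMap (F.restrictScalars k ∘ₗ z.ofConv)
      (Coalgebra.comul a))
  generalize (Coalgebra.comul a : A ⊗[k] A) = t
  induction t with
  | zero => simp
  | add x y hx hy => simp only [map_add, hx, hy]
  | tmul x y => simp [← Algebra.smul_def]

/-- The coefficient of the unit element. -/
def coeffOne (B M : Type*) [CommRing B] [CommGroup M] : MonoidAlgebra B M →ₗ[B] B where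
  toFun x := x.coeff 1
  map_add' x y := by simp
  map_smul' c x := by simp

lemma coeffOne_single {B M : Type*} [CommRing B] [CommGroup M] [DecidableEq M] (m : M) (b : B) :
    coeffOne B M (MonoidAlgebra.single m b) = if m = 1 then b else 0 := by
  change (MonoidAlgebra.single m b).coeff 1 = _
  simp [Finsupp.single_apply]

/-- The canonical character of a group with values in its group algebra. -/
def univChar (B M : Type*) [CommRing B] [CommGroup M] : M →* (MonoidAlgebra B M)ˣ :=
  (MonoidAlgebra.of B M).toHomUnits

/-- A family of points of the dual of a group, averaged over that group. -/
def average {B M : Type*} [CommRing B] [Algebra k B] [CommGroup M]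
    (z : WithConv (A →ₐ[k] MonoidAlgebra B M)) : WithConv (A →ₗ[k] B) :=
  toConv ((coeffOne B M).restrictScalars k ∘ₗ z.ofConv.toLinearMap)

lemma average_mul {B M : Type*} [CommRing B] [Algebra k B] [CommGroup M]
    (x : WithConv (A →ₐ[k] B)) (z : WithConv (A →ₐ[k] MonoidAlgebra B M)) :
    average (ptMap (IsScalarTower.toAlgHom k B (MonoidAlgebra B M)) x * z) =
      ptLinear x * average z := by
  refine Eq.trans ?_ (toConv_comp_mul (coeffOne B M) x (ptLinear z))
  rw [← map_mul]
  rfl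

lemma average_ptMap {B M : Type*} [CommRing B] [Algebra k B] [CommGroup M]
    (ψ : MonoidAlgebra B M →ₐ[k] MonoidAlgebra B M)
    (h : ∀ x, coeffOne B M (ψ x) = coeffOne B M x)
    (z : WithConv (A →ₐ[k] MonoidAlgebra B M)) : average (ptMap ψ z) = average z :=
  WithConv.ext (LinearMap.ext fun _ => h _)

/-- The algebra endomorphism of a group algebra given by a character. -/
def charHom {B M : Type*} [CommRing B] [CommGroup M] (y : M →* (MonoidAlgebra B M)ˣ) :
    MonoidAlgebra B M →ₐ[B] MonoidAlgebra B M :=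
  MonoidAlgebra.lift B _ M ((Units.coeHom _).comp y)

lemma map_charHom_univChar {B M : Type*} [CommRing B] [CommGroup M]
    (y : M →* (MonoidAlgebra B M)ˣ) :
    (Units.map (charHom y).toMonoidHom).comp (univChar B M) = y := by
  refine MonoidHom.ext fun m => Units.ext ?_
  change charHom y (MonoidAlgebra.single m 1) = _
  simp [charHom]

/-- A substitution `m ↦ y m` fixes the coefficient of `1` as long as no `m ≠ 1` acquires one. Both
translations of the dual of `M` and conjugations on it are of this kind, which is why this
coefficient is the integral sought. -/
lemma coeffOne_charHom {B M : Type*} [CommRing B] [CommGroup M] (y : M →* (MonoidAlgebra B M)ˣ)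
    (h : ∀ m ≠ 1, coeffOne B M (y m) = 0) (x : MonoidAlgebra B M) :
    coeffOne B M (charHom y x) = coeffOne B M x := by
  classical
  induction x using MonoidAlgebra.induction_linear with
  | zero => simp
  | add x y hx hy => simp only [map_add, hx, hy]
  | single m b =>
    rw [coeffOne_single, charHom, MonoidAlgebra.lift_single, map_smul]
    change b • coeffOne B M (y m) = _
    split_ifs with hm
    · rw [hm, map_one, Units.val_one, MonoidAlgebra.one_def, coeffOne_single, if_pos rfl,
        smul_eq_mul, mul_one]
    · rw [h m hm, smul_zero]

end Average

/-- A splitting of the functor of points of an affine group scheme, over an extension `K` of the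
base, as a semidirect product of the dual of `M` and a constant group. -/
structure PointSplitting (k K A M Γ : Type u) [Field k] [Field K] [Algebra k K] [CommRing A]
    [HopfAlgebra k A] [CommGroup M] [Group Γ] where
  /-- The points coming from characters. -/
  d (B : Type u) [CommRing B] [Algebra k B] [Algebra K B] [IsScalarTower k K B] :
    (M →* Bˣ) →* WithConv (A →ₐ[k] B)
  /-- The rational points coming from the constant group. -/
  s : Γ →* WithConv (A →ₐ[k] K)
  ptMap_d {B C : Type u} [CommRing B] [Algebra k B] [Algebra K B] [IsScalarTower k K B]
    [CommRing C] [Algebra k C] [Algebra K C] [IsScalarTower k K C] (F : B →ₐ[K] C)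
    (φ : M →* Bˣ) :
    ptMap (F.restrictScalars k) (d B φ) = d C ((Units.map F.toMonoidHom).comp φ)
  d_injective (B : Type u) [CommRing B] [Algebra k B] [Algebra K B] [IsScalarTower k K B] :
    Function.Injective (d B)
  conj (B : Type u) [CommRing B] [Algebra k B] [Algebra K B] [IsScalarTower k K B] (g : Γ)
    (φ : M →* Bˣ) : ∃ ψ, ptMap (IsScalarTower.toAlgHom k K B) (s g) * d B φ *
      (ptMap (IsScalarTower.toAlgHom k K B) (s g))⁻¹ = d B ψ
  -- Only local `B` are allowed: on a disconnected spectrum the constant-group component need not be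
  -- a single element of `Γ`.
  exists_eq (B : Type u) [CommRing B] [Algebra k B] [Algebra K B] [IsScalarTower k K B]
    [IsLocalRing B] (x : WithConv (A →ₐ[k] B)) :
    ∃ φ g, x = d B φ * ptMap (IsScalarTower.toAlgHom k K B) (s g)

namespace PointSplitting

open WithConv

variable {k K A M Γ : Type u} [Field k] [Field K] [Algebra k K] [CommRing A] [HopfAlgebra k A]
  [CommGroup M] [Group Γ] (P : PointSplitting k K A M Γ)

/-- The points over a `K`-algebra coming from the constant group. -/
def sPt (B : Type u) [CommRing B] [Algebra k B] [Algebra K B] [IsScalarTower k K B] :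
    Γ →* WithConv (A →ₐ[k] B) :=
  (ptMap (IsScalarTower.toAlgHom k K B)).comp P.s

lemma ptMap_sPt {B C : Type u} [CommRing B] [Algebra k B] [Algebra K B] [IsScalarTower k K B]
    [CommRing C] [Algebra k C] [Algebra K C] [IsScalarTower k K C] (F : B →ₐ[K] C) (g : Γ) :
    ptMap (F.restrictScalars k) (P.sPt B g) = P.sPt C g := by
  refine WithConv.ext (AlgHom.ext fun a => ?_)
  exact F.commutes _

/-- Conjugation by a point of the constant group on the universal character. -/
def conjChar (g : Γ) : M →* (MonoidAlgebra K M)ˣ := (P.conj _ g (univChar K M)).choose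

lemma conj_univChar (g : Γ) : P.sPt (MonoidAlgebra K M) g * P.d _ (univChar K M) *
    (P.sPt (MonoidAlgebra K M) g)⁻¹ = P.d _ (P.conjChar g) :=
  (P.conj _ g (univChar K M)).choose_spec

lemma conj_map {C : Type u} [CommRing C] [Algebra k C] [Algebra K C] [IsScalarTower k K C]
    (F : MonoidAlgebra K M →ₐ[K] C) (g : Γ) :
    P.sPt C g * P.d C ((Units.map F.toMonoidHom).comp (univChar K M)) * (P.sPt C g)⁻¹ =
      P.d C ((Units.map F.toMonoidHom).comp (P.conjChar g)) := by
  have h := congrArg (ptMap (F.restrictScalars k)) (P.conj_univChar g)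
  rw [map_mul, map_mul, map_inv, P.ptMap_sPt, P.ptMap_d, P.ptMap_d] at h
  exact h

lemma map_conjChar_mul {C : Type u} [CommRing C] [Algebra k C] [Algebra K C] [IsScalarTower k K C]
    (F i₁ i₂ : MonoidAlgebra K M →ₐ[K] C)
    (hF : ∀ m, F (MonoidAlgebra.single m 1) =
      i₁ (MonoidAlgebra.single m 1) * i₂ (MonoidAlgebra.single m 1)) (g : Γ) (m : M) :
    F (P.conjChar g m) = i₁ (P.conjChar g m) * i₂ (P.conjChar g m) := by
  have h1 : (Units.map F.toMonoidHom).comp (univChar K M) =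
      (Units.map i₁.toMonoidHom).comp (univChar K M) *
        (Units.map i₂.toMonoidHom).comp (univChar K M) :=
    MonoidHom.ext fun m => Units.ext (hF m)
  have h := P.conj_map F g
  rw [h1, map_mul, ← conj_mul, P.conj_map i₁, P.conj_map i₂, ← map_mul] at h
  exact congrArg Units.val (DFunLike.congr_fun (P.d_injective _ h).symm m)

/-- Conjugation respects products of points, so the conjugated universal character is multiplicative
for the comultiplication. Thus conjugation carries `M` to group-like elements of the group algebra.
-/
lemma isGroupLikeElem_conjChar (g : Γ) (m : M) :
    IsGroupLikeElem K (P.conjChar g m : MonoidAlgebra K M) where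
  counit_eq_one := by
    have h := P.conj_map (Bialgebra.counitAlgHom K (MonoidAlgebra K M)) g
    have h1 : (Units.map (Bialgebra.counitAlgHom K (MonoidAlgebra K M)).toMonoidHom).comp
        (univChar K M) = 1 := by
      ext m
      change Bialgebra.counitAlgHom K (MonoidAlgebra K M) (MonoidAlgebra.single m 1) = 1
      simp
    rw [h1, map_one, mul_one, mul_inv_cancel, ← map_one (P.d K)] at h
    exact congrArg Units.val (DFunLike.congr_fun (P.d_injective K h).symm m)
  comul_eq_tmul_self := by
    refine (P.map_conjChar_mul (Bialgebra.comulAlgHom K (MonoidAlgebra K M))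
      Algebra.TensorProduct.includeLeft Algebra.TensorProduct.includeRight
      (fun m => ?_) g m).trans ?_
    · change Bialgebra.comulAlgHom K (MonoidAlgebra K M) (MonoidAlgebra.single m 1) =
        (MonoidAlgebra.single m 1 ⊗ₜ[K] 1) * (1 ⊗ₜ[K] MonoidAlgebra.single m 1)
      simp
    · change (P.conjChar g m : MonoidAlgebra K M) ⊗ₜ[K] (1 : MonoidAlgebra K M) *
        (1 : MonoidAlgebra K M) ⊗ₜ[K] (P.conjChar g m : MonoidAlgebra K M) = _
      rw [Algebra.TensorProduct.tmul_mul_tmul, one_mul, mul_one]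

lemma charHom_conjChar_inv (g : Γ) (m : M) :
    charHom (P.conjChar g⁻¹) (P.conjChar g m) = MonoidAlgebra.single m 1 := by
  have h := P.conj_map (charHom (P.conjChar g⁻¹)) g
  rw [map_charHom_univChar, ← P.conj_univChar, map_inv, inv_inv] at h
  have h2 : ∀ {G : Type u} [Group G] (x y : G), x * (x⁻¹ * y * x) * x⁻¹ = y := by
    intro G _ x y
    group
  rw [h2] at h
  exact congrArg Units.val (DFunLike.congr_fun (P.d_injective _ h).symm m)

/-- The group-like elements of the group algebra of `M` over `K` are the elements of `M`.
Conjugation by `g⁻¹` undoes that by `g`, so only `m = 1` is sent to `1`. -/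
lemma coeffOne_conjChar (g : Γ) (m : M) (hm : m ≠ 1) :
    coeffOne K M (P.conjChar g m) = 0 := by
  classical
  obtain ⟨m', hm'⟩ := MonoidAlgebra.isGroupLikeElem_iff_mem_range_of.1
    (P.isGroupLikeElem_conjChar g m)
  rw [← hm', MonoidAlgebra.of_apply, coeffOne_single, if_neg]
  rintro rfl
  refine hm ?_
  have h := P.charHom_conjChar_inv g m
  rw [← hm', map_one, map_one, MonoidAlgebra.one_def] at h
  exact (MonoidAlgebra.of_injective (R := K) h).symm

/-- The product of the universal character and a point of the constant group. -/
def gen (B : Type u) [CommRing B] [Algebra k B] [Algebra K B] [IsScalarTower k K B] (g : Γ) :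
    WithConv (A →ₐ[k] MonoidAlgebra B M) :=
  P.d _ (univChar B M) * P.sPt _ g

/-- `s(g) d(u) s(g') = (s(g) d(u) s(g)⁻¹) s(g g')`, and the conjugated universal character is a
substitution that preserves the coefficient of `1`. -/
lemma average_sPt_mul_gen (g g' : Γ) :
    ptLinear (P.s g) * average (P.gen K g') = average (P.gen K (g * g')) := by
  rw [← average_mul]
  have h : ptMap (IsScalarTower.toAlgHom k K (MonoidAlgebra K M)) (P.s g) * P.gen K g' =
      ptMap ((charHom (P.conjChar g)).restrictScalars k) (P.gen K (g * g')) := by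
    rw [gen, gen, map_mul, P.ptMap_d, map_charHom_univChar, P.ptMap_sPt, ← P.conj_univChar, map_mul]
    change P.sPt _ g * _ = _
    simp only [mul_assoc, inv_mul_cancel_left]
  rw [h, average_ptMap]
  exact fun x => coeffOne_charHom _ (P.coeffOne_conjChar g) x

/-- `d(φ) d(u) = d(φ u)`, and `φ u` is the substitution `m ↦ φ(m) m`, which preserves the
coefficient of `1`. -/
lemma d_mul_average_gen (B : Type u) [CommRing B] [Algebra k B] [Algebra K B]
    [IsScalarTower k K B] (φ : M →* Bˣ) (g : Γ) :
    ptLinear (P.d B φ) * average (P.gen B g) = average (P.gen B g) := by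
  classical
  rw [← average_mul]
  let F : B →ₐ[K] MonoidAlgebra B M := IsScalarTower.toAlgHom K B _
  let y : M →* (MonoidAlgebra B M)ˣ := (Units.map F.toMonoidHom).comp φ * univChar B M
  have hy (m : M) : (y m : MonoidAlgebra B M) = MonoidAlgebra.single m (φ m : B) := by
    change algebraMap B (MonoidAlgebra B M) (φ m) * MonoidAlgebra.single m 1 = _
    simp [MonoidAlgebra.single_mul_single]
  have h : ptMap (IsScalarTower.toAlgHom k B (MonoidAlgebra B M)) (P.d B φ) * P.gen B g =
      ptMap ((charHom y).restrictScalars k) (P.gen B g) := by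
    have h1 := P.ptMap_d F φ
    have h2 := P.ptMap_d ((charHom y).restrictScalars K) (univChar B M)
    have h3 := P.ptMap_sPt ((charHom y).restrictScalars K) g
    have h4 : (Units.map ((charHom y).restrictScalars K).toMonoidHom).comp (univChar B M) = y :=
      map_charHom_univChar y
    rw [h4] at h2
    rw [gen, map_mul]
    refine Eq.trans ?_ (congrArg₂ (· * ·) h2 h3).symm
    rw [map_mul, mul_assoc]
    exact congrArg (· * _) h1
  rw [h, average_ptMap]
  refine fun x => coeffOne_charHom _ (fun m hm => ?_) x
  rw [hy, coeffOne_single, if_neg hm]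

lemma average_gen_map (B : Type u) [CommRing B] [Algebra k B] [Algebra K B]
    [IsScalarTower k K B] (g : Γ) (a : A) :
    (average (P.gen B g)).ofConv a = algebraMap K B ((average (P.gen K g)).ofConv a) := by
  classical
  let F : MonoidAlgebra K M →ₐ[K] MonoidAlgebra B M :=
    MonoidAlgebra.lift K _ M (MonoidAlgebra.of B M)
  have hF (m : M) (c : K) : F (MonoidAlgebra.single m c) =
      MonoidAlgebra.single m (algebraMap K B c) := by
    simp [F, Algebra.smul_def, MonoidAlgebra.single_mul_single]
  have h : ptMap (F.restrictScalars k) (P.gen K g) = P.gen B g := by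
    rw [gen, map_mul, P.ptMap_d, P.ptMap_sPt]
    congr 2
    refine MonoidHom.ext fun m => Units.ext ?_
    exact (hF m 1).trans (by rw [map_one]; rfl)
  rw [← h]
  change coeffOne B M (F ((P.gen K g).ofConv a)) = algebraMap K B
    (coeffOne K M ((P.gen K g).ofConv a))
  generalize (P.gen K g).ofConv a = x
  induction x using MonoidAlgebra.induction_linear with
  | zero => simp
  | add x y hx hy => simp only [map_add, hx, hy]
  | single m c =>
    rw [hF, coeffOne_single, coeffOne_single]
    split_ifs <;> simp

variable [Finite Γ]

/-- The sum of the averages over the components. -/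
def total (B : Type u) [CommRing B] [Algebra k B] [Algebra K B] [IsScalarTower k K B] :
    WithConv (A →ₗ[k] B) :=
  letI := Fintype.ofFinite Γ
  ∑ g, average (P.gen B g)

lemma total_map (B : Type u) [CommRing B] [Algebra k B] [Algebra K B] [IsScalarTower k K B]
    (a : A) : (P.total B).ofConv a = algebraMap K B ((P.total K).ofConv a) := by
  simp only [total, WithConv.ofConv_sum, LinearMap.sum_apply, map_sum, P.average_gen_map B]

/-- Over `K`, translation by `g` permutes the summands; the general case follows because the total
is defined over `K`. -/
lemma sPt_mul_total (B : Type u) [CommRing B] [Algebra k B] [Algebra K B] [IsScalarTower k K B]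
    (g : Γ) : ptLinear (P.sPt B g) * P.total B = P.total B := by
  have h0 : ptLinear (P.s g) * P.total K = P.total K := by
    let := Fintype.ofFinite Γ
    change ptLinear (P.s g) * ∑ g', average (P.gen K g') = ∑ g', average (P.gen K g')
    rw [Finset.mul_sum]
    simp only [P.average_sPt_mul_gen]
    exact Fintype.sum_equiv (Equiv.mulLeft g) _ _ fun _ => rfl
  let F := IsScalarTower.toAlgHom k K B
  have h1 : P.total B = toConv (F.toLinearMap ∘ₗ (P.total K).ofConv) :=
    WithConv.ext (LinearMap.ext fun a => P.total_map B a)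
  have h2 := LinearMap.algHom_comp_convMul_distrib F (ptLinear (P.s g)) (P.total K)
  rw [h0] at h2
  rw [h1]
  exact WithConv.ext h2.symm

lemma d_mul_total (B : Type u) [CommRing B] [Algebra k B] [Algebra K B] [IsScalarTower k K B]
    (φ : M →* Bˣ) : ptLinear (P.d B φ) * P.total B = P.total B := by
  simp only [total, Finset.mul_sum, P.d_mul_average_gen]

lemma mul_total_of_isLocalRing (B : Type u) [CommRing B] [Algebra k B] [Algebra K B]
    [IsScalarTower k K B] [IsLocalRing B] (x : WithConv (A →ₐ[k] B)) :
    ptLinear x * P.total B = P.total B := by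
  obtain ⟨φ, g, rfl⟩ := P.exists_eq B x
  rw [map_mul, mul_assoc]
  refine (congrArg _ (P.sPt_mul_total B g)).trans (P.d_mul_total B φ)

/-- Equality in `B` can be tested in the localizations at maximal ideals, where every point is a
product of a character point and a constant one. -/
lemma mul_total (B : Type u) [CommRing B] [Algebra k B] [Algebra K B] [IsScalarTower k K B]
    (x : WithConv (A →ₐ[k] B)) : ptLinear x * P.total B = P.total B := by
  refine WithConv.ext (LinearMap.ext fun a => ?_)
  refine MaximalSpectrum.toPiLocalization_injective B (funext fun m => ?_)
  change algebraMap B (Localization.AtPrime m.asIdeal) _ =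
    algebraMap B (Localization.AtPrime m.asIdeal) _
  let F := IsScalarTower.toAlgHom k B (Localization.AtPrime m.asIdeal)
  have h1 : P.total (Localization.AtPrime m.asIdeal) =
      toConv (F.toLinearMap ∘ₗ (P.total B).ofConv) :=
    WithConv.ext (LinearMap.ext fun a => by
      rw [P.total_map, IsScalarTower.algebraMap_apply K B, ← P.total_map]
      rfl)
  have h2 := LinearMap.algHom_comp_convMul_distrib F (ptLinear x) (P.total B)
  have h3 := P.mul_total_of_isLocalRing (Localization.AtPrime m.asIdeal) (ptMap F x)
  rw [h1] at h3
  exact LinearMap.congr_fun (h2.trans (congrArg WithConv.ofConv h3)) a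

lemma total_one : (P.total K).ofConv 1 = Nat.card Γ := by
  have h (g : Γ) : (average (P.gen K g)).ofConv 1 = (1 : K) := by
    classical
    change coeffOne K M ((P.gen K g).ofConv 1) = 1
    rw [_root_.map_one, MonoidAlgebra.one_def, coeffOne_single, if_pos rfl]
  simp only [total, WithConv.ofConv_sum, LinearMap.sum_apply, h]
  let := Fintype.ofFinite Γ
  simp [Nat.card_eq_fintype_card]

/-- Divide the total by the order of `Γ` and compose with a `k`-linear retraction `r` of `K` onto
`k`. The invariance over `k` follows by applying `r ⊗ id` to that of the total under the generic
point with values in `K ⊗ A`. -/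
theorem exists_isNormalizedIntegral (P : PointSplitting k K A M Γ) (h : (Nat.card Γ : K) ≠ 0) :
    ∃ I : A →ₗ[k] k, IsNormalizedIntegral I := by
  obtain ⟨r, hr⟩ := (Algebra.linearMap k K).exists_leftInverse_of_injective
    (LinearMap.ker_eq_bot.2 (algebraMap k K).injective)
  have hr (c : k) : r (algebraMap k K c) = c := LinearMap.congr_fun hr c
  let E : A →ₗ[k] K := (P.total K).ofConv
  let n : K := Nat.card Γ
  refine ⟨r ∘ₗ (LinearMap.mulLeft K n⁻¹).restrictScalars k ∘ₗ E, ?_, fun a => ?_⟩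
  · change r (n⁻¹ * (P.total K).ofConv 1) = 1
    rw [P.total_one, inv_mul_cancel₀ h, ← map_one (algebraMap k K), hr]
  · have h1 := LinearMap.congr_fun (congrArg WithConv.ofConv (P.mul_total (K ⊗[k] A)
      (toConv Algebra.TensorProduct.includeRight))) a
    rw [P.total_map] at h1
    let R : K ⊗[k] A →ₗ[k] A := (TensorProduct.lid k A).toLinearMap ∘ₗ
      (r ∘ₗ (LinearMap.mulLeft K n⁻¹).restrictScalars k).rTensor A
    refine Eq.trans ?_ ((congrArg R h1).trans ?_)
    · change _ = R (LinearMap.mul' k _ (TensorProduct.map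
        (Algebra.TensorProduct.includeRight : A →ₐ[k] K ⊗[k] A).toLinearMap
        (P.total (K ⊗[k] A)).ofConv (Coalgebra.comul a)))
      generalize (Coalgebra.comul a : A ⊗[k] A) = t
      induction t with
      | zero => simp
      | add x y hx hy => simp only [map_add, hx, hy]
      | tmul x y =>
        rw [TensorProduct.map_tmul, P.total_map]
        simp [R, E]
    · change R ((P.total K).ofConv a ⊗ₜ 1) = _
      simp [R, E, Algebra.algebraMap_eq_smul_one]

end PointSplitting

/-! ### Points of affine group schemes and of their pullbacks -/

section PullbackPoints

open scoped CategoryTheory.Obj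

/-- Points of the pullback of a group object. -/
def overPullbackPoints {S U : Scheme.{u}} (f : U ⟶ S) (X : Over S) [GrpObj X] (T : Over U) :
    ((Over.map f).obj T ⟶ X) ≃* (T ⟶ (Over.pullback f).obj X) where
  __ := (Over.mapPullbackAdj f).homEquiv T X
  map_mul' a b := by
    change (Over.mapPullbackAdj f).homEquiv T X (a * b) =
      (Over.mapPullbackAdj f).homEquiv T X a * (Over.mapPullbackAdj f).homEquiv T X b
    rw [Adjunction.homEquiv_unit, Adjunction.homEquiv_unit, Adjunction.homEquiv_unit,
      Functor.map_mul, MonObj.comp_mul]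

/-- Points of the pullback of a group scheme. -/
def pullbackPoints {S U : Scheme.{u}} (f : U ⟶ S) (G : Scheme.{u}) [G.Over S]
    [GrpObj (G.asOver S)] (T : Over U) :
    ((Over.map f).obj T ⟶ G.asOver S) ≃* (T ⟶ (pullback (G ↘ S) f).asOver U) :=
  overPullbackPoints f (G.asOver S) T

lemma comp_pullbackPoints {S U : Scheme.{u}} (f : U ⟶ S) (G : Scheme.{u}) [G.Over S]
    [GrpObj (G.asOver S)] {T T' : Over U} (t : T' ⟶ T) (x : (Over.map f).obj T ⟶ G.asOver S) :
    t ≫ pullbackPoints f G T x = pullbackPoints f G T' ((Over.map f).map t ≫ x) :=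
  ((Over.mapPullbackAdj f).homEquiv_naturality_left t x).symm

end PullbackPoints

/-! ### From finite group schemes over a field to finite-dimensional Hopf algebras -/

section AffineGroup

/-- If the comultiplication comes from a monoid structure `N` on the spectrum, passing back from the
Hopf algebra recovers the multiplication of `N`. This is needed to identify `G` with the spectrum of
its global sections as a group. -/
lemma mul_specAsOver_eq {R : CommRingCat.{u}} {A : CommRingCat.{u}} [Bialgebra R A]
    [N : MonObj ((algSpec R).obj (.op (CommAlgCat.of R A)))]
    (h : (CommAlgCat.ofHom (Bialgebra.comulAlgHom R A)).op =
      ((algSpec.fullyFaithful (R := R)).monObj (op (CommAlgCat.of R A))).mul) :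
    (instMonObjSpecAsOverSpec (R := R) (A := A)).mul.left = N.mul.left := by
  have h2 : Spec.map (CommRingCat.ofHom (Bialgebra.comulAlgHom R A)) =
      (pullbackSpecIso R A A).inv ≫ N.mul.left := by
    have h3 := congrArg (fun x => ((algSpec R).map x).left) h
    exact h3.trans (congrArg Over.Hom.left ((algSpec.fullyFaithful (R := R)).map_preimage _))
  refine (mul_spec_asOver_spec_left (R := R) (A := A)).trans ?_
  refine (congrArg ((pullbackSpecIso R A A).hom ≫ ·) h2).trans ?_
  exact Iso.hom_inv_id_assoc (pullbackSpecIso R A A) N.mul.left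

lemma mul_comp_iso_hom {C : Type*} [Category C] [CartesianMonoidalCategory C] {T X Y : C}
    [MonObj X] [M : MonObj Y] (e : X ≅ Y) (h : M.mul = (MonObj.ofIso e).mul) (a b : T ⟶ X) :
    (a * b) ≫ e.hom = (a ≫ e.hom) * (b ≫ e.hom) := by
  rw [Hom.mul_def, Hom.mul_def, h, MonObj.ofIso_mul]
  simp

/-- Postcomposition with an isomorphism that is compatible with multiplication. -/
def homMulEquivOfIso {C : Type*} [Category C] [CartesianMonoidalCategory C] {X Y : C}
    [MonObj X] [M : MonObj Y] (e : X ≅ Y) (h : M.mul = (MonObj.ofIso e).mul) (T : C) :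
    (T ⟶ X) ≃* (T ⟶ Y) where
  toFun a := a ≫ e.hom
  invFun b := b ≫ e.inv
  left_inv a := by simp
  right_inv b := by simp
  map_mul' := mul_comp_iso_hom e h

/-- An isomorphism compatible with multiplication induces an isomorphism of functors of points. -/
def yonedaGrpObjIso {C : Type*} [Category C] [CartesianMonoidalCategory C] {X Y : C}
    [GrpObj X] [M : GrpObj Y] (e : X ≅ Y) (h : M.mul = (MonObj.ofIso e).mul) :
    yonedaGrpObj X ≅ yonedaGrpObj Y :=
  NatIso.ofComponents (fun T => (homMulEquivOfIso e h T.unop).toGrpIso) fun _ =>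
    GrpCat.hom_ext (MonoidHom.ext fun _ => Category.assoc _ _ _)

/-- The Hopf algebra of global sections of an affine group scheme. -/
abbrev hopfSections (R : CommRingCat.{u}) (G : Scheme.{u}) [G.Over (Spec R)]
    [GrpObj (G.asOver (Spec R))] [IsAffine G] : HopfAlgebra R Γ(G, ⊤) := inferInstance

theorem nonempty_yonedaGrpObj_isoSpec (R : CommRingCat.{u}) (G : Scheme.{u}) [G.Over (Spec R)]
    [GrpObj (G.asOver (Spec R))] [IsAffine G] :
    Nonempty (yonedaGrpObj (G.asOver (Spec R)) ≅ @yonedaGrpObj _ _ _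
      (@Scheme.asOver (Spec (.of Γ(G, ⊤))) (Spec R) (@specOverSpec R (.of Γ(G, ⊤)) (hopfSections R G).toAlgebra))
      (@instGrpObjSpecAsOverSpec R (.of Γ(G, ⊤)) (hopfSections R G))) := by
  let N : MonObj ((algSpec R).obj <| .op <| CommAlgCat.of R Γ(G, ⊤)) :=
      .ofIso <| G.isoSpec.asOver (Spec R)
  have h := mul_specAsOver_eq (R := R) (A := Γ(G, ⊤)) (N := N) rfl
  exact ⟨@yonedaGrpObjIso _ _ _ _ _ _ (@instGrpObjSpecAsOverSpec R (.of Γ(G, ⊤)) (hopfSections R G))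
    (G.isoSpec.asOver (Spec R)) (Over.OverMorphism.ext h)⟩

lemma finite_algebraMap_sections (R : CommRingCat.{u}) (G : Scheme.{u}) [G.Over (Spec R)]
    [IsAffine G] [IsFinite (G ↘ Spec R)] : (algebraMap R Γ(G, ⊤)).Finite := by
  rw [algebraMap_presheafObj]
  refine (IsFinite.SpecMap_iff (Spec.fullyFaithful.preimage (G.isoSpec.inv ≫ G ↘ Spec R)).unop).1 ?_
  have h : Spec.map (Spec.fullyFaithful.preimage (G.isoSpec.inv ≫ G ↘ Spec R)).unop =
    G.isoSpec.inv ≫ G ↘ Spec R := Spec.fullyFaithful.map_preimage _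
  rw [h]
  infer_instance

theorem exists_hopfAlgebra (k : Type u) [Field k] (G : Scheme.{u}) [G.Over (Spec (.of k))]
    [GrpObj (G.asOver (Spec (.of k)))] [IsFinite (G ↘ Spec (.of k))] :
    ∃ (A : Type u) (_ : CommRing A) (_ : HopfAlgebra k A), FiniteDimensional k A ∧
      Nonempty (yonedaGrpObj (G.asOver (Spec (.of k))) ≅ ptFunctor k A) ∧
      (IsLinearlyReductive (.of k) G ↔ InvariantsExact.{u} k A) := by
  have hG : IsAffine G := isAffine_of_isAffineHom (G ↘ Spec (.of k))
  refine ⟨Γ(G, ⊤), inferInstance, hopfSections (.of k) G, ?_, ?_, ?_⟩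
  · exact finite_algebraMap_sections (.of k) G
  · obtain ⟨e⟩ := nonempty_yonedaGrpObj_isoSpec (.of k) G
    exact ⟨e ≪≫ @ptIso k Γ(G, ⊤) _ _ (hopfSections (.of k) G)⟩
  · exact Iff.rfl

end AffineGroup

/-! ### Base change of linearly reductive group schemes -/

section BaseChange

open WithConv

/-- Points of the base change of an affine group scheme. -/
def ptBaseChange {k K A B : Type*} [CommRing k] [CommRing K] [Algebra k K] [CommRing A]
    [HopfAlgebra k A] [CommRing B] [Algebra k B] [Algebra K B] [IsScalarTower k K B] :
    WithConv (K ⊗[k] A →ₐ[K] B) ≃* WithConv (A →ₐ[k] B) where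
  toFun g := toConv ((g.ofConv.restrictScalars k).comp Algebra.TensorProduct.includeRight)
  invFun x := toConv (Algebra.TensorProduct.lift (Algebra.ofId K B) x.ofConv
    fun _ _ => Commute.all _ _)
  left_inv g := by
    refine WithConv.ext (Algebra.TensorProduct.ext (Subsingleton.elim _ _) (AlgHom.ext fun a => ?_))
    simp
  right_inv x := by
    refine WithConv.ext (AlgHom.ext fun a => ?_)
    simp
  map_mul' g h := by
    refine WithConv.ext (AlgHom.ext fun a => ?_)
    change LinearMap.mul' K B (TensorProduct.map g.ofConv.toLinearMap h.ofConv.toLinearMap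
      (Coalgebra.comul ((1 : K) ⊗ₜ[k] a))) = LinearMap.mul' k B (TensorProduct.map
        ((g.ofConv.restrictScalars k).comp Algebra.TensorProduct.includeRight).toLinearMap
        ((h.ofConv.restrictScalars k).comp Algebra.TensorProduct.includeRight).toLinearMap
        (Coalgebra.comul a))
    rw [TensorProduct.comul_tmul, CommSemiring.comul_apply]
    generalize (Coalgebra.comul a : A ⊗[k] A) = z
    induction z with
    | zero => simp
    | add x y hx hy => simp only [TensorProduct.tmul_add, map_add, hx, hy]
    | tmul x y => simp

variable {k K : Type u} [Field k] [Field K] [Algebra k K]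

variable (k) in
/-- The algebra structure over the smaller field. -/
abbrev algebraSec (T : Over (Spec (.of K))) : Algebra k (Sec T) :=
  inferInstanceAs (Algebra k (Sec
    ((Over.map (Spec.map (CommRingCat.ofHom (algebraMap k K)))).obj T)))

lemma isScalarTower_sec (T : Over (Spec (.of K))) :
    letI := algebraSec k T
    IsScalarTower k K (Sec T) :=
  letI := algebraSec k T
  .of_algebraMap_eq' (congrArg CommRingCat.Hom.hom
    (appTop_comp_map T.hom (CommRingCat.ofHom (algebraMap k K))))

variable {A : Type u} [CommRing A] [HopfAlgebra k A]

/-- Points of the base change, in terms of global sections. -/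
def ptSecBaseChange (T : Over (Spec (.of K))) : WithConv (K ⊗[k] A →ₐ[K] Sec T) ≃*
    WithConv (A →ₐ[k] Sec ((Over.map (Spec.map (CommRingCat.ofHom (algebraMap k K)))).obj T)) :=
  letI := algebraSec k T
  letI := isScalarTower_sec (k := k) T
  ptBaseChange (k := k) (K := K) (A := A) (B := Sec T)

/-- For `T` over `K`, the points of the pullback are the `T`-points of `G`, that is, `k`-algebra
maps from `A` to the sections of `T`, or equivalently `K`-algebra maps from `K ⊗ A`. -/
theorem nonempty_pullback_iso (G : Scheme.{u}) [G.Over (Spec (.of k))]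
    [GrpObj (G.asOver (Spec (.of k)))]
    (e : yonedaGrpObj (G.asOver (Spec (.of k))) ≅ ptFunctor k A) :
    Nonempty (yonedaGrpObj ((pullback (G ↘ Spec (.of k))
      (Spec.map (CommRingCat.ofHom (algebraMap k K)))).asOver (Spec (.of K))) ≅
      ptFunctor K (K ⊗[k] A)) := by
  let f := Spec.map (CommRingCat.ofHom (algebraMap k K))
  refine ⟨(NatIso.ofComponents (fun T => (((ptSecBaseChange T.unop).trans
    (e.symm.app (op ((Over.map f).obj T.unop))).groupIsoToMulEquiv).trans
    (pullbackPoints f G T.unop)).toGrpIso) fun {T T'} t => ?_).symm⟩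
  refine GrpCat.hom_ext (MonoidHom.ext fun g => ?_)
  refine Eq.trans ?_ (comp_pullbackPoints f G t.unop _).symm
  refine congrArg (pullbackPoints f G T'.unop) ?_
  exact congr($(e.inv.naturality ((Over.map f).map t.unop).op) (ptSecBaseChange T.unop g))

end BaseChange

/-! ### Splittings of functors of points -/

section Forward

/-- The spectrum of an algebraic closure is an fpqc cover of `Spec k`, and the integral extends to
it. -/
theorem isLocallyWellSplit_of_isNormalizedIntegral {k A : Type u} [Field k] [CommRing A]
    [HopfAlgebra k A] [FiniteDimensional k A] {I : A →ₗ[k] k} (hI : IsNormalizedIntegral I)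
    {G : Scheme.{u}} [G.Over (Spec (.of k))] [GrpObj (G.asOver (Spec (.of k)))]
    (e : yonedaGrpObj (G.asOver (Spec (.of k))) ≅ ptFunctor k A) :
    IsLocallyWellSplit (Spec (.of k)) G := by
  let K := AlgebraicClosure k
  let f : Spec (.of K) ⟶ Spec (.of k) := Spec.map (CommRingCat.ofHom (algebraMap k K))
  have hf : Flat f := Flat.SpecMap_iff.2 (RingHom.flat_algebraMap_iff.2 inferInstance)
  have hs : Surjective f := by
    refine ⟨fun x => ⟨(⊥ : PrimeSpectrum K), Subsingleton.elim (α := PrimeSpectrum k) _ _⟩⟩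
  obtain ⟨e'⟩ := nonempty_pullback_iso (K := K) G e
  have h : IsWellSplit ((pullback (G ↘ Spec (.of k)) f).asOver (Spec (.of K))) :=
    hI.baseChange.isWellSplit e'
  exact ⟨.singleton f f.singleton_mem_fpqcPrecoverage, fun _ => h⟩

end Forward

/-! ### The inclusions of the two factors of a well-split group scheme -/

section Split

variable {S : Scheme.{u}}

lemma map_inr_conj {N Q P : Type*} [Group N] [Group Q] [Group P] {φ : Q →* MulAut N}
    (E : N ⋊[φ] Q →* P) (g : Q) (n : N) :
    E (SemidirectProduct.inr g) * E (SemidirectProduct.inl n) * (E (SemidirectProduct.inr g))⁻¹ =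
      E (SemidirectProduct.inl (φ g n)) := by
  rw [SemidirectProduct.inl_aut, map_mul, map_mul, map_inv, map_inv]

lemma map_inl_mul_map_inr {N Q P : Type*} [Group N] [Group Q] [Group P] {φ : Q →* MulAut N}
    (E : N ⋊[φ] Q →* P) (x : N ⋊[φ] Q) :
    E (SemidirectProduct.inl x.left) * E (SemidirectProduct.inr x.right) = E x := by
  rw [← map_mul, SemidirectProduct.inl_left_mul_inr_right]

lemma IsWellSplit.exists_split {X : Over S} [GrpObj X] (h : IsWellSplit X) :
    ∃ (M Γ : Type u) (_ : CommGroup M) (_ : Group Γ) (_ : Finite Γ)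
      (d : cartierDualFunctor S M ⟶ yonedaGrpObj X) (s : constantFunctor S Γ ⟶ yonedaGrpObj X),
      (∀ T, Function.Injective (d.app T).hom) ∧
      (∀ T g φ, ∃ ψ, (s.app T).hom g * (d.app T).hom φ * ((s.app T).hom g)⁻¹ = (d.app T).hom ψ) ∧
      (∀ T x, ∃ φ g, x = (d.app T).hom φ * (s.app T).hom g) ∧
      ∀ p : S, (Nat.card Γ : S.residueField p) ≠ 0 := by
  obtain ⟨H, Δ, _, _, φ, ⟨Γ, _, _, ⟨eH⟩, hΓ⟩, ⟨M, _, _, ⟨eD⟩⟩, ⟨e⟩⟩ := h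
  let l : yonedaGrpObj Δ ⟶ semidirectFunctor φ :=
    { app := fun T => GrpCat.ofHom SemidirectProduct.inl
      naturality := fun T T' t => GrpCat.hom_ext (MonoidHom.ext fun x =>
        SemidirectProduct.ext rfl ((yonedaGrpObj H).map t).hom.map_one.symm) }
  let r : yonedaGrpObj H ⟶ semidirectFunctor φ :=
    { app := fun T => GrpCat.ofHom SemidirectProduct.inr
      naturality := fun T T' t => GrpCat.hom_ext (MonoidHom.ext fun x =>
        SemidirectProduct.ext ((yonedaGrpObj Δ).map t).hom.map_one.symm rfl) }
  refine ⟨M, Γ, inferInstance, inferInstance, inferInstance, eD.inv ≫ l ≫ e.inv,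
    eH.inv ≫ r ≫ e.inv, fun T => ?_, fun T g ψ => ?_, fun T x => ?_, hΓ⟩
  · exact ((e.app T).symm.groupIsoToMulEquiv.injective.comp SemidirectProduct.inl_injective).comp
      (eD.app T).symm.groupIsoToMulEquiv.injective
  · let g' := (eH.inv.app T).hom g
    let ψ' := (eD.inv.app T).hom ψ
    refine ⟨(eD.hom.app T).hom (φ.act T.unop g' ψ'), ?_⟩
    have h1 : (eD.inv.app T).hom ((eD.hom.app T).hom (φ.act T.unop g' ψ')) =
      φ.act T.unop g' ψ' := congr($(eD.hom_inv_id_app T) _)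
    have h2 : ((eD.inv ≫ l ≫ e.inv).app T).hom ((eD.hom.app T).hom (φ.act T.unop g' ψ')) =
        (e.inv.app T).hom (SemidirectProduct.inl (φ := φ.act T.unop) (φ.act T.unop g' ψ')) :=
      congrArg (fun z => (e.inv.app T).hom (SemidirectProduct.inl (φ := φ.act T.unop) z)) h1
    exact (map_inr_conj (φ := φ.act T.unop) (e.inv.app T).hom g' ψ').trans h2.symm
  · let x' : (T.unop ⟶ Δ) ⋊[φ.act T.unop] (T.unop ⟶ H) := (e.hom.app T).hom x
    refine ⟨(eD.hom.app T).hom x'.left, (eH.hom.app T).hom x'.right, ?_⟩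
    have h1 : (eD.inv.app T).hom ((eD.hom.app T).hom x'.left) = x'.left :=
      congr($(eD.hom_inv_id_app T) _)
    have h2 : (eH.inv.app T).hom ((eH.hom.app T).hom x'.right) = x'.right :=
      congr($(eH.hom_inv_id_app T) _)
    have h3 : (e.inv.app T).hom x' = x := congr($(e.hom_inv_id_app T) x)
    refine (h3.symm.trans (map_inl_mul_map_inr (e.inv.app T).hom x').symm).trans ?_
    exact congrArg₂ (fun y z => (e.inv.app T).hom (SemidirectProduct.inl y) *
      (e.inv.app T).hom (SemidirectProduct.inr z)) h1.symm h2.symm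

end Split

/-! ### Local splittings give splittings of points -/

section LocalSplitting

open WithConv

variable {k K : Type u} [Field k] [Field K] [Algebra k K] {U : Scheme.{u}}

/-- The spectrum of an algebra over the coordinate field of a point of `U`. -/
def specOver (p : Spec (.of K) ⟶ U) (B : Type u) [CommRing B] [Algebra K B] : Over U :=
  Over.mk (Spec.map (CommRingCat.ofHom (algebraMap K B)) ≫ p)

/-- Functoriality of `specOver`. -/
def specOverMap (p : Spec (.of K) ⟶ U) {B C : Type u} [CommRing B] [Algebra K B] [CommRing C]
    [Algebra K C] (F : B →ₐ[K] C) : specOver p C ⟶ specOver p B :=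
  Over.homMk (Spec.map (CommRingCat.ofHom F.toRingHom)) (by
    change Spec.map (CommRingCat.ofHom F.toRingHom) ≫
      Spec.map (CommRingCat.ofHom (algebraMap K B)) ≫ p =
        Spec.map (CommRingCat.ofHom (algebraMap K C)) ≫ p
    rw [← Spec.map_comp_assoc, ← CommRingCat.ofHom_comp]
    exact congrArg (fun g => Spec.map (CommRingCat.ofHom g) ≫ p) F.comp_algebraMap)

variable {f : U ⟶ Spec (.of k)} {p : Spec (.of K) ⟶ U}

lemma specOver_hom_comp (hp : p ≫ f = Spec.map (CommRingCat.ofHom (algebraMap k K))) (B : Type u) [CommRing B] [Algebra k B] [Algebra K B]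
    [IsScalarTower k K B] : ((Over.map f).obj (specOver p B)).hom =
      Spec.map (CommRingCat.ofHom (algebraMap k B)) := by
  change (Spec.map (CommRingCat.ofHom (algebraMap K B)) ≫ p) ≫ f = _
  rw [Category.assoc, hp, ← Spec.map_comp, ← CommRingCat.ofHom_comp,
    ← IsScalarTower.algebraMap_eq]

variable (hp : p ≫ f = Spec.map (CommRingCat.ofHom (algebraMap k K)))

/-- The global sections of the spectrum of an algebra. -/
def secSpecOver (B : Type u) [CommRing B] [Algebra k B] [Algebra K B] [IsScalarTower k K B] :
    Sec ((Over.map f).obj (specOver p B)) ≃ₐ[k] B :=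
  AlgEquiv.ofRingEquiv (f := (Scheme.ΓSpecIso (.of B)).commRingCatIsoToRingEquiv) fun c => by
    have h : (Scheme.ΓSpecIso (.of k)).inv ≫ ((Over.map f).obj (specOver p B)).hom.appTop ≫
        (Scheme.ΓSpecIso (.of B)).hom = CommRingCat.ofHom (algebraMap k B) := by
      rw [specOver_hom_comp hp]
      refine (congrArg ((Scheme.ΓSpecIso (.of k)).inv ≫ ·)
        (Scheme.ΓSpecIso_naturality (CommRingCat.ofHom (algebraMap k B)))).trans ?_
      exact Iso.inv_hom_id_assoc _ _
    exact congr($h c)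

lemma secSpecOver_comp_secMap {B C : Type u} [CommRing B] [Algebra k B] [Algebra K B]
    [IsScalarTower k K B] [CommRing C] [Algebra k C] [Algebra K C] [IsScalarTower k K C]
    (F : B →ₐ[K] C) :
    (secSpecOver hp C).toAlgHom.comp (secMap ((Over.map f).map (specOverMap p F))) =
      (F.restrictScalars k).comp (secSpecOver hp B).toAlgHom :=
  AlgHom.ext fun b => congr($(Scheme.ΓSpecIso_naturality (CommRingCat.ofHom F.toRingHom)) b)

variable {A : Type u} [CommRing A] [HopfAlgebra k A] {G : Scheme.{u}} [G.Over (Spec (.of k))]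
  [GrpObj (G.asOver (Spec (.of k)))] (e : yonedaGrpObj (G.asOver (Spec (.of k))) ≅ ptFunctor k A)

/-- Points, functoriality for isomorphisms. -/
def ptCongr {k A B C : Type*} [CommRing k] [CommRing A] [HopfAlgebra k A] [CommRing B]
    [Algebra k B] [CommRing C] [Algebra k C] (F : B ≃ₐ[k] C) :
    WithConv (A →ₐ[k] B) ≃* WithConv (A →ₐ[k] C) where
  __ := ptMap F.toAlgHom
  invFun := ptMap F.symm.toAlgHom
  left_inv _ := WithConv.ext (AlgHom.ext fun _ => F.symm_apply_apply _)
  right_inv _ := WithConv.ext (AlgHom.ext fun _ => F.apply_symm_apply _)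

/-- The points of a pullback, in terms of the Hopf algebra. -/
def specOverPoints (B : Type u) [CommRing B] [Algebra k B] [Algebra K B] [IsScalarTower k K B] :
    (specOver p B ⟶ (pullback (G ↘ Spec (.of k)) f).asOver U) ≃* WithConv (A →ₐ[k] B) :=
  ((pullbackPoints f G (specOver p B)).symm.trans
    (e.app (op ((Over.map f).obj (specOver p B)))).groupIsoToMulEquiv).trans
      (ptCongr (secSpecOver hp B))

lemma ptMap_specOverPoints {B C : Type u} [CommRing B] [Algebra k B] [Algebra K B]
    [IsScalarTower k K B] [CommRing C] [Algebra k C] [Algebra K C] [IsScalarTower k K C]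
    (F : B →ₐ[K] C) (x : specOver p B ⟶ (pullback (G ↘ Spec (.of k)) f).asOver U) :
    ptMap (F.restrictScalars k) (specOverPoints hp e B x) =
      specOverPoints hp e C (specOverMap p F ≫ x) := by
  obtain ⟨y, rfl⟩ := (pullbackPoints f G (specOver p B)).surjective x
  have h1 : (pullbackPoints f G (specOver p B)).symm (pullbackPoints f G (specOver p B) y) = y :=
    MulEquiv.symm_apply_apply _ _
  have h2 : (pullbackPoints f G (specOver p C)).symm
      (specOverMap p F ≫ pullbackPoints f G (specOver p B) y) =
        (Over.map f).map (specOverMap p F) ≫ y := by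
    rw [comp_pullbackPoints]
    exact MulEquiv.symm_apply_apply _ _
  have h3 : (e.hom.app (op ((Over.map f).obj (specOver p C)))).hom
      ((Over.map f).map (specOverMap p F) ≫ y) =
        ptMap (secMap ((Over.map f).map (specOverMap p F)))
          ((e.hom.app (op ((Over.map f).obj (specOver p B)))).hom y) :=
    congr($(e.hom.naturality ((Over.map f).map (specOverMap p F)).op) y)
  change ptMap (F.restrictScalars k) (ptMap (secSpecOver hp B).toAlgHom
    ((e.hom.app (op ((Over.map f).obj (specOver p B)))).hom
      ((pullbackPoints f G (specOver p B)).symm (pullbackPoints f G (specOver p B) y)))) =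
    ptMap (secSpecOver hp C).toAlgHom ((e.hom.app (op ((Over.map f).obj (specOver p C)))).hom
      ((pullbackPoints f G (specOver p C)).symm
        (specOverMap p F ≫ pullbackPoints f G (specOver p B) y)))
  rw [h1, h2]
  refine Eq.trans ?_ (congrArg (ptMap (secSpecOver hp C).toAlgHom) h3.symm)
  refine congrArg (fun q => toConv (q.comp
    ((e.hom.app (op ((Over.map f).obj (specOver p B)))).hom y).ofConv))
      (secSpecOver_comp_secMap hp F).symm

/-- Characters with values in the units of a ring, as characters with values in global sections. -/
def charSec (M B : Type u) [CommGroup M] [CommRing B] :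
    (M →* Bˣ) ≃* (M →* Γ(Spec (.of B), ⊤)ˣ) :=
  MulEquiv.monoidHomCongrRight
    (Units.mapEquiv (Scheme.ΓSpecIso (.of B)).commRingCatIsoToRingEquiv.symm.toMulEquiv)

/-- Every point of the spectrum of a local ring specializes to the closed point, so an open fibre
containing the closed point is everything. -/
lemma exists_const_eq {B Γ : Type u} [CommRing B] [IsLocalRing B]
    (Φ : LocallyConstant (Spec (.of B)) Γ) : ∃ g, Φ = LocallyConstant.const _ g := by
  refine ⟨Φ (IsLocalRing.closedPoint B), LocallyConstant.ext fun x => ?_⟩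
  exact (IsLocalRing.specializes_closedPoint x).mem_open
    (Φ.isLocallyConstant.isOpen_fiber (Φ (IsLocalRing.closedPoint B))) rfl

end LocalSplitting

/-! ### Locally well-split group schemes are linearly reductive -/

section Converse

open WithConv

variable {k K : Type u} [Field k] [Field K] [Algebra k K] {U : Scheme.{u}}
  {f : U ⟶ Spec (.of k)} {p : Spec (.of K) ⟶ U}
  (hp : p ≫ f = Spec.map (CommRingCat.ofHom (algebraMap k K)))
  {A : Type u} [CommRing A] [HopfAlgebra k A] {G : Scheme.{u}} [G.Over (Spec (.of k))]
  [GrpObj (G.asOver (Spec (.of k)))] (e : yonedaGrpObj (G.asOver (Spec (.of k))) ≅ ptFunctor k A)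
  {M Γ : Type u} [CommGroup M] [Group Γ]

lemma charSec_comp (p : Spec (.of K) ⟶ U) {B C : Type u} [CommRing B] [Algebra K B] [CommRing C]
    [Algebra K C] (F : B →ₐ[K] C) (φ : M →* Bˣ) :
    ((cartierDualFunctor U M).map (specOverMap p F).op).hom (charSec M B φ) =
      charSec M C ((Units.map F.toMonoidHom).comp φ) :=
  MonoidHom.ext fun m => Units.ext
    congr($(Scheme.ΓSpecIso_inv_naturality (CommRingCat.ofHom F.toRingHom)) (φ m : B)).symm

/-- The inclusion of the constant functions. -/
def constSec (T : Scheme.{u}) (Γ : Type u) [Group Γ] : Γ →* LocallyConstant T Γ :=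
  LocallyConstant.constMonoidHom

/-- A splitting of a group scheme after a base change gives a splitting of the points of its
Hopf algebra. -/
def pointSplitting
    (d : cartierDualFunctor U M ⟶ yonedaGrpObj ((pullback (G ↘ Spec (.of k)) f).asOver U))
    (s : constantFunctor U Γ ⟶ yonedaGrpObj ((pullback (G ↘ Spec (.of k)) f).asOver U))
    (h₁ : ∀ T, Function.Injective (d.app T).hom)
    (h₂ : ∀ T g φ, ∃ ψ, (s.app T).hom g * (d.app T).hom φ * ((s.app T).hom g)⁻¹ =
      (d.app T).hom ψ)
    (h₃ : ∀ T x, ∃ φ g, x = (d.app T).hom φ * (s.app T).hom g) :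
    PointSplitting k K A M Γ :=
  let d' (B : Type u) [CommRing B] [Algebra k B] [Algebra K B] [IsScalarTower k K B] :
      (M →* Bˣ) →* WithConv (A →ₐ[k] B) :=
    ((specOverPoints hp e B).toMonoidHom.comp (d.app (op (specOver p B))).hom).comp
      (charSec M B).toMonoidHom
  let s' (B : Type u) [CommRing B] [Algebra k B] [Algebra K B] [IsScalarTower k K B] :
      Γ →* WithConv (A →ₐ[k] B) :=
    ((specOverPoints hp e B).toMonoidHom.comp (s.app (op (specOver p B))).hom).comp (constSec _ Γ)
  have hs (B : Type u) [CommRing B] [Algebra k B] [Algebra K B] [IsScalarTower k K B] (g : Γ) :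
      ptMap (IsScalarTower.toAlgHom k K B) (s' K g) = s' B g := by
    refine (ptMap_specOverPoints hp e (Algebra.ofId K B) _).trans ?_
    exact congrArg (specOverPoints hp e B)
      congr($(s.naturality (specOverMap p (Algebra.ofId K B)).op) (constSec _ Γ g)).symm
  { d := d'
    s := s' K
    ptMap_d {B C} _ _ _ _ _ _ _ _ F φ := by
      refine (ptMap_specOverPoints hp e F _).trans (congrArg (specOverPoints hp e C) ?_)
      refine congr($(d.naturality (specOverMap p F).op) (charSec M B φ)).symm.trans ?_
      exact congrArg (d.app (op (specOver p C))).hom (charSec_comp p F φ)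
    d_injective B _ _ _ _ φ ψ h := by
      have h' : specOverPoints hp e B ((d.app (op (specOver p B))).hom (charSec M B φ)) =
        specOverPoints hp e B ((d.app (op (specOver p B))).hom (charSec M B ψ)) := h
      exact (charSec M B).injective (h₁ _ ((specOverPoints hp e B).injective h'))
    conj B _ _ _ _ g φ := by
      obtain ⟨ψ, hψ⟩ := h₂ (op (specOver p B)) (constSec _ Γ g) (charSec M B φ)
      refine ⟨(charSec M B).symm ψ, ?_⟩
      rw [hs]
      have h := congrArg (specOverPoints hp e B) hψ
      have h' := congrArg (fun y => specOverPoints hp e B ((d.app (op (specOver p B))).hom y))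
        ((charSec M B).apply_symm_apply ψ)
      refine Eq.trans ?_ (h.trans h'.symm)
      refine Eq.symm ((map_mul (specOverPoints hp e B) _ _).trans ?_)
      exact congrArg₂ (· * ·) (map_mul (specOverPoints hp e B) _ _)
        (map_inv (specOverPoints hp e B) _)
    exists_eq B _ _ _ _ _ x := by
      obtain ⟨φ, Φ, h⟩ := h₃ (op (specOver p B)) ((specOverPoints hp e B).symm x)
      obtain ⟨g, hg⟩ := exists_const_eq (B := B) Φ
      refine ⟨(charSec M B).symm φ, g, ?_⟩
      rw [hs]
      have h' := congrArg (fun y => specOverPoints hp e B ((d.app (op (specOver p B))).hom y))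
        ((charSec M B).apply_symm_apply φ)
      have h'' := congrArg (fun y => specOverPoints hp e B ((s.app (op (specOver p B))).hom y)) hg
      refine ((specOverPoints hp e B).apply_symm_apply x).symm.trans ?_
      refine (congrArg (specOverPoints hp e B) h).trans ?_
      refine (map_mul (specOverPoints hp e B) _ _).trans ?_
      exact congrArg₂ (· * ·) h'.symm h'' }

/-- Some member of the cover has a point `u` above the point of `Spec k`. The splitting pulls back
to the residue field `K` of `u`, where tameness makes the order of `Γ` nonzero. -/
theorem IsLocallyWellSplit.exists_isNormalizedIntegral
    (e : yonedaGrpObj (G.asOver (Spec (.of k))) ≅ ptFunctor k A)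
    (h : IsLocallyWellSplit (Spec (.of k)) G) : ∃ I : A →ₗ[k] k, IsNormalizedIntegral I := by
  obtain ⟨𝒰, h𝒰⟩ := h
  obtain ⟨i, u, -⟩ := ((Scheme.presieve₀_mem_precoverage_iff 𝒰.toPreZeroHypercover).1 𝒰.mem₀.2).1 (⊥ : PrimeSpectrum k)
  have hi := h𝒰 i
  let K := (𝒰.X i).residueField u
  let p : Spec (.of K) ⟶ 𝒰.X i := (𝒰.X i).fromSpecResidueField u
  let : Algebra k K := (Spec.preimage (p ≫ 𝒰.f i)).hom.toAlgebra
  have hp : p ≫ 𝒰.f i = Spec.map (CommRingCat.ofHom (algebraMap k K)) :=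
    (Spec.map_preimage _).symm
  obtain ⟨M, Γ, _, _, _, d, s, h₁, h₂, h₃, h₄⟩ := hi.exists_split
  exact (pointSplitting hp e d s h₁ h₂ h₃).exists_isNormalizedIntegral (h₄ u)

end Converse

/-! ### Well-split group schemes are locally well-split -/

section WellSplit

lemma IsWellSplit.of_iso {S : Scheme.{u}} {X Y : Over S} [GrpObj X] [GrpObj Y]
    (e : yonedaGrpObj X ≅ yonedaGrpObj Y) (h : IsWellSplit Y) : IsWellSplit X := by
  obtain ⟨H, Δ, hH, hΔ, φ, h₁, h₂, ⟨e'⟩⟩ := h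
  exact ⟨H, Δ, hH, hΔ, φ, h₁, h₂, ⟨e ≪≫ e'⟩⟩

theorem IsWellSplit.isLocallyWellSplit {S G : Scheme.{u}} [G.Over S] [GrpObj (G.asOver S)]
    (h : IsWellSplit (G.asOver S)) : IsLocallyWellSplit S G := by
  let e : yonedaGrpObj ((pullback (G ↘ S) (𝟙 S)).asOver S) ≅ yonedaGrpObj (G.asOver S) :=
    NatIso.ofComponents (fun T => ((pullbackPoints (𝟙 S) G T.unop).symm.trans
      ((yonedaGrpObj (G.asOver S)).mapIso
        ((Over.mapId S).app T.unop).symm.op).groupIsoToMulEquiv).toGrpIso) fun {T T'} t =>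
      GrpCat.hom_ext (MonoidHom.ext fun x => by
        obtain ⟨y, rfl⟩ := (pullbackPoints (𝟙 S) G T.unop).surjective x
        have h1 : (pullbackPoints (𝟙 S) G T.unop).symm (pullbackPoints (𝟙 S) G T.unop y) = y :=
          MulEquiv.symm_apply_apply _ _
        have h2 : (pullbackPoints (𝟙 S) G T'.unop).symm
            (t.unop ≫ pullbackPoints (𝟙 S) G T.unop y) = (Over.map (𝟙 S)).map t.unop ≫ y := by
          rw [comp_pullbackPoints]
          exact MulEquiv.symm_apply_apply _ _
        change (Over.mapId S).inv.app T'.unop ≫ (pullbackPoints (𝟙 S) G T'.unop).symm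
            (t.unop ≫ pullbackPoints (𝟙 S) G T.unop y) =
          t.unop ≫ (Over.mapId S).inv.app T.unop ≫
            (pullbackPoints (𝟙 S) G T.unop).symm (pullbackPoints (𝟙 S) G T.unop y)
        rw [h1, h2]
        exact ((Over.mapId S).inv.naturality_assoc t.unop y).symm)
  have h' : IsWellSplit ((pullback (G ↘ S) (𝟙 S)).asOver S) := h.of_iso e
  exact ⟨.singleton (𝟙 S) (𝟙 S : S ⟶ S).singleton_mem_fpqcPrecoverage, fun _ => h'⟩

end WellSplit

end LinRed

end

theorem mainTheorem3 (k : Type u) [Field k] (G : Scheme.{u}) [G.Over (Spec (.of k))]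
    [GrpObj (G.asOver (Spec (.of k)))] [IsFinite (G ↘ Spec (.of k))] :
    (LinRed.IsLinearlyReductive (.of k) G ↔ LinRed.IsLocallyWellSplit (Spec (.of k)) G) ∧
    (IsAlgClosed k → (LinRed.IsLocallyWellSplit (Spec (.of k)) G ↔
      LinRed.IsWellSplit (G.asOver (Spec (.of k))))) := by
  obtain ⟨A, _, _, _, ⟨e⟩, hA⟩ := LinRed.exists_hopfAlgebra k G
  refine ⟨hA.trans ⟨fun h => ?_, fun h => ?_⟩, fun _ => ⟨fun h => ?_, fun h => ?_⟩⟩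
  · obtain ⟨I, hI⟩ := h.exists_isNormalizedIntegral
    exact LinRed.isLocallyWellSplit_of_isNormalizedIntegral hI e
  · obtain ⟨I, hI⟩ := h.exists_isNormalizedIntegral e
    exact hI.invariantsExact
  -- The splitting on the cover is not descended: it yields an integral over `k`, from which a new
  -- splitting over `k` is built.
  · obtain ⟨I, hI⟩ := h.exists_isNormalizedIntegral e
    exact hI.isWellSplit e
  · exact h.isLocallyWellSplit
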